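/- **Setting.** Combinators are the terms built from $S$ and $K$ by binary application; the size of a term is its number of applications. Normal-order reduction contracts the leftmost outermost redex ($Kxy\to x$, $Sxyz\to xz(yz)$). Let $r_{n,k}$ be the number of terms of size $k$ that reach normal form in exactly $n$ normal-order steps, $c_k$ the number of all terms of size $k$, $R_n(z)=\sum_k r_{n,k}z^k$ and $C(z)=\sum_k c_kz^k$. *Grammars.* Trees are built by binary application from the symbols $S$, $K$, $\mathcal C$ and $R_0,R_1,\dots$; $X$ stands for $S$ or $K$. A tree $X\alpha_1\cdots\alpha_m$ with $m\ge1$ is called complex. The productions of the normal-order reduction grammars are defined by recursion on $n$. The set $R_0$ is $\{S,\ K,\ SR_0,\ KR_0,\ SR_0R_0\}$. The set $R_{n+1}$ consists of $SR_{n+1}$, $KR_{n+1}$, $SR_iR_j$ for $i+j=n+1$, $KR_n\mathcal C$, and, for every production $X\alpha_1\cdots\alpha_m$ of $R_n$: - the K-expansions $K(X\alpha_1\cdots\alpha_k)\,\mathcal C\,\alpha_{k+1}\cdots\alpha_m$ for $0\le k\le m-1$; - the S-expansions $S(X\alpha_1\cdots\alpha_k)\,\varphi_l\,\varphi_r\,\alpha_{k+3}\cdots\alpha_m$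 for $0\le k\le m-2$ and $\varphi_l\varphi_r\in\mathrm{RS}(\alpha_{k+1},\alpha_{k+2})$. Here $\alpha\trianglerighteq\beta$ means that $\beta$ arises from $\alpha$ by finitely many replacements, at any positions, of $\mathcal C$ by $S$, $K$, $\mathcal C\mathcal C$ or some $R_i$, or of $R_i$ by one of its productions. The mesh set $\mathrm{MS}(\alpha,\beta)$ is given as follows. - $\mathrm{MS}(X\alpha_1\cdots\alpha_m,X\beta_1\cdots\beta_m)$, $m\ge1$, consists of all $X\gamma_1\cdots\gamma_m$ where $\gamma_i=\beta_i$ if $\alpha_i\trianglerighteq\beta_i$; otherwise $\gamma_i=\alpha_i$ if $\beta_i\trianglerighteq\alpha_i$; otherwise $\gamma_i\in\mathrm{MS}(\alpha_i,\beta_i)$. - If one argument is $R_k$ and the other is complex, $\mathrm{MS}$ is the union of the mesh sets obtained by replacing $R_k$ by each of its productions. - In all other cases it is empty. The rewriting set is given as follows. - $\mathrm{RS}(\alpha,S)=\mathrm{RS}(\alpha,K)=\emptyset$ and $\mathrm{RS}(\alpha,\mathcal C)=\{\mathcal C\alpha\}$. - $\mathrm{RS}(\alpha,R_k)$ is the union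 of $\mathrm{RS}(\alpha,p)$ over the productions $p$ of $R_k$. - $\mathrm{RS}(\alpha,X\beta_1\cdots\beta_m)$, $m\ge1$, consists of all $X\beta_1\cdots\beta_{m-1}\gamma$ where $\gamma=\beta_m$ if $\alpha\trianglerighteq\beta_m$; otherwise $\gamma=\alpha$ if $\beta_m\trianglerighteq\alpha$; otherwise $\gamma\in\mathrm{MS}(\alpha,\beta_m)$. Let $\Phi(R_n)$ be the set of productions of $R_n$ in which the symbol $R_n$ does not occur. For a tree $\alpha$ let $k(\alpha)$, $c(\alpha)$, $r_i(\alpha)$ be its numbers of applications, of symbols $\mathcal C$ and of symbols $R_i$. **Theorem.** For each $n\ge0$ the generating function $R_n(z)$ has a computable closed form. That is: every $R_n$ has finitely many productions, and there is an algorithm which, given $n$, outputs an expression built from $z$ and natural numbers by $+,-,\cdot,/$ and $\sqrt{\phantom{x}}$ which, for every complex $z$ with $0<|z|<1/8$ (principal square roots), is well defined, with no zero denominator and no radicand in $(-\infty,0]$, and equals the sum of the convergent series $R_n(z)$. Moreover, for these $z$, the series $C(z)$ converges, $$C(z)=\frac{1-\sqrt{1-8z}}{2z},\qquad R_0(z)=\frac{1-2z-\sqrt{1-4z-4z^2}}{2z^2},$$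 and for every $n\ge1$ $$R_n(z)=\frac{1}{\sqrt{1-4z-4z^2}}\sum_{\alpha\in\Phi(R_n)}z^{k(\alpha)}\,C(z)^{c(\alpha)}\prod_{i=0}^{n-1}R_i(z)^{r_i(\alpha)} .$$ -/

import Mathlib

namespace SK

/-! ### Combinatory logic terms and normal-order reduction -/

/-- Terms over the primitive combinators `S`, `K` with binary application. -/
inductive Term : Type
  | S : Term
  | K : Term
  | app : Term → Term → Term

/-- The size of a term: the number of applications. -/
def Term.size : Term → ℕ
  | .S => 0
  | .K => 0
  | .app x y => x.size + y.size + 1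

/-- One step of normal-order reduction: contract the leftmost outermost redex, where
`K x y` contracts to `x` and `S x y z` contracts to `x z (y z)`.
The value is `none` exactly when the term has no redex, i.e. is in normal form. -/
def Term.step : Term → Option Term
  | .app (.app .K x) _ => some x
  | .app (.app (.app .S x) y) z => some (.app (.app x z) (.app y z))
  | .app x y =>
    match x.step with
    | some x' => some (.app x' y)
    | none =>
      match y.step with
      | some y' => some (.app x y')
      | none => none
  | .S => none
  | .K => none

/-- `Reduces n x`: normal-order reduction brings `x` to normal form in exactly `n` steps. -/
def Reduces : ℕ → Term → Prop
  | 0, x => x.step = none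
  | n + 1, x => ∃ y, x.step = some y ∧ Reduces n y

/-- The number of terms of size `k`. -/
noncomputable def numTerms (k : ℕ) : ℕ :=
  Set.ncard {x : Term | x.size = k}

/-- The number of terms of size `k` that normalize in exactly `n` normal-order steps. -/
noncomputable def numReducing (n k : ℕ) : ℕ :=
  Set.ncard {x : Term | x.size = k ∧ Reduces n x}

/-! ### Trees: right-hand sides of grammar productions -/

/-- Trees over the terminals `S`, `K` and application and the non-terminals `C` (all terms)
and `R i` (terms normalizing in `i` steps). -/
inductive Tree : Type
  | S : Tree
  | K : Tree
  | C : Tree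
  | R : ℕ → Tree
  | app : Tree → Tree → Tree

namespace Tree

/-- The number of applications in a tree. -/
def numApp : Tree → ℕ
  | .S => 0
  | .K => 0
  | .C => 0
  | .R _ => 0
  | .app a b => a.numApp + b.numApp + 1

/-- The number of occurrences of the non-terminal `C`. -/
def numC : Tree → ℕ
  | .S => 0
  | .K => 0
  | .C => 1
  | .R _ => 0
  | .app a b => a.numC + b.numC

/-- The number of occurrences of the non-terminal `R i`. -/
def numR (i : ℕ) : Tree → ℕ
  | .S => 0
  | .K => 0
  | .C => 0
  | .R j => if j = i then 1 else 0
  | .app a b => a.numR i + b.numR i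

end Tree

/-! In the following, `P k` is the set of productions of the non-terminal `R k`. -/

/-- One rewriting step at any position of a tree: a derivation step of the grammar
(`C → S | K | C C`, and `R k → p` for a production `p` of `R k`), or the replacement
of `C` by some `R n`. -/
inductive Step (P : ℕ → Set Tree) : Tree → Tree → Prop
  | c_S : Step P .C .S
  | c_K : Step P .C .K
  | c_app : Step P .C (.app .C .C)
  | c_R (n : ℕ) : Step P .C (.R n)
  | prod {k : ℕ} {p : Tree} : p ∈ P k → Step P (.R k) p
  | left {a a' b : Tree} : Step P a a' → Step P (.app a b) (.app a' b)
  | right {a b b' : Tree} : Step P b b' → Step P (.app a b) (.app a b')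

/-- The rewriting relation: reflexive-transitive closure of `Step`. -/
def Rew (P : ℕ → Set Tree) : Tree → Tree → Prop :=
  Relation.ReflTransGen (Step P)

mutual

/-- `Mesh P a b c`: the tree `c` belongs to the mesh set of `a` and `b`. If both trees are
complex, their meshes are computed argumentwise. If one of them is `R k` and the other one is
complex, the mesh set is the union over all productions of `R k`. Otherwise it is empty. -/
inductive Mesh (P : ℕ → Set Tree) : Tree → Tree → Tree → Prop
  | complex {f a g b c : Tree} :
      ArgMesh P (.app f a) (.app g b) c → Mesh P (.app f a) (.app g b) c
  | gramLeft {k : ℕ} {p g b c : Tree} :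
      p ∈ P k → Mesh P p (.app g b) c → Mesh P (.R k) (.app g b) c
  | gramRight {k : ℕ} {p f a c : Tree} :
      p ∈ P k → Mesh P (.app f a) p c → Mesh P (.app f a) (.R k) c

/-- `ArgMesh P a b c`: `a = X a₁ … aₘ`, `b = X b₁ … bₘ` and `c = X c₁ … cₘ` with the same
combinator `X` and the same `m ≥ 0`, where for each `i`
`cᵢ` is `bᵢ` if `aᵢ` rewrites to `bᵢ`; otherwise `aᵢ` if `bᵢ` rewrites to `aᵢ`;
otherwise any element of the mesh set of `aᵢ` and `bᵢ`. -/
inductive ArgMesh (P : ℕ → Set Tree) : Tree → Tree → Tree → Prop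
  | S : ArgMesh P .S .S .S
  | K : ArgMesh P .K .K .K
  | right {f g h a b : Tree} : ArgMesh P f g h → Rew P a b →
      ArgMesh P (.app f a) (.app g b) (.app h b)
  | left {f g h a b : Tree} : ArgMesh P f g h → ¬ Rew P a b → Rew P b a →
      ArgMesh P (.app f a) (.app g b) (.app h a)
  | mesh {f g h a b c : Tree} : ArgMesh P f g h → ¬ Rew P a b → ¬ Rew P b a →
      Mesh P a b c → ArgMesh P (.app f a) (.app g b) (.app h c)

end

/-- `Rewriting P a b l r`: the tree `l r` belongs to the rewriting set of `a` and `b`. -/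
inductive Rewriting (P : ℕ → Set Tree) : Tree → Tree → Tree → Tree → Prop
  | all {a : Tree} : Rewriting P a .C .C a
  | gram {k : ℕ} {a p l r : Tree} :
      p ∈ P k → Rewriting P a p l r → Rewriting P a (.R k) l r
  | right {a f b : Tree} : Rew P a b → Rewriting P a (.app f b) f b
  | left {a f b : Tree} : ¬ Rew P a b → Rew P b a → Rewriting P a (.app f b) f a
  | mesh {a f b c : Tree} : ¬ Rew P a b → ¬ Rew P b a → Mesh P a b c →
      Rewriting P a (.app f b) f c

/-- `KExpansion a b`: `a = X a₁ … aₘ` and `b = K (X a₁ … aₖ) C aₖ₊₁ … aₘ`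
with `k ≤ m - 1`. -/
inductive KExpansion : Tree → Tree → Prop
  | last {f a : Tree} : KExpansion (.app f a) (.app (.app (.app .K f) .C) a)
  | app {f g a : Tree} : KExpansion f g → KExpansion (.app f a) (.app g a)

/-- `SExpansion P a b`: `a = X a₁ … aₘ` and `b = S (X a₁ … aₖ) l r aₖ₊₃ … aₘ`
with `k ≤ m - 2` and `l r` in the rewriting set of `aₖ₊₁` and `aₖ₊₂`. -/
inductive SExpansion (P : ℕ → Set Tree) : Tree → Tree → Prop
  | last {f a b l r : Tree} : Rewriting P a b l r →
      SExpansion P (.app (.app f a) b) (.app (.app (.app .S f) l) r)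
  | app {f g a : Tree} : SExpansion P f g → SExpansion P (.app f a) (.app g a)

/-- The productions `S | K | S R₀ | K R₀ | S R₀ R₀` of `R₀`. -/
def baseProductions : Set Tree :=
  {.S, .K, .app .S (.R 0), .app .K (.R 0), .app (.app .S (.R 0)) (.R 0)}

/-- The productions of `R (n + 1)`, when `P k` are the productions of `R k` for `k ≤ n`. -/
def nextProductions (P : ℕ → Set Tree) (n : ℕ) : Set Tree :=
  {.app .S (.R (n + 1)), .app .K (.R (n + 1))} ∪
  {t | ∃ i j : ℕ, i + j = n + 1 ∧ t = .app (.app .S (.R i)) (.R j)} ∪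
  {.app (.app .K (.R n)) .C} ∪
  {t | ∃ p ∈ P n, KExpansion p t} ∪
  {t | ∃ p ∈ P n, SExpansion P p t}

/-- `productionsUpTo n k` is the set of productions of `R k` if `k ≤ n`, and `∅` otherwise. -/
def productionsUpTo : ℕ → ℕ → Set Tree
  | 0 => Function.update (fun _ => ∅) 0 baseProductions
  | n + 1 =>
    Function.update (productionsUpTo n) (n + 1) (nextProductions (productionsUpTo n) n)

/-- The productions of the `n`-th normal-order reduction grammar `R n`. -/
def productions (n : ℕ) : Set Tree := productionsUpTo n n

/-- The productions of `R n` in which the non-terminal `R n` does not occur. -/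
def nonSelfReferencing (n : ℕ) : Set Tree :=
  {α | α ∈ productions n ∧ α.numR n = 0}

/-! ### Closed forms -/

/-- Closed-form expressions in one variable `z`: built from `z` and natural number constants
by the four arithmetic operations and square roots. -/
inductive ClosedForm : Type
  | var : ClosedForm
  | const : ℕ → ClosedForm
  | add : ClosedForm → ClosedForm → ClosedForm
  | sub : ClosedForm → ClosedForm → ClosedForm
  | mul : ClosedForm → ClosedForm → ClosedForm
  | div : ClosedForm → ClosedForm → ClosedForm
  | sqrt : ClosedForm → ClosedForm

namespace ClosedForm

/-- The value at `z`, with the principal branch of the square root. -/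
noncomputable def eval (z : ℂ) : ClosedForm → ℂ
  | var => z
  | const q => (q : ℂ)
  | add e f => e.eval z + f.eval z
  | sub e f => e.eval z - f.eval z
  | mul e f => e.eval z * f.eval z
  | div e f => e.eval z / f.eval z
  | sqrt e => Complex.sqrt (e.eval z)

/-- The expression is meaningful (and analytic) at `z`: no denominator vanishes and no radicand
lies on the branch cut of the principal square root. -/
def Regular (z : ℂ) : ClosedForm → Prop
  | var => True
  | const _ => True
  | add e f => e.Regular z ∧ f.Regular z
  | sub e f => e.Regular z ∧ f.Regular z
  | mul e f => e.Regular z ∧ f.Regular z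
  | div e f => e.Regular z ∧ f.Regular z ∧ f.eval z ≠ 0
  | sqrt e => e.Regular z ∧ e.eval z ∈ Complex.slitPlane

/-- The Gödel number of an expression. -/
def code : ClosedForm → ℕ
  | var => Nat.pair 0 0
  | const q => Nat.pair 1 q
  | add e f => Nat.pair 2 (Nat.pair e.code f.code)
  | sub e f => Nat.pair 3 (Nat.pair e.code f.code)
  | mul e f => Nat.pair 4 (Nat.pair e.code f.code)
  | div e f => Nat.pair 5 (Nat.pair e.code f.code)
  | sqrt e => Nat.pair 6 e.code

/-- Distinct expressions have distinct Gödel numbers. -/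
theorem code_injective : Function.Injective code := by
  intro e
  induction e with
  | var => intro f h; cases f <;> simp_all [code, Nat.pair_eq_pair]
  | const q => intro f h; cases f <;> simp_all [code, Nat.pair_eq_pair]
  | add a b iha ihb | sub a b iha ihb | mul a b iha ihb | div a b iha ihb =>
    intro f h
    cases f <;> simp [code, Nat.pair_eq_pair] at h
    rw [iha h.1, ihb h.2]
  | sqrt a iha =>
    intro f h
    cases f <;> simp [code, Nat.pair_eq_pair] at h
    rw [iha h]

end ClosedForm

/-- The closed form `C(z) = (1 - √(1 - 8z)) / (2z)`. -/
noncomputable def genC (z : ℂ) : ℂ := (1 - Complex.sqrt (1 - 8 * z)) / (2 * z)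

/-- The closed form `R₀(z) = (1 - 2z - √(1 - 4z - 4z²)) / (2z²)`. -/
noncomputable def genR0 (z : ℂ) : ℂ :=
  (1 - 2 * z - Complex.sqrt (1 - 4 * z - 4 * z ^ 2)) / (2 * z ^ 2)

end SK

namespace SK

/-! ### Generating functions of sets of terms -/

-- Analysis. Give a term the weight `z ^ size`. The number 4 is the double root of c = 2 + c²/8, so
-- for ‖z‖ ≤ 1/8 the absolute sums over terms of bounded height never exceed 4. Hence all series
-- converge absolutely and are bounded by 4. Splitting terms at the root turns application into `z`
-- times a product. This yields quadratic equations for C and R₀, and the bound 4 puts 1 - 2zC and 1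
-- - 2z - 2z²R₀ into the right half plane, which selects the principal square root.
--
-- Unambiguity. Every term normalizing in `n` steps lies in the language of exactly one production
-- of `R n` (`existsUnique_productions`). By induction on `n`: a term is a head normal form, or `K x
-- y`, or has a head redex with a determined contractum. In the last case the contractum has a
-- unique production, and the expansions of that production invert the contraction. A K-contraction
-- erases an argument, so `C` is inserted. An S-contraction copies an argument, so the argument must
-- match two trees at once; mesh sets write such intersections of languages as disjoint unions
-- (`existsUnique_argMesh`). Therefore Rₙ is a sum of products over its productions. For n ≥ 1
-- exactly four productions mention `R n`, contributing 2zRₙ + 2z²R₀Rₙ; solving for Rₙ divides by 1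
-- - 2z - 2z²R₀ = √(1 - 4z - 4z²). Finiteness follows from a weight that decreases in every mesh
-- computation (`finite_mesh`).
--
-- Computability. The grammars ask whether one tree rewrites to another. The algorithm avoids this
-- question: it keeps intersections formal, as patterns coded by numbers, and builds by the
-- analogous recursion a table of spines. Its correctness is an identity of counts: the number of
-- listed spines matching a term is the indicator of normalizing in `k` steps (`table_spec`).
-- Generating functions of patterns are then replaced repeatedly by sums of products until only four
-- basic closed forms are left. This stops by induction on the largest step number and then on a
-- weight (`exists_expands`), so an unbounded search finds the number of rounds.

theorem Complex_sqrt_eq_of_sq_eq {w a : ℂ} (h : w ^ 2 = a) (hw : 0 < w.re) :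
    Complex.sqrt a = w := by
  rw [← h, Complex.sqrt]
  exact_mod_cast Complex.sq_cpow_two_inv hw

open Classical in
/-- The terms of height less than `n`. -/
noncomputable def termBall : ℕ → Finset Term
  | 0 => ∅
  | n + 1 => {.S, .K} ∪ (termBall n ×ˢ termBall n).image fun p => .app p.1 p.2

theorem mem_termBall_succ {n : ℕ} {x y : Term} :
    Term.app x y ∈ termBall (n + 1) ↔ x ∈ termBall n ∧ y ∈ termBall n := by
  simp [termBall]

theorem mem_termBall_of_size_le {x : Term} {n : ℕ} (h : x.size ≤ n) : x ∈ termBall (n + 1) := by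
  induction x generalizing n with
  | S => simp [termBall]
  | K => simp [termBall]
  | app x y ihx ihy =>
    cases n with
    | zero => simp [Term.size] at h
    | succ n =>
      simp only [Term.size] at h
      exact mem_termBall_succ.2 ⟨ihx (by omega), ihy (by omega)⟩

theorem exists_subset_termBall (s : Finset Term) : ∃ n, s ⊆ termBall n := by
  classical
  refine ⟨s.sup Term.size + 1, fun x hx => mem_termBall_of_size_le (Finset.le_sup hx)⟩

theorem finite_size_eq (k : ℕ) : {x : Term | x.size = k}.Finite :=
  (termBall (k + 1)).finite_toSet.subset fun _ hx => mem_termBall_of_size_le (le_of_eq hx)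

theorem sum_termBall_le {r : ℝ} (h0 : 0 ≤ r) (hr : r ≤ 1 / 8) (n : ℕ) :
    ∑ x ∈ termBall n, r ^ x.size ≤ 4 := by
  classical
  induction n with
  | zero => simp [termBall]
  | succ n ih =>
    rw [termBall, Finset.sum_union, Finset.sum_pair (by simp), Finset.sum_image]
    · simp only [Term.size, pow_zero, pow_add, pow_one]
      have h1 : 0 ≤ ∑ x ∈ termBall n, r ^ x.size := Finset.sum_nonneg fun _ _ => by positivity
      have h2 : ∑ p ∈ termBall n ×ˢ termBall n, r ^ p.1.size * r ^ p.2.size * r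
          = (∑ x ∈ termBall n, r ^ x.size) * (∑ x ∈ termBall n, r ^ x.size) * r := by
        rw [Finset.sum_mul_sum, ← Finset.sum_product', Finset.sum_mul]
      rw [h2]
      -- A partial sum s ≤ 4 is followed by 2 + r s² ≤ 2 + 16/8 = 4.
      nlinarith [mul_le_mul ih ih h1 (by norm_num : (0 : ℝ) ≤ 4),
        mul_nonneg h1 h1]
    · intro p _ q _ h
      simpa [Prod.ext_iff] using h
    · rw [Finset.disjoint_left]
      intro x hx hx'
      simp only [Finset.mem_insert, Finset.mem_singleton] at hx
      rcases hx with rfl | rfl <;> simp at hx'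

theorem sum_pow_size_le {r : ℝ} (h0 : 0 ≤ r) (hr : r ≤ 1 / 8) (s : Finset Term) :
    ∑ x ∈ s, r ^ x.size ≤ 4 := by
  obtain ⟨n, hn⟩ := exists_subset_termBall s
  exact (Finset.sum_le_sum_of_subset_of_nonneg hn fun _ _ _ => by positivity).trans
    (sum_termBall_le h0 hr n)

theorem summable_pow_size {r : ℝ} (h0 : 0 ≤ r) (hr : r ≤ 1 / 8) :
    Summable fun x : Term => r ^ x.size :=
  summable_of_sum_le (fun _ => by positivity) (sum_pow_size_le h0 hr)

theorem tsum_pow_size_le {r : ℝ} (h0 : 0 ≤ r) (hr : r ≤ 1 / 8) :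
    ∑' x : Term, r ^ x.size ≤ 4 :=
  Real.tsum_le_of_sum_le (fun _ => by positivity) (sum_pow_size_le h0 hr)

/-- The generating function of terms `x` counted with weight `f x`. -/
noncomputable def gen (z : ℂ) (f : Term → ℂ) : ℂ := ∑' x : Term, f x * z ^ x.size

theorem summable_norm_gen {z : ℂ} (hz : ‖z‖ < 1 / 8) {f : Term → ℂ} (hf : ∀ x, ‖f x‖ ≤ 1) :
    Summable fun x : Term => ‖f x * z ^ x.size‖ := by
  refine Summable.of_nonneg_of_le (fun _ => norm_nonneg _) (fun x => ?_)
    (summable_pow_size (norm_nonneg z) hz.le)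
  rw [norm_mul, norm_pow]
  exact mul_le_of_le_one_left (by positivity) (hf x)

theorem summable_gen {z : ℂ} (hz : ‖z‖ < 1 / 8) {f : Term → ℂ} (hf : ∀ x, ‖f x‖ ≤ 1) :
    Summable fun x : Term => f x * z ^ x.size :=
  (summable_norm_gen hz hf).of_norm

theorem norm_gen_le {z : ℂ} (hz : ‖z‖ < 1 / 8) {f : Term → ℂ} (hf : ∀ x, ‖f x‖ ≤ 1) :
    ‖gen z f‖ ≤ 4 := by
  refine (norm_tsum_le_tsum_norm (summable_norm_gen hz hf)).trans ?_
  refine le_trans ?_ (tsum_pow_size_le (norm_nonneg z) hz.le)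
  refine (summable_norm_gen hz hf).tsum_le_tsum (fun x => ?_)
    (summable_pow_size (norm_nonneg z) hz.le)
  rw [norm_mul, norm_pow]
  exact mul_le_of_le_one_left (by positivity) (hf x)

/-- Decomposition of a generating function along the root application. -/
theorem gen_eq {z : ℂ} (hz : ‖z‖ < 1 / 8) {f : Term → ℂ} (hf : ∀ x, ‖f x‖ ≤ 1) :
    gen z f = f .S + f .K + ∑' p : Term × Term, f (.app p.1 p.2) * z ^ (Term.app p.1 p.2).size := by
  classical
  have h := (summable_gen hz hf).hasSum
  have hinj : Function.Injective fun p : Term × Term => Term.app p.1 p.2 := by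
    intro p q h
    simpa [Prod.ext_iff] using h
  -- Removing the two leaves leaves a summand supported on the range of the injective map `app`, so
  -- the sum can be reindexed by pairs.
  let g : Term → ℂ := fun x => if x = .S ∨ x = .K then 0 else f x * z ^ x.size
  have hg : HasSum g (gen z f - (f .S + f .K)) := by
    have h2 : HasSum (fun x : Term => if x = .S ∨ x = .K then f x * z ^ x.size else 0)
        (f .S + f .K) := by
      have := hasSum_sum_of_ne_finset_zero (L := .unconditional Term)
        (f := fun x : Term => if x = .S ∨ x = .K then f x * z ^ x.size else 0)
        (s := {.S, .K}) (by intro b hb; simp at hb; simp [hb])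
      simpa [Finset.sum_pair, Term.size] using this
    have hgf : g = fun x => f x * z ^ x.size -
        if x = .S ∨ x = .K then f x * z ^ x.size else 0 := by
      funext x
      simp only [g]
      split_ifs <;> simp
    rw [hgf]
    exact h.sub h2
  have h3 := (hinj.hasSum_iff (f := g) (a := gen z f - (f .S + f .K)) (by
    intro x hx
    cases x with
    | S => simp [g]
    | K => simp [g]
    | app x y => exact absurd ⟨(x, y), rfl⟩ hx)).2 hg
  have h4 : g ∘ (fun p : Term × Term => Term.app p.1 p.2) =
      fun p => f (.app p.1 p.2) * z ^ (Term.app p.1 p.2).size := by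
    funext p; simp [g]
  rw [h4] at h3
  rw [h3.tsum_eq]; ring

/-- Absolute convergence lets the double series over pairs of subterms factor; the extra `z` counts
the root application. -/
theorem gen_app {z : ℂ} (hz : ‖z‖ < 1 / 8) {f g h : Term → ℂ} (hf : ∀ x, ‖f x‖ ≤ 1)
    (hg : ∀ x, ‖g x‖ ≤ 1) (hS : h .S = 0) (hK : h .K = 0)
    (happ : ∀ x y, h (.app x y) = f x * g y) : gen z h = z * gen z f * gen z g := by
  have hh : ∀ x, ‖h x‖ ≤ 1 := by
    intro x
    cases x with
    | S => simp [hS]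
    | K => simp [hK]
    | app x y =>
      rw [happ, norm_mul]
      exact mul_le_one₀ (hf x) (norm_nonneg _) (hg y)
  rw [gen_eq hz hh, hS, hK, mul_assoc, gen, gen,
    tsum_mul_tsum_of_summable_norm (summable_norm_gen hz hf) (summable_norm_gen hz hg),
    ← tsum_mul_left, zero_add, zero_add]
  congr 1
  funext p
  rw [happ, Term.size]
  ring

theorem gen_sum {z : ℂ} (hz : ‖z‖ < 1 / 8) {ι : Type*} {s : Finset ι} {f : ι → Term → ℂ}
    (hf : ∀ i ∈ s, ∀ x, ‖f i x‖ ≤ 1) :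
    gen z (fun x => ∑ i ∈ s, f i x) = ∑ i ∈ s, gen z (f i) := by
  simp only [gen, Finset.sum_mul]
  exact Summable.tsum_finsetSum fun i hi => summable_gen hz (hf i hi)

open Classical in
/-- The generating function of a set of terms. -/
noncomputable def genSet (z : ℂ) (L : Set Term) : ℂ := gen z fun x => if x ∈ L then 1 else 0

open Classical in
theorem norm_indicator_le (L : Set Term) (x : Term) : ‖(if x ∈ L then 1 else 0 : ℂ)‖ ≤ 1 := by
  split_ifs <;> simp

/-- Regroups the series over terms by the finite fibres of `Term.size`, which ties it to the
counting sequences. -/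
theorem hasSum_genSet {z : ℂ} (hz : ‖z‖ < 1 / 8) (L : Set Term) :
    HasSum (fun k : ℕ => ({x : Term | x.size = k ∧ x ∈ L}.ncard : ℂ) * z ^ k) (genSet z L) := by
  classical
  have h : HasSum (fun x : Term => (if x ∈ L then 1 else 0 : ℂ) * z ^ x.size) (genSet z L) :=
    (summable_gen hz (norm_indicator_le L)).hasSum
  have h2 := ((Equiv.sigmaFiberEquiv Term.size).hasSum_iff).2 h
  refine h2.sigma fun k => ?_
  have hfin : {x : Term | x.size = k ∧ x ∈ L}.Finite := (finite_size_eq k).subset fun x hx => hx.1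
  change HasSum ((fun x : Term => (if x ∈ L then 1 else 0 : ℂ) * z ^ x.size) ∘
    ((↑) : {x : Term | x.size = k} → Term)) _
  rw [hasSum_subtype_iff_indicator, Set.ncard_eq_toFinset_card _ hfin]
  have h3 := hasSum_sum_of_ne_finset_zero (L := .unconditional Term) (s := hfin.toFinset)
    (f := {x : Term | x.size = k}.indicator
      fun x : Term => (if x ∈ L then 1 else 0 : ℂ) * z ^ x.size)
    (by intro x hx; simp at hx; by_cases hk : x.size = k <;> simp_all)
  convert h3 using 1
  rw [Finset.sum_congr rfl (g := fun _ => z ^ k), Finset.sum_const, nsmul_eq_mul]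
  intro x hx
  simp at hx
  simp [hx]

/-! ### The closed forms of the basic generating functions -/

theorem genSet_univ_eq {z : ℂ} (hz : ‖z‖ < 1 / 8) :
    genSet z Set.univ = 2 + z * genSet z Set.univ ^ 2 := by
  have h := gen_eq hz (f := fun _ => 1) (fun _ => by simp)
  -- A weight vanishing on the leaves isolates the sum over pairs.
  have h2 := gen_app hz (f := fun _ => 1) (g := fun _ => 1)
    (h := fun x => match x with | .app _ _ => 1 | _ => 0)
    (fun _ => by simp) (fun _ => by simp) rfl rfl (fun _ _ => by simp)
  rw [gen_eq hz (by intro x; cases x <;> simp)] at h2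
  simp only [zero_add] at h2
  simp only [genSet, Set.mem_univ, if_true]
  rw [h2] at h
  linear_combination h

theorem norm_genSet_le {z : ℂ} (hz : ‖z‖ < 1 / 8) (L : Set Term) : ‖genSet z L‖ ≤ 4 :=
  norm_gen_le hz (norm_indicator_le L)

/-- The equation gives (1 - 2zc)² = 1 - 8z, and ‖c‖ ≤ 4 gives ‖2zc‖ < 1, so 1 - 2zc has positive
real part and is the principal root. -/
theorem genSet_univ {z : ℂ} (h0 : 0 < ‖z‖) (hz : ‖z‖ < 1 / 8) :
    genSet z Set.univ = genC z := by
  have hz0 : z ≠ 0 := norm_pos_iff.1 h0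
  have h := genSet_univ_eq hz
  have hb := norm_genSet_le hz Set.univ
  set c := genSet z Set.univ
  have hs : Complex.sqrt (1 - 8 * z) = 1 - 2 * z * c := by
    refine Complex_sqrt_eq_of_sq_eq (by linear_combination (-4 * z) * h) ?_
    have h1 : (2 * z * c).re ≤ ‖2 * z * c‖ := Complex.re_le_norm _
    have h2 : ‖2 * z * c‖ < 1 := by
      rw [norm_mul, norm_mul, Complex.norm_ofNat]
      nlinarith [norm_nonneg c]
    simp only [Complex.sub_re, Complex.one_re]
    linarith
  rw [genC, hs]
  field_simp
  ring

theorem slitPlane_of_norm_lt {w : ℂ} (hw : ‖w‖ < 1) : 1 - w ∈ Complex.slitPlane := by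
  left
  have := Complex.re_le_norm w
  simp only [Complex.sub_re, Complex.one_re]
  linarith

theorem norm_four_mul_add_lt {z : ℂ} (hz : ‖z‖ < 1 / 8) : ‖4 * z + 4 * z ^ 2‖ < 1 := by
  refine (norm_add_le _ _).trans_lt ?_
  rw [norm_mul, norm_mul, norm_pow, Complex.norm_ofNat]
  nlinarith [norm_nonneg z]

/-- Same branch argument as for C. The identity is used twice: it determines R₀, and it identifies
the factor that remains when the self-referencing productions of `R n` are moved to one side. -/
theorem sqrt_eq_of_quadratic {z c : ℂ} (hz : ‖z‖ < 1 / 8) (hb : ‖c‖ ≤ 4)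
    (h : c = 2 + 2 * z * c + z ^ 2 * c ^ 2) :
    Complex.sqrt (1 - 4 * z - 4 * z ^ 2) = 1 - 2 * z - 2 * z ^ 2 * c := by
  refine Complex_sqrt_eq_of_sq_eq (by linear_combination (-4 * z ^ 2) * h) ?_
  have h1 : (2 * z + 2 * z ^ 2 * c).re ≤ ‖2 * z + 2 * z ^ 2 * c‖ := Complex.re_le_norm _
  have h2 : ‖2 * z + 2 * z ^ 2 * c‖ < 1 := by
    refine (norm_add_le _ _).trans_lt ?_
    rw [norm_mul, norm_mul, norm_mul, norm_pow, Complex.norm_ofNat]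
    have : ‖z‖ ^ 2 ≤ 1 / 64 := by nlinarith [norm_nonneg z]
    nlinarith [norm_nonneg c, mul_le_mul this hb (norm_nonneg c) (by norm_num)]
  have h3 : (1 - 2 * z - 2 * z ^ 2 * c).re = 1 - (2 * z + 2 * z ^ 2 * c).re := by
    rw [sub_sub, Complex.sub_re, Complex.one_re]
  rw [h3]
  linarith

theorem eq_genR0_of_quadratic {z c : ℂ} (h0 : 0 < ‖z‖) (hz : ‖z‖ < 1 / 8) (hb : ‖c‖ ≤ 4)
    (h : c = 2 + 2 * z * c + z ^ 2 * c ^ 2) : c = genR0 z := by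
  have hz0 : z ≠ 0 := norm_pos_iff.1 h0
  rw [genR0, sqrt_eq_of_quadratic hz hb h]
  field_simp
  ring

theorem sqrt_ne_zero {z : ℂ} (hz : ‖z‖ < 1 / 8) : Complex.sqrt (1 - 4 * z - 4 * z ^ 2) ≠ 0 := by
  rw [Complex.sqrt, Ne, Complex.cpow_eq_zero_iff, sub_sub]
  exact fun h => Complex.slitPlane_ne_zero (slitPlane_of_norm_lt (norm_four_mul_add_lt hz)) h.1

/-! ### Head contractions -/

/-- Contraction of a head redex `K x y` which has at least one further argument. -/
inductive HeadK : Term → Term → Prop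
  | last {x y w : Term} : HeadK (.app (.app (.app .K x) y) w) (.app x w)
  | app {f g w : Term} : HeadK f g → HeadK (.app f w) (.app g w)

/-- Contraction of a head redex `S x y z`. -/
inductive HeadS : Term → Term → Prop
  | last {x y z : Term} :
      HeadS (.app (.app (.app .S x) y) z) (.app (.app x z) (.app y z))
  | app {f g w : Term} : HeadS f g → HeadS (.app f w) (.app g w)

/-- The two exclusions say that the root of `f w` is not a redex, so reduction proceeds inside `f`.
-/
theorem step_app_of_step {f g w : Term} (h : f.step = some g)
    (hK : ∀ x, f ≠ .app .K x) (hS : ∀ x y, f ≠ .app (.app .S x) y) :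
    (Term.app f w).step = some (.app g w) := by
  rw [Term.step]
  · simp [h]
  · exact fun x hx => hK x hx
  · exact fun x y hx => hS x y hx

theorem HeadK.step {f g : Term} (h : HeadK f g) : f.step = some g := by
  induction h with
  | last => exact step_app_of_step (by rw [Term.step]) (by simp) (by simp)
  | app h ih =>
    refine step_app_of_step ih ?_ ?_
    · rintro x rfl
      cases h with | app h => cases h
    · rintro x y rfl
      cases h with | app h => cases h with | app h => cases h

theorem HeadS.step {f g : Term} (h : HeadS f g) : f.step = some g := by
  induction h with
  | last => rw [Term.step]
  | app h ih =>
    refine step_app_of_step ih ?_ ?_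
    · rintro x rfl
      cases h with | app h => cases h
    · rintro x y rfl
      cases h with | app h => cases h with | app h => cases h

theorem step_S : Term.S.step = none := rfl

theorem step_K : Term.K.step = none := rfl

theorem step_app_S (x : Term) : (Term.app .S x).step = x.step.map (.app .S) := by
  rw [Term.step]
  · rw [step_S]; cases x.step <;> rfl
  · simp
  · simp

theorem step_app_K (x : Term) : (Term.app .K x).step = x.step.map (.app .K) := by
  rw [Term.step]
  · rw [step_K]; cases x.step <;> rfl
  · simp
  · simp

theorem step_app_app_S (x y : Term) : (Term.app (.app .S x) y).step =
    match x.step with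
    | some x' => some (.app (.app .S x') y)
    | none => y.step.map (.app (.app .S x)) := by
  rw [Term.step]
  · rw [step_app_S]; cases x.step <;> cases y.step <;> rfl
  · simp
  · simp

theorem step_app_app_K (x y : Term) : (Term.app (.app .K x) y).step = some x := by
  rw [Term.step]

/-- The shapes of terms: head normal forms and head redexes. -/
inductive Shape : Term → Prop
  | S : Shape .S
  | K : Shape .K
  | S₁ (x : Term) : Shape (.app .S x)
  | K₁ (x : Term) : Shape (.app .K x)
  | S₂ (x y : Term) : Shape (.app (.app .S x) y)
  | K₂ (x y : Term) : Shape (.app (.app .K x) y)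
  | headK {x y : Term} : HeadK x y → Shape x
  | headS {x y : Term} : HeadS x y → Shape x

/-- A further argument turns a two-argument shape into a head redex and preserves head redexes. This
case distinction underlies both the grammars and the algorithm. -/
theorem shape (x : Term) : Shape x := by
  induction x with
  | S => exact .S
  | K => exact .K
  | app f w ih _ =>
    cases ih with
    | S => exact .S₁ w
    | K => exact .K₁ w
    | S₁ x => exact .S₂ x w
    | K₁ x => exact .K₂ x w
    | S₂ x y => exact .headS .last
    | K₂ x y => exact .headK .last
    | headK h => exact .headK h.app
    | headS h => exact .headS h.app

theorem reduces_zero {x : Term} : Reduces 0 x ↔ x.step = none := Iff.rfl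

theorem reduces_succ {n : ℕ} {x : Term} :
    Reduces (n + 1) x ↔ ∃ y, x.step = some y ∧ Reduces n y := Iff.rfl

theorem reduces_of_step_none {n : ℕ} {x : Term} (h : x.step = none) : Reduces n x ↔ n = 0 := by
  cases n <;> simp [reduces_zero, reduces_succ, h]

theorem reduces_of_step_some {n : ℕ} {x y : Term} (h : x.step = some y) :
    Reduces n x ↔ ∃ m, n = m + 1 ∧ Reduces m y := by
  cases n <;> simp [reduces_zero, reduces_succ, h]

/-- Reduction is deterministic; consequently the languages of distinct `R i` are disjoint. -/
theorem reduces_unique {m n : ℕ} {x : Term} (hm : Reduces m x) (hn : Reduces n x) : m = n := by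
  induction m generalizing n x with
  | zero => exact ((reduces_of_step_none hm).1 hn).symm
  | succ m ih =>
    obtain ⟨y, hy, hm⟩ := hm
    obtain ⟨k, rfl, hk⟩ := (reduces_of_step_some hy).1 hn
    rw [ih hm hk]

theorem reduces_S {n : ℕ} : Reduces n .S ↔ n = 0 := reduces_of_step_none rfl

theorem reduces_K {n : ℕ} : Reduces n .K ↔ n = 0 := reduces_of_step_none rfl

theorem reduces_app_S {n : ℕ} {x : Term} : Reduces n (.app .S x) ↔ Reduces n x := by
  induction n generalizing x with
  | zero => simp [reduces_zero, step_app_S]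
  | succ n ih =>
    simp only [reduces_succ, step_app_S, Option.map_eq_some_iff]
    constructor
    · rintro ⟨_, ⟨y, hy, rfl⟩, h⟩
      exact ⟨y, hy, ih.1 h⟩
    · rintro ⟨y, hy, h⟩
      exact ⟨_, ⟨y, hy, rfl⟩, ih.2 h⟩

theorem reduces_app_K {n : ℕ} {x : Term} : Reduces n (.app .K x) ↔ Reduces n x := by
  induction n generalizing x with
  | zero => simp [reduces_zero, step_app_K]
  | succ n ih =>
    simp only [reduces_succ, step_app_K, Option.map_eq_some_iff]
    constructor
    · rintro ⟨_, ⟨y, hy, rfl⟩, h⟩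
      exact ⟨y, hy, ih.1 h⟩
    · rintro ⟨y, hy, h⟩
      exact ⟨_, ⟨y, hy, rfl⟩, ih.2 h⟩

/-- The leftmost strategy normalizes `x` completely before it touches `y`, so the step counts add
up. -/
theorem reduces_app_app_S {n : ℕ} {x y : Term} :
    Reduces n (.app (.app .S x) y) ↔ ∃ i j, i + j = n ∧ Reduces i x ∧ Reduces j y := by
  induction n generalizing x y with
  | zero =>
    simp only [reduces_zero, step_app_app_S, Nat.add_eq_zero_iff]
    cases hx : x.step with
    | some x' =>
      simp only [reduceCtorEq, false_iff, not_exists]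
      rintro i j ⟨⟨rfl, rfl⟩, h, _⟩
      rw [reduces_zero, hx] at h
      cases h
    | none =>
      simp only [Option.map_eq_none_iff]
      constructor
      · exact fun h => ⟨0, 0, ⟨rfl, rfl⟩, hx, h⟩
      · rintro ⟨i, j, ⟨rfl, rfl⟩, _, h⟩
        exact h
  | succ n ih =>
    rw [reduces_succ, step_app_app_S]
    cases hx : x.step with
    | some x' =>
      simp only [Option.some.injEq, exists_eq_left', ih]
      constructor
      · rintro ⟨i, j, rfl, hi, hj⟩
        exact ⟨i + 1, j, by omega, ⟨x', hx, hi⟩, hj⟩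
      · rintro ⟨i, j, hij, hi, hj⟩
        obtain ⟨m, rfl, hm⟩ := (reduces_of_step_some hx).1 hi
        exact ⟨m, j, by omega, hm, hj⟩
    | none =>
      simp only [Option.map_eq_some_iff]
      constructor
      · rintro ⟨_, ⟨y', hy, rfl⟩, h⟩
        obtain ⟨i, j, rfl, hi, hj⟩ := ih.1 h
        exact ⟨i, j + 1, by omega, hi, y', hy, hj⟩
      · rintro ⟨i, j, hij, hi, hj⟩
        obtain rfl := (reduces_of_step_none hx).1 hi
        obtain rfl : j = n + 1 := by omega
        obtain ⟨y', hy, hj⟩ := hj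
        exact ⟨_, ⟨y', hy, rfl⟩, ih.2 ⟨0, n, by omega, hi, hj⟩⟩

theorem reduces_app_app_K {n : ℕ} {x y : Term} :
    Reduces n (.app (.app .K x) y) ↔ ∃ m, n = m + 1 ∧ Reduces m x :=
  reduces_of_step_some (step_app_app_K x y)

theorem HeadK.reduces {n : ℕ} {x y : Term} (h : HeadK x y) :
    Reduces n x ↔ ∃ m, n = m + 1 ∧ Reduces m y :=
  reduces_of_step_some h.step

theorem HeadS.reduces {n : ℕ} {x y : Term} (h : HeadS x y) :
    Reduces n x ↔ ∃ m, n = m + 1 ∧ Reduces m y :=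
  reduces_of_step_some h.step

theorem not_headK_app_app {a b c d : Term} (ha : a = .S ∨ a = .K) :
    ¬ HeadK (.app (.app a b) c) d := by
  rintro h
  rcases ha with rfl | rfl <;>
  · cases h with | app h => cases h with | app h => cases h

theorem HeadK.not_headS {x y z : Term} (h : HeadK x y) : ¬ HeadS x z := by
  intro h'
  induction h generalizing z with
  | last => cases h' with | app h => cases h with | app h => cases h with | app h => cases h
  | app h ih =>
    cases h' with
    | last => cases h with | app h => cases h with | app h => cases h
    | app h' => exact ih h'

/-! ### The language of a tree -/

/-- `a.Has x`: the term `x` arises from the tree `a` by replacing every `C` by a term and every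
`R n` by a term normalizing in `n` steps. -/
def Tree.Has : Tree → Term → Prop
  | .S, x => x = .S
  | .K, x => x = .K
  | .C, _ => True
  | .R n, x => Reduces n x
  | .app a b, .app f y => a.Has f ∧ b.Has y
  | .app _ _, _ => False

namespace Tree

@[simp] theorem has_S {x : Term} : Tree.S.Has x ↔ x = .S := Iff.rfl

@[simp] theorem has_K {x : Term} : Tree.K.Has x ↔ x = .K := Iff.rfl

@[simp] theorem has_C {x : Term} : Tree.C.Has x ↔ True := Iff.rfl

@[simp] theorem has_R {n : ℕ} {x : Term} : (Tree.R n).Has x ↔ Reduces n x := Iff.rfl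

@[simp] theorem has_app_app {a b : Tree} {f y : Term} :
    (Tree.app a b).Has (.app f y) ↔ a.Has f ∧ b.Has y := Iff.rfl

@[simp] theorem not_has_app_S {a b : Tree} : ¬ (Tree.app a b).Has .S := id

@[simp] theorem not_has_app_K {a b : Tree} : ¬ (Tree.app a b).Has .K := id

theorem has_app {a b : Tree} {x : Term} :
    (Tree.app a b).Has x ↔ ∃ f y, x = .app f y ∧ a.Has f ∧ b.Has y := by
  cases x <;> simp

/-- The tree is `X a₁ … aₘ` for a combinator `X`, where each `aᵢ` is `C`, some `R i` with `i < N`,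
or again of this form. -/
def Spine (N : ℕ) : Tree → Prop
  | .S => True
  | .K => True
  | .C => False
  | .R _ => False
  | .app f a => f.Spine N ∧ (a = .C ∨ (∃ i < N, a = .R i) ∨ a.Spine N)

/-- The possible arguments in a tree satisfying `Tree.Spine`. -/
def IsArg (N : ℕ) (a : Tree) : Prop := a = .C ∨ (∃ i < N, a = .R i) ∨ a.Spine N

variable {N : ℕ}

@[simp] theorem spine_S : Tree.S.Spine N := trivial

@[simp] theorem spine_K : Tree.K.Spine N := trivial

@[simp] theorem not_spine_C : ¬ Tree.C.Spine N := id

@[simp] theorem not_spine_R {i : ℕ} : ¬ (Tree.R i).Spine N := id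

@[simp] theorem spine_app {f a : Tree} : (Tree.app f a).Spine N ↔ f.Spine N ∧ a.IsArg N := Iff.rfl

theorem Spine.isArg {a : Tree} (h : a.Spine N) : a.IsArg N := .inr (.inr h)

@[simp] theorem isArg_C : Tree.C.IsArg N := .inl rfl

@[simp] theorem isArg_R {i : ℕ} : (Tree.R i).IsArg N ↔ i < N := by simp [IsArg]

@[simp] theorem isArg_app {f a : Tree} : (Tree.app f a).IsArg N ↔ (Tree.app f a).Spine N := by
  simp [IsArg]

theorem Spine.mono {M : ℕ} (h : N ≤ M) {a : Tree} (ha : a.Spine N) : a.Spine M := by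
  induction a with
  | app f a ihf iha =>
    refine ⟨ihf ha.1, ?_⟩
    rcases ha.2 with rfl | ⟨i, hi, rfl⟩ | ha
    · exact isArg_C
    · exact isArg_R.2 (hi.trans_le h)
    · exact .inr (.inr (iha ha))
  | _ => simp_all

theorem Spine.eq_S {a : Tree} (h : a.Spine N) (hx : a.Has .S) : a = .S := by
  cases a <;> simp_all

theorem Spine.eq_K {a : Tree} (h : a.Spine N) (hx : a.Has .K) : a = .K := by
  cases a <;> simp_all

theorem Spine.eq_app {a : Tree} {f x : Term} (h : a.Spine N) (hx : a.Has (.app f x)) :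
    ∃ g b, a = .app g b := by
  cases a <;> simp_all

end Tree

/-- The self-referencing productions of `R k`. -/
def selfReferencing (k : ℕ) : Set Tree :=
  {.app .S (.R k), .app .K (.R k), .app (.app .S (.R 0)) (.R k), .app (.app .S (.R k)) (.R 0)}

/-- The productions `P` describe the terms normalizing in fewer than `N` steps unambiguously. -/
structure Covers (P : ℕ → Set Tree) (N : ℕ) : Prop where
  lt : ∀ {k p}, p ∈ P k → k < N
  spine : ∀ {k p}, p ∈ P k → p.Spine (k + 1)
  shape : ∀ {k p}, p ∈ P k → p ∈ selfReferencing k ∨ p.Spine k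
  sound : ∀ {k p x}, p ∈ P k → p.Has x → Reduces k x
  complete : ∀ {k x}, k < N → Reduces k x → ∃ p ∈ P k, p.Has x
  unique : ∀ {k p q x}, p ∈ P k → q ∈ P k → p.Has x → q.Has x → p = q

namespace Covers

variable {P : ℕ → Set Tree} {N : ℕ}

theorem spine' (hP : Covers P N) {k : ℕ} {p : Tree} (hp : p ∈ P k) : p.Spine N :=
  (hP.spine hp).mono (hP.lt hp)

/-- Rewriting can only shrink the language: productions are sound, and `C` already contains every
term. -/
theorem has_of_step (hP : Covers P N) {a b : Tree} (h : Step P a b) {x : Term} (hx : b.Has x) :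
    a.Has x := by
  induction h generalizing x with
  | prod hp => exact hP.sound hp hx
  | left _ ih =>
    obtain ⟨f, y, rfl, hf, hy⟩ := Tree.has_app.1 hx
    exact ⟨ih hf, hy⟩
  | right _ ih =>
    obtain ⟨f, y, rfl, hf, hy⟩ := Tree.has_app.1 hx
    exact ⟨hf, ih hy⟩
  | _ => trivial

theorem has_of_rew (hP : Covers P N) {a b : Tree} (h : Rew P a b) {x : Term} (hx : b.Has x) :
    a.Has x := by
  induction h with
  | refl => exact hx
  | tail _ h ih => exact ih (hP.has_of_step h hx)

end Covers

theorem rew_app {P : ℕ → Set Tree} {a b c d : Tree} (h : Rew P a b) (h' : Rew P c d) :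
    Rew P (.app a c) (.app b d) := by
  have h1 : Rew P (.app a c) (.app b c) := by
    induction h with
    | refl => exact .refl
    | tail _ h ih => exact ih.tail (.left h)
  refine h1.trans ?_
  induction h' with
  | refl => exact .refl
  | tail _ h ih => exact ih.tail (.right h)

/-- Because of this, `C` never takes part in a proper mesh: one of the two rewriting tests always
succeeds. -/
theorem rew_C (P : ℕ → Set Tree) (a : Tree) : Rew P .C a := by
  induction a with
  | S => exact .single .c_S
  | K => exact .single .c_K
  | C => exact .refl
  | R n => exact .single (.c_R n)
  | app a b iha ihb => exact Relation.ReflTransGen.head .c_app (rew_app iha ihb)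

/-! ### Mesh sets compute intersections -/

/-- The choice between rewriting and meshing made for a pair of arguments. -/
inductive Meet (P : ℕ → Set Tree) (a b : Tree) : Tree → Prop
  | right : Rew P a b → Meet P a b b
  | left : ¬ Rew P a b → Rew P b a → Meet P a b a
  | mesh {c : Tree} : ¬ Rew P a b → ¬ Rew P b a → Mesh P a b c → Meet P a b c

section

variable {P : ℕ → Set Tree} {N : ℕ}

theorem argMesh_app_iff {f a g b t : Tree} : ArgMesh P (.app f a) (.app g b) t ↔
    ∃ h c, t = .app h c ∧ ArgMesh P f g h ∧ Meet P a b c := by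
  constructor
  · intro h
    cases h with
    | right h h1 => exact ⟨_, _, rfl, h, .right h1⟩
    | left h h1 h2 => exact ⟨_, _, rfl, h, .left h1 h2⟩
    | mesh h h1 h2 h3 => exact ⟨_, _, rfl, h, .mesh h1 h2 h3⟩
  · rintro ⟨h, c, rfl, hh, hc⟩
    cases hc with
    | right h1 => exact .right hh h1
    | left h1 h2 => exact .left hh h1 h2
    | mesh h1 h2 h3 => exact .mesh hh h1 h2 h3

theorem mesh_app_app_iff {f a g b t : Tree} :
    Mesh P (.app f a) (.app g b) t ↔ ArgMesh P (.app f a) (.app g b) t :=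
  ⟨fun h => by cases h with | complex h => exact h, .complex⟩

theorem mesh_R_app_iff {k : ℕ} {g b t : Tree} :
    Mesh P (.R k) (.app g b) t ↔ ∃ p ∈ P k, Mesh P p (.app g b) t :=
  ⟨fun h => by cases h with | gramLeft hp h => exact ⟨_, hp, h⟩, fun ⟨_, hp, h⟩ => .gramLeft hp h⟩

theorem mesh_app_R_iff {k : ℕ} {f a t : Tree} :
    Mesh P (.app f a) (.R k) t ↔ ∃ p ∈ P k, Mesh P (.app f a) p t :=
  ⟨fun h => by cases h with | gramRight hp h => exact ⟨_, hp, h⟩,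
    fun ⟨_, hp, h⟩ => .gramRight hp h⟩

theorem Mesh.spine (hP : Covers P N) {a b c : Tree} (h : Mesh P a b c) :
    a.IsArg N → b.IsArg N → c.Spine N := by
  -- The two relations are mutually inductive, hence two motives: meshes are taken of arguments,
  -- argumentwise meshes of spines.
  refine Mesh.rec (motive_1 := fun a b c _ => a.IsArg N → b.IsArg N → c.Spine N)
    (motive_2 := fun a b c _ => a.Spine N → b.Spine N → c.Spine N) ?_ ?_ ?_ ?_ ?_ ?_ ?_ ?_ h
  · intro f a g b c _ ih ha hb
    exact ih (Tree.isArg_app.1 ha) (Tree.isArg_app.1 hb)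
  · exact fun hp _ ih _ hb => ih (hP.spine' hp).isArg hb
  · exact fun hp _ ih ha _ => ih ha (hP.spine' hp).isArg
  · simp
  · simp
  · exact fun _ _ ih ha hb => ⟨ih ha.1 hb.1, hb.2⟩
  · exact fun _ _ _ ih ha hb => ⟨ih ha.1 hb.1, ha.2⟩
  · exact fun _ _ _ _ ih ih' ha hb => ⟨ih ha.1 hb.1, (ih' ha.2 hb.2).isArg⟩

theorem Mesh.has (hP : Covers P N) {a b c : Tree} (h : Mesh P a b c) :
    ∀ {x : Term}, c.Has x → a.Has x ∧ b.Has x := by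
  refine Mesh.rec (motive_1 := fun a b c _ => ∀ {x : Term}, c.Has x → a.Has x ∧ b.Has x)
    (motive_2 := fun a b c _ => ∀ {x : Term}, c.Has x → a.Has x ∧ b.Has x)
    ?_ ?_ ?_ ?_ ?_ ?_ ?_ ?_ h
  · exact fun _ ih _ hx => ih hx
  · exact fun hp _ ih _ hx => ⟨hP.sound hp (ih hx).1, (ih hx).2⟩
  · exact fun hp _ ih _ hx => ⟨(ih hx).1, hP.sound hp (ih hx).2⟩
  · exact fun hx => ⟨hx, hx⟩
  · exact fun hx => ⟨hx, hx⟩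
  · intro f g h a b _ hr ih x hx
    obtain ⟨u, v, rfl, hu, hv⟩ := Tree.has_app.1 hx
    exact ⟨⟨(ih hu).1, hP.has_of_rew hr hv⟩, (ih hu).2, hv⟩
  · intro f g h a b _ _ hr ih x hx
    obtain ⟨u, v, rfl, hu, hv⟩ := Tree.has_app.1 hx
    exact ⟨⟨(ih hu).1, hv⟩, (ih hu).2, hP.has_of_rew hr hv⟩
  · intro f g h a b c _ _ _ _ ih ih' x hx
    obtain ⟨u, v, rfl, hu, hv⟩ := Tree.has_app.1 hx
    exact ⟨⟨(ih hu).1, (ih' hv).1⟩, (ih hu).2, (ih' hv).2⟩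

theorem rew_R_S (hP : Covers P N) {k : ℕ} (hk : k < N) (h : Reduces k .S) : Rew P (.R k) .S := by
  obtain ⟨p, hp, hx⟩ := hP.complete hk h
  rw [(hP.spine hp).eq_S hx] at hp
  exact .single (.prod hp)

theorem rew_R_K (hP : Covers P N) {k : ℕ} (hk : k < N) (h : Reduces k .K) : Rew P (.R k) .K := by
  obtain ⟨p, hp, hx⟩ := hP.complete hk h
  rw [(hP.spine hp).eq_K hx] at hp
  exact .single (.prod hp)

theorem existsUnique_argMesh_app {f a g b : Tree} {u v : Term}
    (hf : ∃! h, ArgMesh P f g h ∧ h.Has u) (ha : ∃! c, Meet P a b c ∧ c.Has v) :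
    ∃! t, ArgMesh P (.app f a) (.app g b) t ∧ t.Has (.app u v) := by
  obtain ⟨h, ⟨h1, h2⟩, h3⟩ := hf
  obtain ⟨c, ⟨c1, c2⟩, c3⟩ := ha
  refine ⟨.app h c, ⟨argMesh_app_iff.2 ⟨h, c, rfl, h1, c1⟩, h2, c2⟩, ?_⟩
  rintro t ⟨ht, htx⟩
  obtain ⟨h', c', rfl, h1', c1'⟩ := argMesh_app_iff.1 ht
  rw [h3 h' ⟨h1', htx.1⟩, c3 c' ⟨c1', htx.2⟩]

/-- With `C` excluded, each argument is some `R i` or a spine. An `R i` is replaced by its unique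
production containing `x`, which reduces everything to the argumentwise mesh of two spines. -/
theorem existsUnique_mesh_of_argMesh (hP : Covers P N) {x : Term}
    (H : ∀ a b : Tree, a.Spine N → b.Spine N → a.Has x → b.Has x →
      ∃! c, ArgMesh P a b c ∧ c.Has x)
    {a b : Tree} (ha : a.IsArg N) (hb : b.IsArg N) (hax : a.Has x) (hbx : b.Has x)
    (hab : ¬ Rew P a b) (hba : ¬ Rew P b a) : ∃! c, Mesh P a b c ∧ c.Has x := by
  rcases ha with rfl | ⟨i, hi, rfl⟩ | ha
  · exact absurd (rew_C P b) hab
  · rcases hb with rfl | ⟨j, hj, rfl⟩ | hb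
    · exact absurd (rew_C P _) hba
    -- A common term forces both step numbers to agree, so the trees are equal, which the failed
    -- rewriting test excludes.
    · rw [reduces_unique hax hbx] at hab
      exact absurd .refl hab
    · cases x with
      | S => rw [hb.eq_S hbx] at hab; exact absurd (rew_R_S hP hi hax) hab
      | K => rw [hb.eq_K hbx] at hab; exact absurd (rew_R_K hP hi hax) hab
      | app u v =>
        obtain ⟨g, b, rfl⟩ := hb.eq_app hbx
        obtain ⟨p, hp, hpx⟩ := hP.complete hi hax
        obtain ⟨f, a, rfl⟩ := (hP.spine hp).eq_app hpx
        obtain ⟨c, ⟨hc, hcx⟩, huniq⟩ := H _ _ (hP.spine' hp) hb hpx hbx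
        refine ⟨c, ⟨mesh_R_app_iff.2 ⟨_, hp, .complex hc⟩, hcx⟩, ?_⟩
        rintro d ⟨hd, hdx⟩
        obtain ⟨q, hq, hqd⟩ := mesh_R_app_iff.1 hd
        -- A mesh through another production `q` would also put `x` into the language of `q`.
        obtain rfl := hP.unique hq hp (hqd.has hP hdx).1 hpx
        exact huniq d ⟨mesh_app_app_iff.1 hqd, hdx⟩
  · rcases hb with rfl | ⟨j, hj, rfl⟩ | hb
    · exact absurd (rew_C P _) hba
    · cases x with
      | S => rw [ha.eq_S hax] at hba; exact absurd (rew_R_S hP hj hbx) hba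
      | K => rw [ha.eq_K hax] at hba; exact absurd (rew_R_K hP hj hbx) hba
      | app u v =>
        obtain ⟨f, a, rfl⟩ := ha.eq_app hax
        obtain ⟨p, hp, hpx⟩ := hP.complete hj hbx
        obtain ⟨g, b, rfl⟩ := (hP.spine hp).eq_app hpx
        obtain ⟨c, ⟨hc, hcx⟩, huniq⟩ := H _ _ ha (hP.spine' hp) hax hpx
        refine ⟨c, ⟨mesh_app_R_iff.2 ⟨_, hp, .complex hc⟩, hcx⟩, ?_⟩
        rintro d ⟨hd, hdx⟩
        obtain ⟨q, hq, hqd⟩ := mesh_app_R_iff.1 hd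
        obtain rfl := hP.unique hq hp (hqd.has hP hdx).2 hpx
        exact huniq d ⟨mesh_app_app_iff.1 hqd, hdx⟩
    · cases x with
      | S => rw [ha.eq_S hax, hb.eq_S hbx] at hab; exact absurd .refl hab
      | K => rw [ha.eq_K hax, hb.eq_K hbx] at hab; exact absurd .refl hab
      | app u v =>
        obtain ⟨f, a, rfl⟩ := ha.eq_app hax
        obtain ⟨g, b, rfl⟩ := hb.eq_app hbx
        simpa only [mesh_app_app_iff] using H _ _ ha hb hax hbx

theorem existsUnique_meet_of_argMesh (hP : Covers P N) {x : Term}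
    (H : ∀ a b : Tree, a.Spine N → b.Spine N → a.Has x → b.Has x →
      ∃! c, ArgMesh P a b c ∧ c.Has x)
    {a b : Tree} (ha : a.IsArg N) (hb : b.IsArg N) (hax : a.Has x) (hbx : b.Has x) :
    ∃! c, Meet P a b c ∧ c.Has x := by
  by_cases hab : Rew P a b
  · refine ⟨b, ⟨.right hab, hbx⟩, ?_⟩
    rintro c ⟨hc, -⟩
    cases hc with
    | right => rfl
    | left h => exact absurd hab h
    | mesh h => exact absurd hab h
  by_cases hba : Rew P b a
  · refine ⟨a, ⟨.left hab hba, hax⟩, ?_⟩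
    rintro c ⟨hc, -⟩
    cases hc with
    | right h => exact absurd h hab
    | left => rfl
    | mesh _ h => exact absurd hba h
  obtain ⟨c, ⟨hc, hcx⟩, huniq⟩ := existsUnique_mesh_of_argMesh hP H ha hb hax hbx hab hba
  refine ⟨c, ⟨.mesh hab hba hc, hcx⟩, ?_⟩
  rintro d ⟨hd, hdx⟩
  cases hd with
  | right h => exact absurd h hab
  | left _ h => exact absurd h hba
  | mesh _ _ h => exact huniq d ⟨h, hdx⟩

/-- Mesh sets split an intersection of languages into disjoint pieces. The induction runs over the
term, not the trees: replacing `R k` by a production may enlarge a tree, while arguments always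
match proper subterms. -/
theorem existsUnique_argMesh (hP : Covers P N) (x : Term) : ∀ a b : Tree, a.Spine N → b.Spine N →
    a.Has x → b.Has x → ∃! c, ArgMesh P a b c ∧ c.Has x := by
  induction x with
  | S =>
    intro a b ha hb hax hbx
    rw [ha.eq_S hax, hb.eq_S hbx]
    exact ⟨.S, ⟨.S, rfl⟩, fun c hc => by cases hc.1; rfl⟩
  | K =>
    intro a b ha hb hax hbx
    rw [ha.eq_K hax, hb.eq_K hbx]
    exact ⟨.K, ⟨.K, rfl⟩, fun c hc => by cases hc.1; rfl⟩
  | app u v ihu ihv =>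
    intro a b ha hb hax hbx
    obtain ⟨f, a, rfl⟩ := ha.eq_app hax
    obtain ⟨g, b, rfl⟩ := hb.eq_app hbx
    exact existsUnique_argMesh_app (ihu f g ha.1 hb.1 hax.1 hbx.1)
      (existsUnique_meet_of_argMesh hP ihv ha.2 hb.2 hax.2 hbx.2)

theorem existsUnique_meet (hP : Covers P N) {x : Term} {a b : Tree} (ha : a.IsArg N)
    (hb : b.IsArg N) (hax : a.Has x) (hbx : b.Has x) : ∃! c, Meet P a b c ∧ c.Has x :=
  existsUnique_meet_of_argMesh hP (existsUnique_argMesh hP x) ha hb hax hbx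

/-! ### Rewriting sets -/

theorem rewriting_app_iff {a f b l r : Tree} :
    Rewriting P a (.app f b) l r ↔ l = f ∧ Meet P a b r := by
  constructor
  · intro h
    cases h with
    | right h => exact ⟨rfl, .right h⟩
    | left h h' => exact ⟨rfl, .left h h'⟩
    | mesh h h' h'' => exact ⟨rfl, .mesh h h' h''⟩
  · rintro ⟨rfl, h⟩
    cases h with
    | right h => exact .right h
    | left h h' => exact .left h h'
    | mesh h h' h'' => exact .mesh h h' h''

theorem rewriting_R_iff {a l r : Tree} {k : ℕ} :
    Rewriting P a (.R k) l r ↔ ∃ p ∈ P k, Rewriting P a p l r :=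
  ⟨fun h => by cases h with | gram hp h => exact ⟨_, hp, h⟩, fun ⟨_, hp, h⟩ => .gram hp h⟩

theorem Rewriting.has (hP : Covers P N) {a b l r : Tree} (h : Rewriting P a b l r) {y z : Term}
    (hy : l.Has y) (hz : r.Has z) : a.Has z ∧ b.Has (.app y z) := by
  induction h with
  | all => exact ⟨hz, trivial⟩
  | gram hp _ ih => exact ⟨(ih hy hz).1, hP.sound hp (ih hy hz).2⟩
  | right h => exact ⟨hP.has_of_rew h hz, hy, hz⟩
  | left _ h => exact ⟨hz, hy, hP.has_of_rew h hz⟩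
  | mesh _ _ h => exact ⟨(h.has hP hz).1, hy, (h.has hP hz).2⟩

theorem Rewriting.isArg (hP : Covers P N) {a b l r : Tree} (h : Rewriting P a b l r)
    (ha : a.IsArg N) (hb : b.IsArg N) : l.IsArg N ∧ r.IsArg N := by
  induction h with
  | all => exact ⟨hb, ha⟩
  | gram hp _ ih => exact ih ha (hP.spine' hp).isArg
  | right => exact ⟨(Tree.isArg_app.1 hb).1.isArg, (Tree.isArg_app.1 hb).2⟩
  | left => exact ⟨(Tree.isArg_app.1 hb).1.isArg, ha⟩
  | mesh _ _ h =>
    exact ⟨(Tree.isArg_app.1 hb).1.isArg, (h.spine hP ha (Tree.isArg_app.1 hb).2).isArg⟩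

theorem exists_rewriting_app (hP : Covers P N) {a f b : Tree} (ha : a.IsArg N)
    (hb : b.IsArg N) {y z : Term} (hz : a.Has z) (hyz : (Tree.app f b).Has (.app y z)) :
    ∃ l r, (Rewriting P a (.app f b) l r ∧ l.Has y ∧ r.Has z) ∧
      ∀ l' r', Rewriting P a (.app f b) l' r' → l'.Has y → r'.Has z → l' = l ∧ r' = r := by
  obtain ⟨c, ⟨hc, hcz⟩, huniq⟩ := existsUnique_meet hP ha hb hz hyz.2
  refine ⟨f, c, ⟨rewriting_app_iff.2 ⟨rfl, hc⟩, hyz.1, hcz⟩, fun l' r' h _ hr => ?_⟩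
  obtain ⟨h1, h2⟩ := rewriting_app_iff.1 h
  exact ⟨h1, huniq r' ⟨h2, hr⟩⟩

/-- The rewriting set describes the pairs `y`, `z` for which `z` matches `a` and `y z` matches `b`,
each pair exactly once. This is the condition for undoing a contraction to `x z (y z)`. -/
theorem exists_rewriting (hP : Covers P N) {a b : Tree} (ha : a.IsArg N)
    (hb : b.IsArg N) {y z : Term} (hz : a.Has z) (hyz : b.Has (.app y z)) :
    ∃ l r, (Rewriting P a b l r ∧ l.Has y ∧ r.Has z) ∧
      ∀ l' r', Rewriting P a b l' r' → l'.Has y → r'.Has z → l' = l ∧ r' = r := by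
  rcases hb with rfl | ⟨k, hk, rfl⟩ | hb
  · refine ⟨.C, a, ⟨.all, trivial, hz⟩, fun l' r' h _ _ => ?_⟩
    cases h
    exact ⟨rfl, rfl⟩
  · obtain ⟨p, hp, hpx⟩ := hP.complete hk hyz
    obtain ⟨f, b, rfl⟩ := (hP.spine hp).eq_app hpx
    obtain ⟨l, r, ⟨h1, h2, h3⟩, h4⟩ := exists_rewriting_app hP ha (hP.spine' hp).2 hz hpx
    refine ⟨l, r, ⟨.gram hp h1, h2, h3⟩, fun l' r' h hl hr => ?_⟩
    obtain ⟨q, hq, h⟩ := rewriting_R_iff.1 h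
    obtain rfl := hP.unique hq hp (h.has hP hl hr).2 hpx
    exact h4 l' r' h hl hr
  · obtain ⟨f, b, rfl⟩ := hb.eq_app hyz
    exact exists_rewriting_app hP ha hb.2 hz hyz

/-! ### Expansions of productions -/

theorem KExpansion.has {p q : Tree} (h : KExpansion p q) {x : Term} (hx : q.Has x) :
    ∃ y, HeadK x y ∧ p.Has y := by
  induction h generalizing x with
  | last =>
    obtain ⟨u, w, rfl, hu, hw⟩ := Tree.has_app.1 hx
    obtain ⟨u, y, rfl, hu, -⟩ := Tree.has_app.1 hu
    obtain ⟨u, v, rfl, rfl, hv⟩ := Tree.has_app.1 hu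
    exact ⟨_, .last, hv, hw⟩
  | app _ ih =>
    obtain ⟨f, w, rfl, hf, hw⟩ := Tree.has_app.1 hx
    obtain ⟨g, hg, hg'⟩ := ih hf
    exact ⟨_, .app hg, hg', hw⟩

/-- The term determines where its head redex ends: an expansion at a different place would create or
require a head redex in a two-argument term, which has none. -/
theorem existsUnique_kExpansion {x y : Term} (h : HeadK x y) {p : Tree} (hp : p.Spine N)
    (hy : p.Has y) : ∃! q, KExpansion p q ∧ q.Has x := by
  induction h generalizing p with
  | last =>
    obtain ⟨f, a, rfl⟩ := hp.eq_app hy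
    refine ⟨_, ⟨.last, ⟨⟨rfl, hy.1⟩, trivial⟩, hy.2⟩, ?_⟩
    rintro q ⟨hq, hqx⟩
    cases hq with
    | last => rfl
    | app hq =>
      obtain ⟨_, h, -⟩ := hq.has hqx.1
      exact absurd h (not_headK_app_app (.inr rfl))
  | app h ih =>
    obtain ⟨f, a, rfl⟩ := hp.eq_app hy
    obtain ⟨q, ⟨hq, hqx⟩, huniq⟩ := ih hp.1 hy.1
    refine ⟨_, ⟨.app hq, hqx, hy.2⟩, ?_⟩
    rintro q' ⟨hq', hqx'⟩
    cases hq' with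
    | last =>
      obtain ⟨u, y, rfl, hu, -⟩ := Tree.has_app.1 hqx'.1
      obtain ⟨u, x, rfl, rfl, hx⟩ := Tree.has_app.1 hu
      exact absurd h (not_headK_app_app (.inr rfl))
    | app hq' => rw [huniq _ ⟨hq', hqx'.1⟩]

theorem SExpansion.has (hP : Covers P N) {p q : Tree} (h : SExpansion P p q) {x : Term}
    (hx : q.Has x) : ∃ y, HeadS x y ∧ p.Has y := by
  induction h generalizing x with
  | last hr =>
    obtain ⟨u, z, rfl, hu, hz⟩ := Tree.has_app.1 hx
    obtain ⟨u, y, rfl, hu, hy⟩ := Tree.has_app.1 hu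
    obtain ⟨u, v, rfl, rfl, hv⟩ := Tree.has_app.1 hu
    have h := hr.has hP hy hz
    exact ⟨_, .last, ⟨hv, h.1⟩, h.2⟩
  | app _ ih =>
    obtain ⟨f, w, rfl, hf, hw⟩ := Tree.has_app.1 hx
    obtain ⟨g, hg, hg'⟩ := ih hf
    exact ⟨_, .app hg, hg', hw⟩

theorem not_headS_app_app {a x y z : Term} (ha : a = .S ∨ a = .K) :
    ¬ HeadS (.app (.app a x) y) z := by
  rintro h
  rcases ha with rfl | rfl <;>
  · cases h with | app h => cases h with | app h => cases h

/-- As for K-expansions, the position is forced by the term; at that position uniqueness comes from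
the rewriting set. -/
theorem existsUnique_sExpansion (hP : Covers P N) {x y : Term} (h : HeadS x y) {p : Tree}
    (hp : p.Spine N) (hy : p.Has y) : ∃! q, SExpansion P p q ∧ q.Has x := by
  induction h generalizing p with
  | last =>
    obtain ⟨f, b, rfl⟩ := hp.eq_app hy
    obtain ⟨f, a, rfl⟩ := hp.1.eq_app hy.1
    obtain ⟨l, r, ⟨h1, h2, h3⟩, h4⟩ := exists_rewriting hP hp.1.2 hp.2 hy.1.2 hy.2
    refine ⟨_, ⟨.last h1, ⟨⟨rfl, hy.1.1⟩, h2⟩, h3⟩, ?_⟩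
    rintro q ⟨hq, hqx⟩
    cases hq with
    | last hr =>
      obtain ⟨rfl, rfl⟩ := h4 _ _ hr hqx.1.2 hqx.2
      rfl
    | app hq =>
      obtain ⟨_, h, -⟩ := hq.has hP hqx.1
      exact absurd h (not_headS_app_app (.inl rfl))
  | app h ih =>
    obtain ⟨f, a, rfl⟩ := hp.eq_app hy
    obtain ⟨q, ⟨hq, hqx⟩, huniq⟩ := ih hp.1 hy.1
    refine ⟨_, ⟨.app hq, hqx, hy.2⟩, ?_⟩
    rintro q' ⟨hq', hqx'⟩
    cases hq' with
    | last =>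
      obtain ⟨u, y, rfl, hu, -⟩ := Tree.has_app.1 hqx'.1
      obtain ⟨u, x, rfl, rfl, hx⟩ := Tree.has_app.1 hu
      exact absurd h (not_headS_app_app (.inl rfl))
    | app hq' => rw [huniq _ ⟨hq', hqx'.1⟩]

theorem KExpansion.spine {p q : Tree} (h : KExpansion p q) (hp : p.Spine N) : q.Spine N := by
  induction h with
  | last => exact ⟨⟨⟨trivial, hp.1.isArg⟩, Tree.isArg_C⟩, hp.2⟩
  | app _ ih => exact ⟨ih hp.1, hp.2⟩

theorem SExpansion.spine (hP : Covers P N) {p q : Tree} (h : SExpansion P p q)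
    (hp : p.Spine N) : q.Spine N := by
  induction h with
  | last hr =>
    have := hr.isArg hP hp.1.2 hp.2
    exact ⟨⟨⟨trivial, hp.1.1.isArg⟩, this.1⟩, this.2⟩
  | app _ ih => exact ⟨ih hp.1, hp.2⟩

end

/-! ### Finiteness of the grammars -/

/-- The weight of a tree, where `R k` weighs `h k`. -/
def Tree.weight (h : ℕ → ℕ) : Tree → ℕ
  | .S => 0
  | .K => 0
  | .C => 0
  | .R k => h k
  | .app a b => a.weight h + b.weight h + 1

/-- All arguments of the tree have weight at most `m`. -/
def Tree.ArgsLe (h : ℕ → ℕ) (m : ℕ) : Tree → Prop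
  | .app f a => f.ArgsLe h m ∧ a.weight h ≤ m
  | _ => True

theorem Tree.argsLe_of_weight_le {h : ℕ → ℕ} {m : ℕ} {a : Tree} (ha : a.weight h ≤ m + 1) :
    a.ArgsLe h m := by
  induction a with
  | app f a ihf _ =>
    simp only [weight] at ha
    exact ⟨ihf (by omega), by omega⟩
  | _ => trivial

theorem Tree.weight_congr {h h' : ℕ → ℕ} {N : ℕ} (hh : ∀ k < N, h k = h' k) {a : Tree}
    (ha : a.IsArg N) : a.weight h = a.weight h' := by
  induction a with
  | R k => exact hh k (isArg_R.1 ha)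
  | app f a ihf iha =>
    have ha := isArg_app.1 ha
    simp only [weight, ihf ha.1.isArg, iha ha.2]
  | _ => rfl

theorem Tree.argsLe_congr {h h' : ℕ → ℕ} {N m : ℕ} (hh : ∀ k < N, h k = h' k) {a : Tree}
    (ha : a.Spine N) (hm : a.ArgsLe h m) : a.ArgsLe h' m := by
  induction a with
  | app f a ihf _ => exact ⟨ihf ha.1 hm.1, (weight_congr hh ha.2).symm.trans_le hm.2⟩
  | _ => trivial

section

variable {P : ℕ → Set Tree} {N : ℕ} {h : ℕ → ℕ}

theorem finite_meet {a b : Tree} (hm : {c | Mesh P a b c}.Finite) : {c | Meet P a b c}.Finite := by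
  refine ((Set.toFinite {a, b}).union hm).subset fun c hc => ?_
  cases hc with
  | right => exact .inl (.inr rfl)
  | left => exact .inl (.inl rfl)
  | mesh _ _ h => exact .inr h

theorem finite_argMesh {m m' : ℕ} {f g : Tree} (hf : f.ArgsLe h m) (hg : g.ArgsLe h m')
    (H : ∀ a b : Tree, a.weight h ≤ m → b.weight h ≤ m' → {c | Mesh P a b c}.Finite) :
    {t | ArgMesh P f g t}.Finite := by
  induction f generalizing g with
  | S => exact (Set.finite_singleton .S).subset fun c hc => by cases hc; rfl
  | K => exact (Set.finite_singleton .K).subset fun c hc => by cases hc; rfl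
  | C => exact Set.finite_empty.subset fun c hc => by cases hc
  | R k => exact Set.finite_empty.subset fun c hc => by cases hc
  | app f a ihf _ =>
    cases g with
    | app g b =>
      refine ((ihf hf.1 hg.1).image2 Tree.app (finite_meet (H a b hf.2 hg.2))).subset fun t ht => ?_
      obtain ⟨u, c, rfl, hu, hc⟩ := argMesh_app_iff.1 ht
      exact ⟨u, hu, c, hc, rfl⟩
    | _ => exact Set.finite_empty.subset fun c hc => by cases hc

/-- Induction on the total weight. A mesh always involves a complex tree, whose arguments weigh
strictly less than the tree. Replacing `R k` by a production costs nothing, because the arguments of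
the production weigh at most `h k`. -/
theorem finite_mesh (hP : Covers P N) (hfin : ∀ k, (P k).Finite)
    (hW : ∀ k, ∀ p ∈ P k, p.ArgsLe h (h k)) (a b : Tree) : {c | Mesh P a b c}.Finite := by
  induction hn : a.weight h + b.weight h using Nat.strong_induction_on generalizing a b with
  | _ n ih =>
  subst hn
  have H : ∀ m m', m + m' < a.weight h + b.weight h → ∀ a b : Tree, a.weight h ≤ m →
      b.weight h ≤ m' → {c | Mesh P a b c}.Finite :=
    fun m m' hm a b ha hb => ih _ (by omega) a b rfl
  -- The outermost application contributes 1 to the weight, so each argument weighs at least one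
  -- less than the whole tree.
  have hle : ∀ f a : Tree, (Tree.app f a).ArgsLe h (f.weight h + a.weight h) :=
    fun f a => Tree.argsLe_of_weight_le (by simp [Tree.weight])
  cases a with
  | app f a =>
    cases b with
    | app g b =>
      refine (finite_argMesh (hle f a) (hle g b)
        (H _ _ (by simp only [Tree.weight]; omega))).subset fun t ht => mesh_app_app_iff.1 ht
    | R k =>
      refine ((hfin k).biUnion (t := fun p => {t | ArgMesh P (.app f a) p t}) fun p hp =>
        finite_argMesh (hle f a) (hW k p hp)
          (H _ _ (by simp only [Tree.weight]; omega))).subset fun t ht => ?_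
      obtain ⟨p, hp, ht⟩ := mesh_app_R_iff.1 ht
      have hs := hP.spine hp
      refine Set.mem_biUnion hp ?_
      cases ht with
      | complex ht => exact ht
      | gramRight => exact absurd hs Tree.not_spine_R
    | _ => exact Set.finite_empty.subset fun c hc => by cases hc
  | R k =>
    cases b with
    | app g b =>
      refine ((hfin k).biUnion (t := fun p => {t | ArgMesh P p (.app g b) t}) fun p hp =>
        finite_argMesh (hW k p hp) (hle g b)
          (H _ _ (by simp only [Tree.weight]; omega))).subset fun t ht => ?_
      obtain ⟨p, hp, ht⟩ := mesh_R_app_iff.1 ht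
      have hs := hP.spine hp
      refine Set.mem_biUnion hp ?_
      cases ht with
      | complex ht => exact ht
      | gramLeft => exact absurd hs Tree.not_spine_R
    | _ => exact Set.finite_empty.subset fun c hc => by cases hc
  | _ => exact Set.finite_empty.subset fun c hc => by cases hc

theorem finite_rewriting_app (hM : ∀ a b, {c | Mesh P a b c}.Finite) (a f b : Tree) :
    {q : Tree × Tree | Rewriting P a (.app f b) q.1 q.2}.Finite := by
  refine ((finite_meet (hM a b)).image fun c => (f, c)).subset fun q hq => ?_
  obtain ⟨h1, h2⟩ := rewriting_app_iff.1 hq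
  exact ⟨q.2, h2, by rw [← h1]⟩

theorem finite_rewriting (hP : Covers P N) (hfin : ∀ k, (P k).Finite)
    (hM : ∀ a b, {c | Mesh P a b c}.Finite) (a b : Tree) :
    {q : Tree × Tree | Rewriting P a b q.1 q.2}.Finite := by
  cases b with
  | S => exact Set.finite_empty.subset fun c hc => by cases hc
  | K => exact Set.finite_empty.subset fun c hc => by cases hc
  | C =>
    refine (Set.finite_singleton (Tree.C, a)).subset ?_
    rintro ⟨l, r⟩ hq
    cases hq
    rfl
  | app f b => exact finite_rewriting_app hM a f b
  | R k =>
    refine ((hfin k).biUnion (t := fun p => {q : Tree × Tree | Rewriting P a p q.1 q.2})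
      fun p hp => ?_).subset fun q hq => ?_
    · have hs := hP.spine hp
      cases p with
      | app f b => exact finite_rewriting_app hM a f b
      | S => exact Set.finite_empty.subset fun c hc => by cases hc
      | K => exact Set.finite_empty.subset fun c hc => by cases hc
      | C => exact absurd hs Tree.not_spine_C
      | R k => exact absurd hs Tree.not_spine_R
    · obtain ⟨p, hp, h⟩ := rewriting_R_iff.1 hq
      exact Set.mem_biUnion hp h

theorem finite_kExpansion (p : Tree) : {q | KExpansion p q}.Finite := by
  induction p with
  | app f a ihf _ =>
    refine ((Set.finite_singleton (Tree.app (.app (.app .K f) .C) a)).union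
      (ihf.image fun g => .app g a)).subset fun q hq => ?_
    cases hq with
    | last => exact .inl rfl
    | app h => exact .inr ⟨_, h, rfl⟩
  | _ => exact Set.finite_empty.subset fun c hc => by cases hc

theorem finite_sExpansion
    (hR : ∀ a b, {q : Tree × Tree | Rewriting P a b q.1 q.2}.Finite) (p : Tree) :
    {q | SExpansion P p q}.Finite := by
  induction p with
  | app f b ihf _ =>
    have h1 : {q | SExpansion P (.app f b) q} ⊆ (fun g => Tree.app g b) '' {g | SExpansion P f g} ∪
        {q | ∃ g a l r, f = .app g a ∧ Rewriting P a b l r ∧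
          q = .app (.app (.app .S g) l) r} := by
      intro q hq
      cases hq with
      | last h => exact .inr ⟨_, _, _, _, rfl, h, rfl⟩
      | app h => exact .inl ⟨_, h, rfl⟩
    refine ((ihf.image _).union ?_).subset h1
    cases f with
    | app g a =>
      refine ((hR a b).image fun q => Tree.app (.app (.app .S g) q.1) q.2).subset ?_
      rintro q ⟨g', a', l, r, h, hr, rfl⟩
      cases h
      exact ⟨(l, r), hr, rfl⟩
    | _ => exact Set.finite_empty.subset fun c hc => by
             obtain ⟨g, a, l, r, h, -⟩ := hc
             cases h
  | _ => exact Set.finite_empty.subset fun c hc => by cases hc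

theorem finite_nextProductions (hP : Covers P N) (hfin : ∀ k, (P k).Finite)
    (hW : ∀ k, ∀ p ∈ P k, p.ArgsLe h (h k)) (n : ℕ) : (nextProductions P n).Finite := by
  have hM := finite_mesh hP hfin hW
  refine ((((Set.toFinite _).union ?_).union (Set.toFinite _)).union ?_).union ?_
  · refine ((Finset.HasAntidiagonal.antidiagonal (n + 1)).finite_toSet.image
      fun q => Tree.app (.app .S (.R q.1)) (.R q.2)).subset ?_
    rintro _ ⟨i, j, hij, rfl⟩
    exact ⟨(i, j), by simpa using hij, rfl⟩
  · refine ((hfin n).biUnion fun p _ => finite_kExpansion p).subset ?_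
    rintro q ⟨p, hp, hq⟩
    exact Set.mem_biUnion hp hq
  · refine ((hfin n).biUnion fun p _ =>
      finite_sExpansion (finite_rewriting hP hfin hM) p).subset ?_
    rintro q ⟨p, hp, hq⟩
    exact Set.mem_biUnion hp hq

end

/-! ### Correctness of the grammars -/

section

variable {P : ℕ → Set Tree} {n : ℕ}

theorem mem_nextProductions {q : Tree} : q ∈ nextProductions P n ↔
    q = .app .S (.R (n + 1)) ∨ q = .app .K (.R (n + 1)) ∨
    (∃ i j, i + j = n + 1 ∧ q = .app (.app .S (.R i)) (.R j)) ∨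
    q = .app (.app .K (.R n)) .C ∨ (∃ p ∈ P n, KExpansion p q) ∨ ∃ p ∈ P n, SExpansion P p q := by
  simp only [nextProductions, Set.mem_union, Set.mem_insert_iff, Set.mem_singleton_iff,
    Set.mem_ofPred_eq, or_assoc]

theorem nextProductions_spine (hP : Covers P (n + 1)) {q : Tree} (hq : q ∈ nextProductions P n) :
    q ∈ selfReferencing (n + 1) ∨ q.Spine (n + 1) := by
  simp only [selfReferencing, Set.mem_insert_iff, Set.mem_singleton_iff]
  rcases mem_nextProductions.1 hq with rfl | rfl | ⟨i, j, hij, rfl⟩ | rfl | ⟨p, hp, h⟩ | ⟨p, hp, h⟩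
  · simp
  · simp
  · rcases Nat.eq_zero_or_pos i with rfl | hi
    · obtain rfl : j = n + 1 := by omega
      simp
    rcases Nat.eq_zero_or_pos j with rfl | hj
    · obtain rfl : i = n + 1 := by omega
      simp
    · right
      simp
      omega
  · simp
  · exact .inr (h.spine (hP.spine hp))
  · exact .inr (h.spine hP (hP.spine hp))

theorem spine_of_mem_selfReferencing {k : ℕ} {p : Tree} (hp : p ∈ selfReferencing k) :
    p.Spine (k + 1) := by
  simp only [selfReferencing, Set.mem_insert_iff, Set.mem_singleton_iff] at hp
  rcases hp with rfl | rfl | rfl | rfl <;> simp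

theorem nextProductions_sound (hP : Covers P (n + 1)) {q : Tree} (hq : q ∈ nextProductions P n)
    {x : Term} (hx : q.Has x) : Reduces (n + 1) x := by
  rcases mem_nextProductions.1 hq with rfl | rfl | ⟨i, j, hij, rfl⟩ | rfl | ⟨p, hp, h⟩ | ⟨p, hp, h⟩
  · obtain ⟨f, u, rfl, rfl, hu⟩ := Tree.has_app.1 hx
    exact reduces_app_S.2 hu
  · obtain ⟨f, u, rfl, rfl, hu⟩ := Tree.has_app.1 hx
    exact reduces_app_K.2 hu
  · obtain ⟨f, v, rfl, hf, hv⟩ := Tree.has_app.1 hx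
    obtain ⟨f, u, rfl, rfl, hu⟩ := Tree.has_app.1 hf
    exact reduces_app_app_S.2 ⟨i, j, hij, hu, hv⟩
  · obtain ⟨f, v, rfl, hf, hv⟩ := Tree.has_app.1 hx
    obtain ⟨f, u, rfl, rfl, hu⟩ := Tree.has_app.1 hf
    exact reduces_app_app_K.2 ⟨n, rfl, hu⟩
  · obtain ⟨y, hy, hpy⟩ := h.has hx
    exact hy.reduces.2 ⟨n, rfl, hP.sound hp hpy⟩
  · obtain ⟨y, hy, hpy⟩ := h.has hP hx
    exact hy.reduces.2 ⟨n, rfl, hP.sound hp hpy⟩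

theorem not_headK_S₁ {x y : Term} : ¬ HeadK (.app .S x) y := by
  intro h
  cases h with | app h => cases h

theorem not_headK_K₁ {x y : Term} : ¬ HeadK (.app .K x) y := by
  intro h
  cases h with | app h => cases h

theorem not_headS_S₁ {x y : Term} : ¬ HeadS (.app .S x) y := by
  intro h
  cases h with | app h => cases h

theorem not_headS_K₁ {x y : Term} : ¬ HeadS (.app .K x) y := by
  intro h
  cases h with | app h => cases h

theorem exists_kExpansion_has {q : Tree} {x : Term} (h : ∃ p ∈ P n, KExpansion p q)
    (hx : q.Has x) : ∃ y, HeadK x y := by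
  obtain ⟨p, -, h⟩ := h
  obtain ⟨y, hy, -⟩ := h.has hx
  exact ⟨y, hy⟩

theorem exists_sExpansion_has (hP : Covers P (n + 1)) {q : Tree} {x : Term}
    (h : ∃ p ∈ P n, SExpansion P p q) (hx : q.Has x) : ∃ y, HeadS x y := by
  obtain ⟨p, -, h⟩ := h
  obtain ⟨y, hy, -⟩ := h.has hP hx
  exact ⟨y, hy⟩

theorem HeadK.exists_eq {x y : Term} (h : HeadK x y) :
    ∃ a b c, x = .app (.app a b) c ∧ a ≠ .S ∧ a ≠ .K := by
  cases h with
  | last => exact ⟨_, _, _, rfl, by simp, by simp⟩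
  | app h =>
    cases h with
    | last => exact ⟨_, _, _, rfl, by simp, by simp⟩
    | app h => cases h <;> exact ⟨_, _, _, rfl, by simp, by simp⟩

theorem HeadS.exists_eq {x y : Term} (h : HeadS x y) :
    ∃ a b c, x = .app (.app a b) c ∧ a ≠ .S ∧ a ≠ .K := by
  cases h with
  | last => exact ⟨_, _, _, rfl, by simp, by simp⟩
  | app h =>
    cases h with
    | last => exact ⟨_, _, _, rfl, by simp, by simp⟩
    | app h => cases h <;> exact ⟨_, _, _, rfl, by simp, by simp⟩

/-- The shape of the term selects the kind of production: one of the explicit ones for head normal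
forms and for `K x y`, otherwise an expansion of the unique production of the contractum. -/
theorem existsUnique_nextProductions (hP : Covers P (n + 1)) {x : Term} (hx : Reduces (n + 1) x) :
    ∃! q, q ∈ nextProductions P n ∧ q.Has x := by
  simp only [mem_nextProductions]
  cases shape x with
  | S => simp [reduces_S] at hx
  | K => simp [reduces_K] at hx
  | S₁ u =>
    refine ⟨_, ⟨.inl rfl, rfl, reduces_app_S.1 hx⟩, ?_⟩
    rintro q ⟨rfl | rfl | ⟨i, j, hij, rfl⟩ | rfl | h | h, hqx⟩
    · rfl
    · simp at hqx
    · simp at hqx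
    · simp at hqx
    · exact absurd (exists_kExpansion_has h hqx).choose_spec not_headK_S₁
    · exact absurd (exists_sExpansion_has hP h hqx).choose_spec not_headS_S₁
  | K₁ u =>
    refine ⟨_, ⟨.inr (.inl rfl), rfl, reduces_app_K.1 hx⟩, ?_⟩
    rintro q ⟨rfl | rfl | ⟨i, j, hij, rfl⟩ | rfl | h | h, hqx⟩
    · simp at hqx
    · rfl
    · simp at hqx
    · simp at hqx
    · exact absurd (exists_kExpansion_has h hqx).choose_spec not_headK_K₁
    · exact absurd (exists_sExpansion_has hP h hqx).choose_spec not_headS_K₁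
  | S₂ u v =>
    obtain ⟨i, j, hij, hu, hv⟩ := reduces_app_app_S.1 hx
    refine ⟨_, ⟨.inr (.inr (.inl ⟨i, j, hij, rfl⟩)), ⟨rfl, hu⟩, hv⟩, ?_⟩
    rintro q ⟨rfl | rfl | ⟨i', j', hij', rfl⟩ | rfl | h | h, hqx⟩
    · simp at hqx
    · simp at hqx
    · rw [reduces_unique hu hqx.1.2, reduces_unique hv hqx.2]
    · simp at hqx
    · exact absurd (exists_kExpansion_has h hqx).choose_spec (not_headK_app_app (.inl rfl))
    · exact absurd (exists_sExpansion_has hP h hqx).choose_spec (not_headS_app_app (.inl rfl))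
  | K₂ u v =>
    obtain ⟨m, hm, hu⟩ := reduces_app_app_K.1 hx
    obtain rfl : n = m := by omega
    refine ⟨_, ⟨.inr (.inr (.inr (.inl rfl))), ⟨rfl, hu⟩, trivial⟩, ?_⟩
    rintro q ⟨rfl | rfl | ⟨i', j', hij', rfl⟩ | rfl | h | h, hqx⟩
    · simp at hqx
    · simp at hqx
    · simp at hqx
    · rfl
    · exact absurd (exists_kExpansion_has h hqx).choose_spec (not_headK_app_app (.inr rfl))
    · exact absurd (exists_sExpansion_has hP h hqx).choose_spec (not_headS_app_app (.inr rfl))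
  | headK hy =>
    obtain ⟨m, hm, hu⟩ := hy.reduces.1 hx
    obtain rfl : n = m := by omega
    obtain ⟨p, hp, hpy⟩ := hP.complete n.lt_succ_self hu
    obtain ⟨q, ⟨hq, hqx⟩, huniq⟩ := existsUnique_kExpansion hy (hP.spine hp) hpy
    refine ⟨q, ⟨.inr (.inr (.inr (.inr (.inl ⟨p, hp, hq⟩)))), hqx⟩, ?_⟩
    obtain ⟨a, b, c, rfl, ha, ha'⟩ := hy.exists_eq
    rintro q' ⟨rfl | rfl | ⟨i', j', hij', rfl⟩ | rfl | ⟨p', hp', h⟩ | h, hqx'⟩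
    · simp at hqx'
    · simp at hqx'
    · exact absurd hqx'.1.1 ha
    · exact absurd hqx'.1.1 ha'
    · obtain ⟨y', hy', hpy'⟩ := h.has hqx'
      -- Both contractions are the normal-order step of the same term, so the contracta agree.
      obtain rfl : y' = _ := Option.some.inj (hy'.step.symm.trans hy.step)
      obtain rfl := hP.unique hp' hp hpy' hpy
      exact huniq q' ⟨h, hqx'⟩
    · exact absurd (exists_sExpansion_has hP h hqx').choose_spec hy.not_headS
  | headS hy =>
    obtain ⟨m, hm, hu⟩ := hy.reduces.1 hx
    obtain rfl : n = m := by omega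
    obtain ⟨p, hp, hpy⟩ := hP.complete n.lt_succ_self hu
    obtain ⟨q, ⟨hq, hqx⟩, huniq⟩ := existsUnique_sExpansion hP hy (hP.spine hp) hpy
    refine ⟨q, ⟨.inr (.inr (.inr (.inr (.inr ⟨p, hp, hq⟩)))), hqx⟩, ?_⟩
    obtain ⟨a, b, c, rfl, ha, ha'⟩ := hy.exists_eq
    rintro q' ⟨rfl | rfl | ⟨i', j', hij', rfl⟩ | rfl | h | ⟨p', hp', h⟩, hqx'⟩
    · simp at hqx'
    · simp at hqx'
    · exact absurd hqx'.1.1 ha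
    · exact absurd hqx'.1.1 ha'
    · exact absurd hy (exists_kExpansion_has h hqx').choose_spec.not_headS
    · obtain ⟨y', hy', hpy'⟩ := h.has hP hqx'
      obtain rfl : y' = _ := Option.some.inj (hy'.step.symm.trans hy.step)
      obtain rfl := hP.unique hp' hp hpy' hpy
      exact huniq q' ⟨h, hqx'⟩

end

-- The base grammar and the induction over all grammars

theorem mem_baseProductions {q : Tree} : q ∈ baseProductions ↔ q = .S ∨ q = .K ∨
    q = .app .S (.R 0) ∨ q = .app .K (.R 0) ∨ q = .app (.app .S (.R 0)) (.R 0) := Iff.rfl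

theorem existsUnique_baseProductions {x : Term} (hx : Reduces 0 x) :
    ∃! q, q ∈ baseProductions ∧ q.Has x := by
  simp only [mem_baseProductions]
  cases shape x with
  | S =>
    refine ⟨_, ⟨.inl rfl, rfl⟩, ?_⟩
    rintro q ⟨rfl | rfl | rfl | rfl | rfl, hq⟩ <;> simp_all
  | K =>
    refine ⟨_, ⟨.inr (.inl rfl), rfl⟩, ?_⟩
    rintro q ⟨rfl | rfl | rfl | rfl | rfl, hq⟩ <;> simp_all
  | S₁ u =>
    refine ⟨_, ⟨.inr (.inr (.inl rfl)), rfl, reduces_app_S.1 hx⟩, ?_⟩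
    rintro q ⟨rfl | rfl | rfl | rfl | rfl, hq⟩ <;> simp_all
  | K₁ u =>
    refine ⟨_, ⟨.inr (.inr (.inr (.inl rfl))), rfl, reduces_app_K.1 hx⟩, ?_⟩
    rintro q ⟨rfl | rfl | rfl | rfl | rfl, hq⟩ <;> simp_all
  | S₂ u v =>
    obtain ⟨i, j, hij, hu, hv⟩ := reduces_app_app_S.1 hx
    obtain ⟨rfl, rfl⟩ := Nat.add_eq_zero_iff.1 hij
    refine ⟨_, ⟨.inr (.inr (.inr (.inr rfl))), ⟨rfl, hu⟩, hv⟩, ?_⟩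
    rintro q ⟨rfl | rfl | rfl | rfl | rfl, hq⟩ <;> simp_all
  | K₂ u v => simp [reduces_app_app_K] at hx
  | headK h => simp [h.reduces] at hx
  | headS h => simp [h.reduces] at hx

theorem baseProductions_sound {q : Tree} (hq : q ∈ baseProductions) {x : Term} (hx : q.Has x) :
    Reduces 0 x := by
  rcases mem_baseProductions.1 hq with rfl | rfl | rfl | rfl | rfl
  · rw [hx]; rfl
  · rw [hx]; rfl
  · obtain ⟨f, u, rfl, rfl, hu⟩ := Tree.has_app.1 hx
    exact reduces_app_S.2 hu
  · obtain ⟨f, u, rfl, rfl, hu⟩ := Tree.has_app.1 hx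
    exact reduces_app_K.2 hu
  · obtain ⟨f, v, rfl, hf, hv⟩ := Tree.has_app.1 hx
    obtain ⟨f, u, rfl, rfl, hu⟩ := Tree.has_app.1 hf
    exact reduces_app_app_S.2 ⟨0, 0, rfl, hu, hv⟩

theorem baseProductions_shape {q : Tree} (hq : q ∈ baseProductions) :
    q ∈ selfReferencing 0 ∨ q.Spine 0 := by
  rcases mem_baseProductions.1 hq with rfl | rfl | rfl | rfl | rfl <;> simp [selfReferencing]

theorem Covers.empty : Covers (fun _ => ∅) 0 where
  lt h := h.elim
  spine h := h.elim
  shape h := h.elim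
  sound h := h.elim
  complete h := absurd h (Nat.not_lt_zero _)
  unique h := h.elim

theorem Covers.update {P : ℕ → Set Tree} {N : ℕ} (hP : Covers P N) {Q : Set Tree}
    (shape : ∀ p ∈ Q, p ∈ selfReferencing N ∨ p.Spine N)
    (sound : ∀ p ∈ Q, ∀ x, p.Has x → Reduces N x)
    (unique : ∀ x, Reduces N x → ∃! q, q ∈ Q ∧ q.Has x) :
    Covers (Function.update P N Q) (N + 1) := by
  have key : ∀ {k p}, p ∈ Function.update P N Q k → k = N ∧ p ∈ Q ∨ k < N ∧ p ∈ P k := by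
    intro k p hp
    by_cases hk : k = N
    · subst hk
      exact .inl ⟨rfl, by simpa using hp⟩
    · rw [Function.update_of_ne hk] at hp
      exact .inr ⟨hP.lt hp, hp⟩
  constructor
  · intro k p hp
    rcases key hp with ⟨rfl, -⟩ | ⟨h, -⟩ <;> omega
  · intro k p hp
    rcases key hp with ⟨rfl, hp'⟩ | ⟨-, hp'⟩
    · exact (shape p hp').elim spine_of_mem_selfReferencing fun h => h.mono k.le_succ
    · exact hP.spine hp'
  · intro k p hp
    rcases key hp with ⟨rfl, hp'⟩ | ⟨-, hp'⟩
    · exact shape p hp'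
    · exact hP.shape hp'
  · intro k p x hp hx
    rcases key hp with ⟨rfl, hp'⟩ | ⟨-, hp'⟩
    · exact sound p hp' x hx
    · exact hP.sound hp' hx
  · intro k x hk hx
    rcases Nat.lt_succ_iff_lt_or_eq.1 hk with hk | rfl
    · rw [Function.update_of_ne hk.ne]
      exact hP.complete hk hx
    · obtain ⟨q, hq, -⟩ := unique x hx
      exact ⟨q, by simpa using hq.1, hq.2⟩
  · intro k p q x hp hq hpx hqx
    rcases key hp with ⟨rfl, hp'⟩ | ⟨hk, hp'⟩
    · rcases key hq with ⟨-, hq'⟩ | ⟨hk, -⟩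
      · exact (unique x (sound p hp' x hpx)).unique ⟨hp', hpx⟩ ⟨hq', hqx⟩
      · omega
    · rcases key hq with ⟨rfl, -⟩ | ⟨-, hq'⟩
      · omega
      · exact hP.unique hp' hq' hpx hqx

/-- A finite set of productions can be added without losing the bound on weights. -/
theorem exists_weight_update {P : ℕ → Set Tree} {N : ℕ} (hP : Covers P N) {Q : Set Tree}
    (hfin : Q.Finite) (shape : ∀ p ∈ Q, p ∈ selfReferencing N ∨ p.Spine N)
    {h : ℕ → ℕ} (hW : ∀ k, ∀ p ∈ P k, p.ArgsLe h (h k)) :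
    ∃ h' : ℕ → ℕ, ∀ k, ∀ p ∈ Function.update P N Q k, p.ArgsLe h' (h' k) := by
  obtain ⟨M, hM⟩ := (hfin.image (Tree.weight h)).bddAbove
  -- `M` bounds the old weights of the new productions; `h 0` is added because self-referencing
  -- productions also have `R 0` as an argument.
  refine ⟨Function.update h N (M + h 0), fun k p hp => ?_⟩
  have hagree : ∀ k < N, h k = Function.update h N (M + h 0) k :=
    fun k hk => by rw [Function.update_of_ne hk.ne]
  by_cases hk : k = N
  · subst hk
    rw [Function.update_self] at hp ⊢
    rcases shape p hp with hs | hs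
    · have h0 : Function.update h k (M + h 0) 0 ≤ M + h 0 := by
        by_cases hk : 0 = k
        · subst hk; simp
        · rw [Function.update_of_ne hk]; omega
      simp only [selfReferencing, Set.mem_insert_iff, Set.mem_singleton_iff] at hs
      rcases hs with rfl | rfl | rfl | rfl <;> simp [Tree.ArgsLe, Tree.weight, h0]
    · refine Tree.argsLe_congr hagree hs (Tree.argsLe_of_weight_le ?_)
      have := hM ⟨p, hp, rfl⟩
      omega
  · rw [Function.update_of_ne hk] at hp ⊢
    exact Tree.argsLe_congr hagree (hP.spine' hp) (hW k p hp)

theorem finite_update {P : ℕ → Set Tree} (hfin : ∀ k, (P k).Finite) {N : ℕ} {Q : Set Tree}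
    (hQ : Q.Finite) (k : ℕ) : (Function.update P N Q k).Finite := by
  by_cases hk : k = N
  · subst hk; simpa
  · rw [Function.update_of_ne hk]; exact hfin k

/-- The three claims are proved together: finiteness of the next grammar needs the covering property
and the weight bound for the previous ones. -/
theorem covers_productionsUpTo (n : ℕ) : Covers (productionsUpTo n) (n + 1) ∧
    (∀ k, (productionsUpTo n k).Finite) ∧
    ∃ h : ℕ → ℕ, ∀ k, ∀ p ∈ productionsUpTo n k, p.ArgsLe h (h k) := by
  induction n with
  | zero =>
    have hfin : baseProductions.Finite := Set.toFinite {_, _, _, _, _}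
    exact ⟨Covers.empty.update (fun _ => baseProductions_shape)
      (fun _ h _ => baseProductions_sound h) (fun _ => existsUnique_baseProductions),
      finite_update (fun _ => Set.finite_empty) hfin,
      exists_weight_update Covers.empty hfin (fun _ => baseProductions_shape)
        (h := fun _ => 0) (fun _ _ h => h.elim)⟩
  | succ n ih =>
    obtain ⟨hP, hfin, h, hW⟩ := ih
    have hfin' := finite_nextProductions hP hfin hW n
    exact ⟨hP.update (fun _ => nextProductions_spine hP)
      (fun _ h _ => nextProductions_sound hP h) (fun _ => existsUnique_nextProductions hP),
      finite_update hfin hfin',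
      exists_weight_update hP hfin' (fun _ => nextProductions_spine hP) hW⟩

theorem finite_productions (n : ℕ) : (productions n).Finite :=
  (covers_productionsUpTo n).2.1 n

theorem existsUnique_productions {n : ℕ} {x : Term} (hx : Reduces n x) :
    ∃! p, p ∈ productions n ∧ p.Has x := by
  have hP := (covers_productionsUpTo n).1
  obtain ⟨p, hp, hpx⟩ := hP.complete n.lt_succ_self hx
  exact ⟨p, ⟨hp, hpx⟩, fun q hq => hP.unique hq.1 hp hq.2 hpx⟩

theorem reduces_of_productions_has {n : ℕ} {p : Tree} (hp : p ∈ productions n) {x : Term}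
    (hx : p.Has x) : Reduces n x :=
  (covers_productionsUpTo n).1.sound hp hx

theorem productions_shape {n : ℕ} {p : Tree} (hp : p ∈ productions n) :
    p ∈ selfReferencing n ∨ p.Spine n :=
  (covers_productionsUpTo n).1.shape hp

theorem selfReferencing_subset_productions {n : ℕ} (hn : 1 ≤ n) :
    selfReferencing n ⊆ productions n := by
  obtain ⟨n, rfl⟩ := Nat.exists_eq_add_of_le' hn
  intro p hp
  have h : productions (n + 1) = nextProductions (productionsUpTo n) n := by
    simp [productions, productionsUpTo]
  rw [h, mem_nextProductions]
  simp only [selfReferencing, Set.mem_insert_iff, Set.mem_singleton_iff] at hp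
  rcases hp with rfl | rfl | rfl | rfl
  · exact .inl rfl
  · exact .inr (.inl rfl)
  · exact .inr (.inr (.inl ⟨0, n + 1, by omega, rfl⟩))
  · exact .inr (.inr (.inl ⟨n + 1, 0, by omega, rfl⟩))

/-! ### Generating functions of trees -/

/-- The generating function of the terms that normalize in `n` steps. -/
noncomputable def genR (n : ℕ) (z : ℂ) : ℂ := genSet z {x | Reduces n x}

/-- The generating function of the language of a tree. -/
noncomputable def genTree (z : ℂ) (a : Tree) : ℂ := genSet z {x | a.Has x}

section

variable {z : ℂ}

theorem genTree_S (hz : ‖z‖ < 1 / 8) : genTree z .S = 1 := by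
  classical
  have := gen_eq hz (norm_indicator_le {x | Tree.S.Has x})
  simpa [genTree, genSet] using this

theorem genTree_K (hz : ‖z‖ < 1 / 8) : genTree z .K = 1 := by
  classical
  have := gen_eq hz (norm_indicator_le {x | Tree.K.Has x})
  simpa [genTree, genSet] using this

theorem genTree_C (h0 : 0 < ‖z‖) (hz : ‖z‖ < 1 / 8) : genTree z .C = genC z := by
  rw [← genSet_univ h0 hz, genTree]
  congr 1

theorem genTree_R (n : ℕ) : genTree z (.R n) = genR n z := rfl

theorem genTree_app (hz : ‖z‖ < 1 / 8) (a b : Tree) :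
    genTree z (.app a b) = z * genTree z a * genTree z b := by
  classical
  refine gen_app hz (norm_indicator_le _) (norm_indicator_le _) (by simp) (by simp) fun x y => ?_
  by_cases hx : a.Has x <;> by_cases hy : b.Has y <;> simp [hx, hy]

theorem genTree_eq (h0 : 0 < ‖z‖) (hz : ‖z‖ < 1 / 8) {N : ℕ} (a : Tree)
    (ha : ∀ i, N ≤ i → a.numR i = 0) :
    genTree z a = z ^ a.numApp * genC z ^ a.numC *
      ∏ i ∈ Finset.range N, genR i z ^ a.numR i := by
  induction a with
  | S => simp [genTree_S hz, Tree.numApp, Tree.numC, Tree.numR]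
  | K => simp [genTree_K hz, Tree.numApp, Tree.numC, Tree.numR]
  | C => simp [genTree_C h0 hz, Tree.numApp, Tree.numC, Tree.numR]
  | R j =>
    have hj : j < N := by
      by_contra h
      simpa [Tree.numR] using ha j (not_lt.1 h)
    simp only [genTree_R, Tree.numApp, Tree.numC, Tree.numR, pow_zero, one_mul, pow_ite, pow_one]
    rw [Finset.prod_ite_eq, if_pos (Finset.mem_range.2 hj)]
  | app a b iha ihb =>
    simp only [Tree.numR, Nat.add_eq_zero_iff] at ha
    rw [genTree_app hz, iha fun i hi => (ha i hi).1, ihb fun i hi => (ha i hi).2]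
    simp only [Tree.numApp, Tree.numC, Tree.numR, pow_add, Finset.prod_mul_distrib]
    ring

theorem Tree.Spine.numR_eq_zero {N : ℕ} {a : Tree} (ha : a.IsArg N) {i : ℕ} (hi : N ≤ i) :
    a.numR i = 0 := by
  induction a with
  | R j => simp [numR, ((isArg_R.1 ha).trans_le hi).ne]
  | app f a ihf iha =>
    have ha := isArg_app.1 ha
    simp [numR, ihf ha.1.isArg, iha ha.2]
  | _ => rfl

/-- Unambiguity in analytic form: the indicator of the terms normalizing in `n` steps is the sum of
the indicators of the productions. -/
theorem genR_eq_sum_productions (hz : ‖z‖ < 1 / 8) (n : ℕ) :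
    genR n z = ∑ p ∈ (finite_productions n).toFinset, genTree z p := by
  classical
  simp only [genTree, genSet]
  rw [← gen_sum hz fun p _ => norm_indicator_le {x | p.Has x}, genR, genSet]
  congr 1
  funext x
  by_cases hx : Reduces n x
  · obtain ⟨p, ⟨hp, hpx⟩, huniq⟩ := existsUnique_productions hx
    rw [Finset.sum_eq_single p]
    · simp [hx, hpx]
    · intro q hq hqp
      rw [if_neg]
      exact fun hqx => hqp (huniq q ⟨by simpa using hq, hqx⟩)
    · exact fun h => absurd (by simpa using hp) h
  · rw [Finset.sum_eq_zero]
    · simp [hx]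
    · intro q hq
      rw [if_neg]
      exact fun hqx => hx (reduces_of_productions_has (by simpa using hq) hqx)

theorem genR_zero_eq (hz : ‖z‖ < 1 / 8) :
    genR 0 z = 2 + 2 * z * genR 0 z + z ^ 2 * genR 0 z ^ 2 := by
  classical
  have h : (finite_productions 0).toFinset =
      {.S, .K, .app .S (.R 0), .app .K (.R 0), .app (.app .S (.R 0)) (.R 0)} := by
    ext p
    simp [productions, productionsUpTo, mem_baseProductions]
  conv_lhs => rw [genR_eq_sum_productions hz, h]
  rw [Finset.sum_insert (by simp), Finset.sum_insert (by simp), Finset.sum_insert (by simp),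
    Finset.sum_insert (by simp), Finset.sum_singleton]
  simp only [genTree_app hz, genTree_S hz, genTree_K hz, genTree_R]
  ring

theorem norm_genR_le (hz : ‖z‖ < 1 / 8) (n : ℕ) : ‖genR n z‖ ≤ 4 := norm_genSet_le hz _

theorem genR_zero (h0 : 0 < ‖z‖) (hz : ‖z‖ < 1 / 8) : genR 0 z = genR0 z :=
  eq_genR0_of_quadratic h0 hz (norm_genR_le hz 0) (genR_zero_eq hz)

/-- Collecting `a` leaves the coefficient 1 - 2z - 2z²R₀, which is the square root. -/
theorem eq_div_sqrt (hz : ‖z‖ < 1 / 8) {a b : ℂ}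
    (h : a = 2 * z * a + 2 * z ^ 2 * genR 0 z * a + b) :
    a = 1 / Complex.sqrt (1 - 4 * z - 4 * z ^ 2) * b := by
  have h1 := sqrt_ne_zero hz
  rw [sqrt_eq_of_quadratic hz (norm_genR_le hz 0) (genR_zero_eq hz)] at h1 ⊢
  field_simp
  linear_combination h

theorem productions_eq_union {n : ℕ} (hn : 1 ≤ n) :
    productions n = selfReferencing n ∪ nonSelfReferencing n := by
  apply Set.Subset.antisymm
  · intro p hp
    rcases productions_shape hp with h | h
    · exact .inl h
    · exact .inr ⟨hp, Tree.Spine.numR_eq_zero h.isArg le_rfl⟩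
  · exact Set.union_subset (selfReferencing_subset_productions hn) fun p hp => hp.1

theorem disjoint_selfReferencing (n : ℕ) : Disjoint (selfReferencing n) (nonSelfReferencing n) := by
  rw [Set.disjoint_left]
  rintro p hp ⟨-, hp'⟩
  simp only [selfReferencing, Set.mem_insert_iff, Set.mem_singleton_iff] at hp
  rcases hp with rfl | rfl | rfl | rfl <;> simp [Tree.numR] at hp'

theorem genR_eq_finsum (h0 : 0 < ‖z‖) (hz : ‖z‖ < 1 / 8) {n : ℕ} (hn : 1 ≤ n) :
    genR n z = 1 / Complex.sqrt (1 - 4 * z - 4 * z ^ 2) *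
      ∑ᶠ α ∈ nonSelfReferencing n, z ^ α.numApp * genC z ^ α.numC *
        ∏ i ∈ Finset.range n, genR i z ^ α.numR i := by
  classical
  apply eq_div_sqrt hz
  have hself : (selfReferencing n).Finite := Set.toFinite {_, _, _, _}
  have hnon : (nonSelfReferencing n).Finite := (finite_productions n).subset fun p hp => hp.1
  have h1 : genR n z = ∑ᶠ p ∈ productions n, genTree z p := by
    rw [genR_eq_sum_productions hz, finsum_mem_eq_finite_toFinset_sum _ (finite_productions n)]
  rw [productions_eq_union hn, finsum_mem_union (disjoint_selfReferencing n) hself hnon] at h1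
  have h2 : ∑ᶠ p ∈ selfReferencing n, genTree z p =
      2 * z * genR n z + 2 * z ^ 2 * genR 0 z * genR n z := by
    have h : selfReferencing n = (({.app .S (.R n), .app .K (.R n), .app (.app .S (.R 0)) (.R n),
        .app (.app .S (.R n)) (.R 0)} : Finset Tree) : Set Tree) := by
      simp [selfReferencing]
    -- For `n = 0` the last two self-referencing productions would coincide and be counted only
    -- once.
    have hn' : 0 ≠ n := by omega
    rw [h, finsum_mem_coe_finset, Finset.sum_insert (by simp), Finset.sum_insert (by simp),
      Finset.sum_insert (by simp [hn']), Finset.sum_singleton]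
    simp only [genTree_app hz, genTree_S hz, genTree_K hz, genTree_R]
    ring
  rw [h2] at h1
  rw [← finsum_mem_congr rfl fun p hp => ?_]
  · exact h1
  · refine genTree_eq h0 hz p fun i hi => ?_
    rcases hi.eq_or_lt with rfl | hi
    · exact hp.2
    · rcases productions_shape hp.1 with h | h
      · exact Tree.Spine.numR_eq_zero (spine_of_mem_selfReferencing h).isArg hi
      · exact Tree.Spine.numR_eq_zero h.isArg hi.le

end

/-! ### An algorithm for the closed forms

Patterns are intersections of the sets of terms normalizing in `k` steps and of sets of terms
`X t₁ … tₘ` with given patterns for the arguments. -/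

/-- A head (`true` for `S`, `false` for `K`) and the codes of the arguments, last one first. -/
abbrev PSpine := Bool × List ℕ

/-- An intersection: a list of numbers of reduction steps and a list of spines. -/
abbrev Pattern := List ℕ × List PSpine

/-- The pattern with a given code. -/
def dec (a : ℕ) : Pattern := (Encodable.decode₂ Pattern a).getD ([], [])

/-- The code of a pattern. -/
def enc (p : Pattern) : ℕ := Encodable.encode p

@[simp] theorem dec_enc (p : Pattern) : dec (enc p) = p := by simp [dec, enc]

/-- The code of the pattern of all terms. -/
def topCode : ℕ := enc ([], [])

/-- The code of the pattern of the terms normalizing in `k` steps. -/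
def redCode (k : ℕ) : ℕ := enc ([k], [])

/-- The code of the pattern given by a spine. -/
def spineCode (s : PSpine) : ℕ := enc ([], [s])

/-- The code of an intersection. -/
def interCode (a b : ℕ) : ℕ := enc ((dec a).1 ++ (dec b).1, (dec a).2 ++ (dec b).2)

/-- The self-referencing spines for the terms normalizing in `k` steps. -/
def selfSpines (k : ℕ) : List PSpine :=
  if k = 0 then [(true, [redCode 0]), (false, [redCode 0]), (true, [redCode 0, redCode 0])]
  else [(true, [redCode k]), (false, [redCode k]), (true, [redCode k, redCode 0]),
    (true, [redCode 0, redCode k])]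

/-- The spines for the terms normalizing in `k` steps, if `T` lists the ones which are not
self-referencing. -/
def lookup (T : List (List PSpine)) (k : ℕ) : List PSpine := selfSpines k ++ T.getD k []

/-- The spines of the members of an intersection. -/
def options (T : List (List PSpine)) (a : ℕ) : List (List PSpine) :=
  (dec a).1.map (lookup T) ++ (dec a).2.map fun s => [s]

/-- The intersection of two spines. -/
def meetSpine (s t : PSpine) : List PSpine :=
  if s.1 = t.1 ∧ s.2.length = t.2.length then [(s.1, List.zipWith interCode s.2 t.2)] else []

/-- The intersection of two unions of spines. -/
def meetSpines (L M : List PSpine) : List PSpine := L.flatMap fun s => M.flatMap (meetSpine s)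

/-- A pattern, not the one of all terms, as a disjoint union of spines. -/
def unfoldCode (T : List (List PSpine)) (a : ℕ) : List PSpine :=
  (options T a).tail.foldl meetSpines (options T a).headI

/-- The pairs of patterns for the pairs `y`, `z` such that `z` matches `a` and `y z`
matches `b`. -/
def rewriteCodes (T : List (List PSpine)) (a b : ℕ) : List (ℕ × ℕ) :=
  if options T b = [] then [(topCode, a)]
  else (unfoldCode T b).flatMap fun s =>
    s.2.casesOn [] fun c cs => [(spineCode (s.1, cs), interCode a c)]

/-- Adding a last argument to a spine. -/
def consArg (a : ℕ) (s : PSpine) : PSpine := (s.1, a :: s.2)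

/-- The spines of terms with a head redex `K x y` and at least one further argument. -/
def expandK (X : Bool) : List ℕ → List PSpine
  | [] => []
  | a :: as => (false, [a, topCode, spineCode (X, as)]) :: (expandK X as).map (consArg a)

/-- The spines of terms with a head redex `S x y z` that has no further arguments. -/
def expandSLast (T : List (List PSpine)) (X : Bool) (b : ℕ) (l : List ℕ) : List PSpine :=
  l.casesOn [] fun a as =>
    (rewriteCodes T a b).map fun q => (true, [q.2, q.1, spineCode (X, as)])

/-- The spines of terms with a head redex `S x y z`. -/
def expandS (T : List (List PSpine)) (X : Bool) : List ℕ → List PSpine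
  | [] => []
  | b :: l => expandSLast T X b l ++ (expandS T X l).map (consArg b)

/-- The spines for `n + 1` steps which are not self-referencing. -/
def nextSpines (T : List (List PSpine)) (n : ℕ) : List PSpine :=
  (List.range n).map (fun i => (true, [redCode (n - i), redCode (i + 1)])) ++
  [(false, [topCode, redCode n])] ++
  (lookup T n).flatMap (fun s => expandK s.1 s.2) ++
  (lookup T n).flatMap (fun s => expandS T s.1 s.2)

/-- The lists of spines which are not self-referencing for at most `n` steps. -/
def table : ℕ → List (List PSpine)
  | 0 => [[(true, []), (false, [])]]
  | n + 1 => table n ++ [nextSpines (table n) n]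

/-! ### Correctness of the spines -/

open Classical in
/-- The indicator of the terms normalizing in `k` steps. -/
noncomputable def redVal (k : ℕ) (x : Term) : ℕ := if Reduces k x then 1 else 0

/-- The indicator of the terms described by a spine. -/
noncomputable def spineVal : Term → PSpine → ℕ
  | .S, s => if s = (true, []) then 1 else 0
  | .K, s => if s = (false, []) then 1 else 0
  | .app _ _, (_, []) => 0
  | .app f x, (X, a :: as) =>
    spineVal f (X, as) *
      (((dec a).1.map fun k => redVal k x).prod * ((dec a).2.map (spineVal x)).prod)

/-- The indicator of the terms matching a pattern. -/
noncomputable def codeVal (x : Term) (a : ℕ) : ℕ :=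
  ((dec a).1.map fun k => redVal k x).prod * ((dec a).2.map (spineVal x)).prod

/-- The number of spines in a list that describe a term. -/
noncomputable def spinesVal (x : Term) (L : List PSpine) : ℕ := (L.map (spineVal x)).sum

@[simp] theorem codeVal_topCode (x : Term) : codeVal x topCode = 1 := by simp [codeVal, topCode]

@[simp] theorem codeVal_redCode (x : Term) (k : ℕ) : codeVal x (redCode k) = redVal k x := by
  simp [codeVal, redCode]

@[simp] theorem codeVal_spineCode (x : Term) (s : PSpine) :
    codeVal x (spineCode s) = spineVal x s := by
  simp [codeVal, spineCode]

@[simp] theorem codeVal_interCode (x : Term) (a b : ℕ) :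
    codeVal x (interCode a b) = codeVal x a * codeVal x b := by
  simp only [codeVal, interCode, dec_enc, List.map_append, List.prod_append]
  ring

@[simp] theorem spineVal_S_cons (X : Bool) (a : ℕ) (as : List ℕ) :
    spineVal .S (X, a :: as) = 0 := by simp [spineVal]

@[simp] theorem spineVal_K_cons (X : Bool) (a : ℕ) (as : List ℕ) :
    spineVal .K (X, a :: as) = 0 := by simp [spineVal]

@[simp] theorem spineVal_app_nil (f x : Term) (X : Bool) : spineVal (.app f x) (X, []) = 0 := rfl

-- The recursive clause of `spineVal` spells out `codeVal`, which is itself defined from `spineVal`;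
-- from here on only the folded form is needed.
@[simp] theorem spineVal_app_cons (f x : Term) (X : Bool) (a : ℕ) (as : List ℕ) :
    spineVal (.app f x) (X, a :: as) = spineVal f (X, as) * codeVal x a := rfl

@[simp] theorem spineVal_S_nil (X : Bool) : spineVal .S (X, []) = if X then 1 else 0 := by
  simp [spineVal]

@[simp] theorem spineVal_K_nil (X : Bool) : spineVal .K (X, []) = if X then 0 else 1 := by
  cases X <;> simp [spineVal]

theorem spineVal_nil_of_ne {x : Term} (hS : x ≠ .S) (hK : x ≠ .K) (X : Bool) :
    spineVal x (X, []) = 0 := by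
  cases x <;> simp_all

@[simp] theorem spinesVal_nil (x : Term) : spinesVal x [] = 0 := rfl

@[simp] theorem spinesVal_cons (x : Term) (s : PSpine) (L : List PSpine) :
    spinesVal x (s :: L) = spineVal x s + spinesVal x L := by simp [spinesVal]

@[simp] theorem spinesVal_append (x : Term) (L M : List PSpine) :
    spinesVal x (L ++ M) = spinesVal x L + spinesVal x M := by simp [spinesVal]

theorem spinesVal_flatMap {α : Type*} (x : Term) (L : List α) (f : α → List PSpine) :
    spinesVal x (L.flatMap f) = (L.map fun s => spinesVal x (f s)).sum := by
  induction L with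
  | nil => simp
  | cons a L ih => simp [ih]

theorem spinesVal_map_consArg (f x : Term) (a : ℕ) (L : List PSpine) :
    spinesVal (.app f x) (L.map (consArg a)) = spinesVal f L * codeVal x a := by
  induction L with
  | nil => simp
  | cons s L ih => simp [ih, consArg, add_mul]

theorem meetSpine_cons (X Y : Bool) (a b : ℕ) (as bs : List ℕ) :
    meetSpine (X, a :: as) (Y, b :: bs) =
      (meetSpine (X, as) (Y, bs)).map (consArg (interCode a b)) := by
  simp only [meetSpine, List.length_cons, Nat.add_right_cancel_iff, List.zipWith_cons_cons]
  split_ifs <;> simp [consArg]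

/-- Spines with different heads or lengths have no term in common; otherwise the intersection is
taken argument by argument. Working with counts replaces the existence and uniqueness arguments used
for mesh sets. -/
theorem spinesVal_meetSpine (x : Term) (s t : PSpine) :
    spinesVal x (meetSpine s t) = spineVal x s * spineVal x t := by
  induction x generalizing s t with
  | S =>
    obtain ⟨X, _ | ⟨a, as⟩⟩ := s <;> obtain ⟨Y, _ | ⟨b, bs⟩⟩ := t <;> cases X <;> cases Y <;>
      simp [meetSpine, apply_ite (spinesVal _)]
  | K =>
    obtain ⟨X, _ | ⟨a, as⟩⟩ := s <;> obtain ⟨Y, _ | ⟨b, bs⟩⟩ := t <;> cases X <;> cases Y <;>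
      simp [meetSpine, apply_ite (spinesVal _)]
  | app f x ihf _ =>
    obtain ⟨X, _ | ⟨a, as⟩⟩ := s <;> obtain ⟨Y, _ | ⟨b, bs⟩⟩ := t
    · simp [meetSpine, apply_ite (spinesVal _)]
    · simp [meetSpine]
    · simp [meetSpine]
    · rw [meetSpine_cons, spinesVal_map_consArg, ihf]
      simp only [codeVal_interCode, spineVal_app_cons]
      ring

theorem spinesVal_meetSpines (x : Term) (L M : List PSpine) :
    spinesVal x (meetSpines L M) = spinesVal x L * spinesVal x M := by
  simp only [meetSpines, spinesVal_flatMap, spinesVal_meetSpine]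
  simp only [List.sum_map_mul_left]
  rw [List.sum_map_mul_right]
  rfl

theorem spinesVal_foldl_meetSpines (x : Term) (L : List (List PSpine)) (M : List PSpine) :
    spinesVal x (L.foldl meetSpines M) = spinesVal x M * (L.map (spinesVal x)).prod := by
  induction L generalizing M with
  | nil => simp
  | cons N L ih =>
    rw [List.foldl_cons, ih, spinesVal_meetSpines, List.map_cons, List.prod_cons, mul_assoc]

/-- The spines listed in `T` describe the terms normalizing in fewer than `N` steps. -/
def TableCorrect (T : List (List PSpine)) (N : ℕ) : Prop :=
  ∀ k < N, ∀ x, spinesVal x (lookup T k) = redVal k x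

/-- All numbers of reduction steps in the pattern with code `a` are less than `N`. -/
inductive IndexLt (N : ℕ) : ℕ → Prop
  | mk {a : ℕ} : (∀ k ∈ (dec a).1, k < N) → (∀ s ∈ (dec a).2, ∀ b ∈ s.2, IndexLt N b) →
    IndexLt N a

/-- All numbers of reduction steps in a spine are less than `N`. -/
def SpineIndexLt (N : ℕ) (s : PSpine) : Prop := ∀ a ∈ s.2, IndexLt N a

theorem indexLt_iff {N a : ℕ} :
    IndexLt N a ↔ (∀ k ∈ (dec a).1, k < N) ∧ ∀ s ∈ (dec a).2, SpineIndexLt N s :=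
  ⟨fun h => by cases h with | mk h1 h2 => exact ⟨h1, h2⟩, fun h => .mk h.1 h.2⟩

section

variable {T : List (List PSpine)} {N : ℕ}

theorem prod_options (hT : TableCorrect T N) {a : ℕ} (ha : IndexLt N a) (x : Term) :
    ((options T a).map (spinesVal x)).prod = codeVal x a := by
  rw [options, List.map_append, List.prod_append, codeVal, List.map_map, List.map_map]
  congr 2
  · exact List.map_congr_left fun k hk => hT k ((indexLt_iff.1 ha).1 k hk) x

theorem spinesVal_unfoldCode (hT : TableCorrect T N) {a : ℕ} (ha : IndexLt N a)
    (h : options T a ≠ []) (x : Term) : spinesVal x (unfoldCode T a) = codeVal x a := by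
  rw [unfoldCode, spinesVal_foldl_meetSpines, ← prod_options hT ha]
  cases ho : options T a with
  | nil => exact absurd ho h
  | cons L M => simp

/-- The counting analogue of `exists_rewriting`: unfolding `b` exposes its last argument, which is
then intersected with `a`. -/
theorem sum_rewriteCodes (hT : TableCorrect T N) (a : ℕ) {b : ℕ} (hb : IndexLt N b) (y z : Term) :
    ((rewriteCodes T a b).map fun q => codeVal y q.1 * codeVal z q.2).sum =
      codeVal z a * codeVal (.app y z) b := by
  rw [rewriteCodes]
  split_ifs with h
  -- No options means that `b` imposes no condition, so its indicator is the empty product 1.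
  · have := prod_options hT hb (.app y z)
    rw [h] at this
    simp [← this]
  · rw [← spinesVal_unfoldCode hT hb h]
    induction unfoldCode T b with
    | nil => simp
    | cons s L ih =>
      rw [List.flatMap_cons, List.map_append, List.sum_append, ih, spinesVal_cons, mul_add]
      congr 1
      obtain ⟨X, _ | ⟨c, cs⟩⟩ := s
      · simp
      · simp
        ring

/-! ### Head contractions and spines -/

theorem expandK_of_not_headK {x : Term} (h : ∀ y, ¬ HeadK x y) (X : Bool) (l : List ℕ) :
    spinesVal x (expandK X l) = 0 := by
  induction l generalizing x with
  | nil => simp [expandK]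
  | cons a l ih =>
    cases x with
    | S => simp [expandK, spinesVal, consArg, Function.comp_def]
    | K => simp [expandK, spinesVal, consArg, Function.comp_def]
    | app f w =>
      rw [expandK, spinesVal_cons, spinesVal_map_consArg, ih fun y hy => h _ hy.app, zero_mul,
        add_zero, spineVal_app_cons]
      cases f with
      | S => simp
      | K => simp
      | app f v =>
        cases f with
        | S => simp
        | K => simp
        | app f u =>
          cases f with
          | K => exact absurd .last (h _)
          | S => simp
          | app _ _ => simp

theorem expandK_of_headK {x y : Term} (h : HeadK x y) (X : Bool) (l : List ℕ) :
    spinesVal x (expandK X l) = spineVal y (X, l) := by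
  induction h generalizing l with
  | last =>
    cases l with
    | nil => simp [expandK]
    | cons a l =>
      rw [expandK, spinesVal_cons, spinesVal_map_consArg,
        expandK_of_not_headK fun _ => not_headK_app_app (.inr rfl)]
      simp
  | app h ih =>
    cases l with
    | nil => simp [expandK]
    | cons a l =>
      rw [expandK, spinesVal_cons, spinesVal_map_consArg, ih]
      -- The function part already has a two-argument prefix not headed by a combinator, so the
      -- three-argument spine for a redex at this place does not match.
      obtain ⟨a, b, c, rfl, hS, hK⟩ := h.exists_eq
      simp [spineVal_nil_of_ne hS hK]

theorem spinesVal_expandSLast (hT : TableCorrect T N) (X : Bool) {b : ℕ} (hb : IndexLt N b)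
    (a : ℕ) (l : List ℕ) (u y z : Term) :
    spinesVal (.app (.app (.app .S u) y) z) (expandSLast T X b (a :: l)) =
      spineVal u (X, l) * (codeVal z a * codeVal (.app y z) b) := by
  rw [← sum_rewriteCodes hT a hb, expandSLast, spinesVal]
  simp only [List.map_map, ← List.sum_map_mul_left]
  congr 1
  refine List.map_congr_left fun q _ => ?_
  simp
  ring

theorem spinesVal_expandSLast_eq_zero {x : Term} (h : ∀ u y z, x ≠ .app (.app (.app .S u) y) z)
    (X : Bool) (b : ℕ) (l : List ℕ) : spinesVal x (expandSLast T X b l) = 0 := by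
  cases l with
  | nil => rfl
  | cons a l =>
    rw [spinesVal, expandSLast, List.map_map]
    refine List.sum_eq_zero fun v hv => ?_
    obtain ⟨q, -, rfl⟩ := List.mem_map.1 hv
    cases x with
    | S => simp
    | K => simp
    | app f z =>
      cases f with
      | S => simp
      | K => simp
      | app f y =>
        cases f with
        | S => simp
        | K => simp
        | app f u =>
          cases f with
          | S => exact absurd rfl (h u y z)
          | K => simp
          | app _ _ => simp

theorem expandS_of_not_headS {x : Term} (h : ∀ y, ¬ HeadS x y) (X : Bool) (l : List ℕ) :
    spinesVal x (expandS T X l) = 0 := by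
  induction l generalizing x with
  | nil => simp [expandS]
  | cons a l ih =>
    rw [expandS, spinesVal_append, spinesVal_expandSLast_eq_zero, zero_add]
    · cases x with
      | S => simp [spinesVal, consArg, Function.comp_def]
      | K => simp [spinesVal, consArg, Function.comp_def]
      | app f w => rw [spinesVal_map_consArg, ih fun y hy => h _ hy.app, zero_mul]
    · rintro u y z rfl
      exact h _ .last

/-- The induction on the position of the redex leaves one nonzero contribution: `expandSLast` at the
end of the redex, and the recursive part beyond it. The index bound is needed to evaluate the
patterns with the table. -/
theorem expandS_of_headS (hT : TableCorrect T N) {x y : Term} (h : HeadS x y) (X : Bool)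
    {l : List ℕ} (hl : ∀ a ∈ l, IndexLt N a) :
    spinesVal x (expandS T X l) = spineVal y (X, l) := by
  induction h generalizing l with
  | last =>
    cases l with
    | nil => simp [expandS]
    | cons b l =>
      rw [expandS, spinesVal_append, spinesVal_map_consArg,
        expandS_of_not_headS fun _ => not_headS_app_app (.inl rfl), zero_mul, add_zero]
      cases l with
      | nil => simp [expandSLast]
      | cons a l =>
        rw [spinesVal_expandSLast hT X (hl b (by simp))]
        simp
        ring
  | app h ih =>
    cases l with
    | nil => simp [expandS]
    | cons b l =>
      rw [expandS, spinesVal_append, spinesVal_map_consArg,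
        ih fun a ha => hl a (List.mem_cons_of_mem _ ha), spinesVal_expandSLast_eq_zero]
      · simp
      · rintro u y z heq
        simp only [Term.app.injEq] at heq
        rw [heq.1] at h
        exact not_headS_app_app (.inl rfl) h

/-! ### Bounds on the numbers of reduction steps -/

theorem indexLt_topCode : IndexLt N topCode := by simp [indexLt_iff, topCode]

theorem indexLt_redCode {k : ℕ} (hk : k < N) : IndexLt N (redCode k) := by
  simp [indexLt_iff, redCode, hk]

theorem indexLt_spineCode {s : PSpine} (hs : SpineIndexLt N s) : IndexLt N (spineCode s) := by
  simp [indexLt_iff, spineCode, hs]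

theorem indexLt_interCode {a b : ℕ} (ha : IndexLt N a) (hb : IndexLt N b) :
    IndexLt N (interCode a b) := by
  rw [indexLt_iff] at ha hb ⊢
  simp only [interCode, dec_enc, List.mem_append]
  exact ⟨fun k hk => hk.elim (ha.1 k) (hb.1 k), fun s hs => hs.elim (ha.2 s) (hb.2 s)⟩

theorem IndexLt.mono {M a : ℕ} (h : N ≤ M) (ha : IndexLt N a) : IndexLt M a := by
  induction ha with
  | mk h1 _ ih => exact .mk (fun k hk => (h1 k hk).trans_le h) ih

theorem SpineIndexLt.mono {M : ℕ} (h : N ≤ M) {s : PSpine} (hs : SpineIndexLt N s) :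
    SpineIndexLt M s := fun a ha => (hs a ha).mono h

theorem spineIndexLt_meetSpine {s t u : PSpine} (hs : SpineIndexLt N s) (ht : SpineIndexLt N t)
    (hu : u ∈ meetSpine s t) : SpineIndexLt N u := by
  rw [meetSpine] at hu
  split_ifs at hu
  · obtain rfl := List.mem_singleton.1 hu
    intro c hc
    obtain ⟨X, as⟩ := s
    obtain ⟨Y, bs⟩ := t
    simp only [← List.map_uncurry_zip_eq_zipWith, List.mem_map] at hc
    obtain ⟨⟨a, b⟩, hab, rfl⟩ := hc
    exact indexLt_interCode (hs a (List.of_mem_zip hab).1) (ht b (List.of_mem_zip hab).2)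
  · simp at hu

theorem spineIndexLt_meetSpines {L M : List PSpine} (hL : ∀ s ∈ L, SpineIndexLt N s)
    (hM : ∀ s ∈ M, SpineIndexLt N s) : ∀ s ∈ meetSpines L M, SpineIndexLt N s := by
  intro u hu
  simp only [meetSpines, List.mem_flatMap] at hu
  obtain ⟨s, hs, t, ht, hu⟩ := hu
  exact spineIndexLt_meetSpine (hL s hs) (hM t ht) hu

theorem spineIndexLt_unfoldCode (hT : ∀ k < N, ∀ s ∈ lookup T k, SpineIndexLt N s) {a : ℕ}
    (ha : IndexLt N a) : ∀ s ∈ unfoldCode T a, SpineIndexLt N s := by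
  have ho : ∀ L ∈ options T a, ∀ s ∈ L, SpineIndexLt N s := by
    intro L hL s hs
    rw [indexLt_iff] at ha
    simp only [options, List.mem_append, List.mem_map] at hL
    rcases hL with ⟨k, hk, rfl⟩ | ⟨t, ht, rfl⟩
    · exact hT k (ha.1 k hk) s hs
    · rw [List.mem_singleton.1 hs]
      exact ha.2 t ht
  have hf : ∀ (L : List (List PSpine)) (M : List PSpine), (∀ K ∈ L, ∀ s ∈ K, SpineIndexLt N s) →
      (∀ s ∈ M, SpineIndexLt N s) → ∀ s ∈ L.foldl meetSpines M, SpineIndexLt N s := by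
    intro L
    induction L with
    | nil => exact fun M _ hM => hM
    | cons K L ih =>
      exact fun M hL hM => ih _ (fun K' hK' => hL K' (List.mem_cons_of_mem _ hK'))
        (spineIndexLt_meetSpines hM (hL K List.mem_cons_self))
  rw [unfoldCode]
  cases h : options T a with
  | nil => exact fun s hs => absurd hs List.not_mem_nil
  | cons L M =>
    rw [h] at ho
    exact hf M L (fun K hK => ho K (List.mem_cons_of_mem _ hK)) (ho L List.mem_cons_self)

theorem indexLt_rewriteCodes (hT : ∀ k < N, ∀ s ∈ lookup T k, SpineIndexLt N s) {a b : ℕ}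
    (ha : IndexLt N a) (hb : IndexLt N b) {q : ℕ × ℕ} (hq : q ∈ rewriteCodes T a b) :
    IndexLt N q.1 ∧ IndexLt N q.2 := by
  rw [rewriteCodes] at hq
  split_ifs at hq
  · rw [List.mem_singleton.1 hq]
    exact ⟨indexLt_topCode, ha⟩
  · obtain ⟨⟨X, _ | ⟨c, cs⟩⟩, hs, hq⟩ := List.mem_flatMap.1 hq
    · simp at hq
    · have hs := spineIndexLt_unfoldCode hT hb _ hs
      rw [List.mem_singleton.1 hq]
      exact ⟨indexLt_spineCode fun d hd => hs d (List.mem_cons_of_mem _ hd),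
        indexLt_interCode ha (hs c List.mem_cons_self)⟩

theorem spineIndexLt_cons {X : Bool} {a : ℕ} {l : List ℕ} :
    SpineIndexLt N (X, a :: l) ↔ IndexLt N a ∧ SpineIndexLt N (X, l) := by
  simp [SpineIndexLt]

theorem spineIndexLt_nil {X : Bool} : SpineIndexLt N (X, []) := by
  simp [SpineIndexLt]

theorem spineIndexLt_expandK {X : Bool} {l : List ℕ} (h : SpineIndexLt N (X, l)) :
    ∀ s ∈ expandK X l, SpineIndexLt N s := by
  induction l with
  | nil => simp [expandK]
  | cons a l ih =>
    rw [spineIndexLt_cons] at h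
    intro s hs
    rcases List.mem_cons.1 hs with rfl | hs
    · simp [spineIndexLt_cons, spineIndexLt_nil, h.1, indexLt_topCode, indexLt_spineCode h.2]
    · obtain ⟨t, ht, rfl⟩ := List.mem_map.1 hs
      exact spineIndexLt_cons.2 ⟨h.1, ih h.2 t ht⟩

theorem spineIndexLt_expandS (hT : ∀ k < N, ∀ s ∈ lookup T k, SpineIndexLt N s) {X : Bool}
    {l : List ℕ} (h : SpineIndexLt N (X, l)) : ∀ s ∈ expandS T X l, SpineIndexLt N s := by
  induction l with
  | nil => simp [expandS]
  | cons b l ih =>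
    rw [spineIndexLt_cons] at h
    intro s hs
    rcases List.mem_append.1 hs with hs | hs
    · cases l with
      | nil => simp [expandSLast] at hs
      | cons a l =>
        rw [spineIndexLt_cons] at h
        obtain ⟨q, hq, rfl⟩ := List.mem_map.1 hs
        have hq := indexLt_rewriteCodes hT h.2.1 h.1 hq
        simp [spineIndexLt_cons, spineIndexLt_nil, hq.1, hq.2, indexLt_spineCode h.2.2]
    · obtain ⟨t, ht, rfl⟩ := List.mem_map.1 hs
      exact spineIndexLt_cons.2 ⟨h.1, ih h.2 t ht⟩

theorem spineIndexLt_selfSpines {k : ℕ} (hk : k < N) : ∀ s ∈ selfSpines k, SpineIndexLt N s := by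
  have h0 := indexLt_redCode (Nat.zero_lt_of_lt hk)
  have hk := indexLt_redCode hk
  intro s hs
  rw [selfSpines] at hs
  split_ifs at hs <;> simp only [List.mem_cons, List.not_mem_nil, or_false] at hs
  · rcases hs with rfl | rfl | rfl <;> simp [spineIndexLt_cons, spineIndexLt_nil, h0]
  · rcases hs with rfl | rfl | rfl | rfl <;> simp [spineIndexLt_cons, spineIndexLt_nil, h0, hk]

theorem spineIndexLt_nextSpines {n : ℕ}
    (hT : ∀ k < n + 1, ∀ s ∈ lookup T k, SpineIndexLt (n + 1) s) :
    ∀ s ∈ nextSpines T n, SpineIndexLt (n + 1) s := by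
  intro s hs
  simp only [nextSpines, List.mem_append, List.mem_map, List.mem_range, List.mem_singleton,
    List.mem_flatMap] at hs
  rcases hs with ((⟨i, hi, rfl⟩ | rfl) | ⟨t, ht, hs⟩) | ⟨t, ht, hs⟩
  · simp [spineIndexLt_cons, spineIndexLt_nil, indexLt_redCode (show n - i < n + 1 by omega),
      indexLt_redCode (show i + 1 < n + 1 by omega)]
  · simp [spineIndexLt_cons, spineIndexLt_nil, indexLt_redCode, indexLt_topCode]
  · exact spineIndexLt_expandK (hT n n.lt_succ_self t ht) s hs
  · exact spineIndexLt_expandS hT (hT n n.lt_succ_self t ht) s hs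

/-! ### Correctness of the table -/

theorem redVal_of_iff {k l : ℕ} {x y : Term} (h : Reduces k x ↔ Reduces l y) :
    redVal k x = redVal l y := by
  by_cases hy : Reduces l y
  · simp [redVal, hy, h.2 hy]
  · simp [redVal, hy, mt h.1 hy]

theorem HeadK.redVal_eq {n : ℕ} {x y : Term} (h : HeadK x y) : redVal (n + 1) x = redVal n y :=
  redVal_of_iff (by simpa using h.reduces (n := n + 1))

theorem HeadS.redVal_eq {n : ℕ} {x y : Term} (h : HeadS x y) : redVal (n + 1) x = redVal n y :=
  redVal_of_iff (by simpa using h.reduces (n := n + 1))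

theorem sum_map_range (f : ℕ → ℕ) (n : ℕ) :
    ((List.range n).map f).sum = ∑ i ∈ Finset.range n, f i := by
  induction n with
  | zero => rfl
  | succ n ih =>
    rw [List.range_succ, List.map_append, List.sum_append, ih, Finset.sum_range_succ]
    simp

theorem redVal_eq_zero {k : ℕ} {x : Term} (h : ¬ Reduces k x) : redVal k x = 0 := by
  simp [redVal, h]

theorem sum_redVal_mul (n : ℕ) (u v : Term) :
    ∑ i ∈ Finset.range (n + 1), redVal i u * redVal (n - i) v =
      redVal n (.app (.app .S u) v) := by
  by_cases h : Reduces n (.app (.app .S u) v)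
  · obtain ⟨i, j, rfl, hi, hj⟩ := reduces_app_app_S.1 h
    rw [Finset.sum_eq_single i]
    · simp [redVal, h, hi, hj]
    · intro k _ hk
      simp [redVal_eq_zero fun h => hk (reduces_unique h hi)]
    · simp
  · rw [redVal_eq_zero h]
    refine Finset.sum_eq_zero fun i hi => ?_
    rw [Finset.mem_range] at hi
    by_contra h'
    rw [mul_eq_zero, not_or] at h'
    refine h (reduces_app_app_S.2 ⟨i, n - i, by omega, ?_, ?_⟩)
    · by_contra h; exact h'.1 (redVal_eq_zero h)
    · by_contra h; exact h'.2 (redVal_eq_zero h)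

theorem spinesVal_flatMap_expandK {n : ℕ} (hT : TableCorrect T (n + 1)) {x y : Term}
    (h : HeadK x y) : spinesVal x ((lookup T n).flatMap fun s => expandK s.1 s.2) = redVal n y := by
  rw [spinesVal_flatMap, ← hT n n.lt_succ_self]
  simp only [expandK_of_headK h]
  rfl

theorem spinesVal_flatMap_expandK_eq_zero {n : ℕ} {x : Term} (h : ∀ y, ¬ HeadK x y) :
    spinesVal x ((lookup T n).flatMap fun s => expandK s.1 s.2) = 0 := by
  rw [spinesVal_flatMap]
  simp [expandK_of_not_headK h]

theorem spinesVal_flatMap_expandS {n : ℕ} (hT : TableCorrect T (n + 1))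
    (hI : ∀ s ∈ lookup T n, SpineIndexLt (n + 1) s) {x y : Term}
    (h : HeadS x y) :
    spinesVal x ((lookup T n).flatMap fun s => expandS T s.1 s.2) = redVal n y := by
  rw [spinesVal_flatMap, ← hT n n.lt_succ_self, spinesVal]
  congr 1
  exact List.map_congr_left fun s hs => expandS_of_headS hT h s.1 (hI s hs)

theorem spinesVal_flatMap_expandS_eq_zero {n : ℕ} {x : Term} (h : ∀ y, ¬ HeadS x y) :
    spinesVal x ((lookup T n).flatMap fun s => expandS T s.1 s.2) = 0 := by
  rw [spinesVal_flatMap]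
  simp [expandS_of_not_headS h]

theorem spinesVal_range_eq_zero {n : ℕ} {x : Term} {f g : ℕ → ℕ}
    (h : ∀ u v, x ≠ .app (.app .S u) v) :
    spinesVal x ((List.range n).map fun i => (true, [f i, g i])) = 0 := by
  rw [spinesVal, List.map_map]
  refine List.sum_eq_zero fun v hv => ?_
  obtain ⟨i, -, rfl⟩ := List.mem_map.1 hv
  cases x with
  | S => simp
  | K => simp
  | app w v =>
    cases w with
    | S => simp
    | K => simp
    | app w u =>
      cases w with
      | S => exact absurd rfl (h u v)
      | K => simp
      | app _ _ => simp

/-- The counting analogue of `existsUnique_nextProductions`: for each shape only the spines of the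
corresponding kind can contribute. -/
theorem spinesVal_next {n : ℕ} (hT : TableCorrect T (n + 1))
    (hI : ∀ s ∈ lookup T n, SpineIndexLt (n + 1) s) (x : Term) :
    spinesVal x (selfSpines (n + 1) ++ nextSpines T n) = redVal (n + 1) x := by
  simp only [spinesVal_append, nextSpines, selfSpines, Nat.add_one_ne_zero, if_false]
  cases shape x with
  | S =>
    rw [spinesVal_range_eq_zero (by simp), spinesVal_flatMap_expandK_eq_zero (by rintro _ ⟨⟩),
      spinesVal_flatMap_expandS_eq_zero (by rintro _ ⟨⟩), redVal_eq_zero (by simp [reduces_S])]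
    simp
  | K =>
    rw [spinesVal_range_eq_zero (by simp), spinesVal_flatMap_expandK_eq_zero (by rintro _ ⟨⟩),
      spinesVal_flatMap_expandS_eq_zero (by rintro _ ⟨⟩), redVal_eq_zero (by simp [reduces_K])]
    simp
  | S₁ u =>
    rw [spinesVal_range_eq_zero (by simp),
      spinesVal_flatMap_expandK_eq_zero (fun _ => not_headK_S₁),
      spinesVal_flatMap_expandS_eq_zero (fun _ => not_headS_S₁), redVal_of_iff reduces_app_S]
    simp
  | K₁ u =>
    rw [spinesVal_range_eq_zero (by simp),
      spinesVal_flatMap_expandK_eq_zero (fun _ => not_headK_K₁),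
      spinesVal_flatMap_expandS_eq_zero (fun _ => not_headS_K₁), redVal_of_iff reduces_app_K]
    simp
  | S₂ u v =>
    -- In the convolution over i + j = n + 1 the two end terms come from `selfSpines`; the inner
    -- ones come from the range in `nextSpines`.
    rw [spinesVal_flatMap_expandK_eq_zero (fun _ => not_headK_app_app (.inl rfl)),
      spinesVal_flatMap_expandS_eq_zero (fun _ => not_headS_app_app (.inl rfl)),
      ← sum_redVal_mul, Finset.sum_range_succ, Finset.sum_range_succ', spinesVal, spinesVal,
      List.map_map, sum_map_range]
    simp
    ring_nf
  | K₂ u v =>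
    rw [spinesVal_range_eq_zero (by simp),
      spinesVal_flatMap_expandK_eq_zero (fun _ => not_headK_app_app (.inr rfl)),
      spinesVal_flatMap_expandS_eq_zero (fun _ => not_headS_app_app (.inr rfl)),
      redVal_of_iff (l := n) (y := u) (by simp [reduces_app_app_K])]
    simp
  | headK h =>
    rw [spinesVal_flatMap_expandK hT h, spinesVal_flatMap_expandS_eq_zero (fun _ => h.not_headS),
      h.redVal_eq]
    obtain ⟨a, b, c, rfl, hS, hK⟩ := h.exists_eq
    rw [spinesVal_range_eq_zero (by simp [hS])]
    simp [spineVal_nil_of_ne hS hK]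
  | headS h =>
    rw [spinesVal_flatMap_expandK_eq_zero (fun _ h' => h'.not_headS h),
      spinesVal_flatMap_expandS hT hI h,
      h.redVal_eq]
    obtain ⟨a, b, c, rfl, hS, hK⟩ := h.exists_eq
    rw [spinesVal_range_eq_zero (by simp [hS])]
    simp [spineVal_nil_of_ne hS hK]

theorem spinesVal_zero (x : Term) :
    spinesVal x (selfSpines 0 ++ [(true, []), (false, [])]) = redVal 0 x := by
  simp only [spinesVal_append, selfSpines, if_true]
  cases shape x with
  | S => simp [redVal, reduces_S]
  | K => simp [redVal, reduces_K]
  | S₁ u => simp [redVal_of_iff reduces_app_S]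
  | K₁ u => simp [redVal_of_iff reduces_app_K]
  | S₂ u v => simp [← sum_redVal_mul]
  | K₂ u v => simp [redVal, reduces_app_app_K]
  | headK h =>
    rw [redVal_eq_zero (by simp [h.reduces])]
    obtain ⟨a, b, c, rfl, hS, hK⟩ := h.exists_eq
    simp [spineVal_nil_of_ne hS hK]
  | headS h =>
    rw [redVal_eq_zero (by simp [h.reduces])]
    obtain ⟨a, b, c, rfl, hS, hK⟩ := h.exists_eq
    simp [spineVal_nil_of_ne hS hK]

end

theorem length_table (n : ℕ) : (table n).length = n + 1 := by
  induction n with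
  | zero => rfl
  | succ n ih => simp [table, ih]

theorem getD_table_succ_of_le {n k : ℕ} (h : k ≤ n) :
    (table (n + 1)).getD k [] = (table n).getD k [] := by
  rw [table, List.getD_append _ _ _ _ (by rw [length_table]; omega)]

theorem getD_table_succ_self (n : ℕ) :
    (table (n + 1)).getD (n + 1) [] = nextSpines (table n) n := by
  rw [table, List.getD_append_right _ _ _ _ (by rw [length_table]), length_table]
  simp

/-- The strict bound by `k` on the entries for `k` steps is what later lets the expansion descend to
smaller step numbers. -/
theorem table_spec (n : ℕ) : TableCorrect (table n) (n + 1) ∧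
    ∀ k ≤ n, ∀ s ∈ (table n).getD k [], SpineIndexLt k s := by
  induction n with
  | zero =>
    constructor
    · intro k hk x
      obtain rfl : k = 0 := by omega
      exact spinesVal_zero x
    · intro k hk s hs
      obtain rfl : k = 0 := by omega
      simp [table] at hs
      rcases hs with rfl | rfl <;> exact spineIndexLt_nil
  | succ n ih =>
    obtain ⟨hT, hI⟩ := ih
    have hI' : ∀ k < n + 1, ∀ s ∈ lookup (table n) k, SpineIndexLt (n + 1) s := by
      intro k hk s hs
      rcases List.mem_append.1 hs with hs | hs
      · exact spineIndexLt_selfSpines hk s hs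
      · exact (hI k (by omega) s hs).mono hk.le
    constructor
    · intro k hk x
      rcases Nat.lt_succ_iff_lt_or_eq.1 hk with hk | rfl
      · rw [lookup, getD_table_succ_of_le (by omega)]
        exact hT k hk x
      · rw [lookup, getD_table_succ_self]
        exact spinesVal_next hT (hI' n n.lt_succ_self) x
    · intro k hk s hs
      rcases Nat.le_succ_iff.1 hk with hk | rfl
      · rw [getD_table_succ_of_le hk] at hs
        exact hI k hk s hs
      · rw [getD_table_succ_self] at hs
        exact spineIndexLt_nextSpines hI' s hs

theorem spineIndexLt_lookup_table {n k N : ℕ} (hk : k < N) (hN : N ≤ n + 1) :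
    ∀ s ∈ lookup (table n) k, SpineIndexLt N s := by
  intro s hs
  rcases List.mem_append.1 hs with hs | hs
  · exact spineIndexLt_selfSpines hk s hs
  · exact ((table_spec n).2 k (by omega) s hs).mono hk.le

/-! ### Evaluation of patterns -/

/-- The closed forms of `z`, `C(z)`, `R₀(z)` and `1 / √(1 - 4z - 4z²)`. -/
def baseForm : ℕ → ClosedForm
  | 0 => .var
  | 1 => .div (.sub (.const 1) (.sqrt (.sub (.const 1) (.mul (.const 8) .var))))
      (.mul (.const 2) .var)
  | 2 => .div (.sub (.sub (.const 1) (.mul (.const 2) .var))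
      (.sqrt (.sub (.sub (.const 1) (.mul (.const 4) .var)) (.mul (.const 4) (.mul .var .var)))))
      (.mul (.const 2) (.mul .var .var))
  | _ => .div (.const 1)
      (.sqrt (.sub (.sub (.const 1) (.mul (.const 4) .var)) (.mul (.const 4) (.mul .var .var))))

/-- A product of closed forms `baseForm t` and of generating functions of patterns. -/
abbrev Monomial := List (ℕ ⊕ ℕ)

/-- The generating function of a spine as a monomial. -/
def spineMonomial (s : PSpine) : Monomial := s.2.flatMap fun a => [.inl 0, .inr a]

/-- The generating function of a pattern as a sum of monomials. -/
def expandCode (T : List (List PSpine)) (a : ℕ) : List Monomial :=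
  if (dec a).2 = [] then
    if (dec a).1 = [] then [[.inl 1]]
    else if ∀ k ∈ (dec a).1, k = (dec a).1.headI then
      if (dec a).1.headI = 0 then [[.inl 2]]
      else (T.getD (dec a).1.headI []).map fun s => .inl 3 :: spineMonomial s
    else []
  else (unfoldCode T a).map spineMonomial

/-- Replacing the generating function of a pattern by its expansion. -/
def expandFactor (T : List (List PSpine)) (f : ℕ ⊕ ℕ) : List Monomial :=
  f.casesOn (fun t => [[.inl t]]) (expandCode T)

/-- Replacing all generating functions of patterns in a monomial by their expansions. -/
def expandMonomial (T : List (List PSpine)) (m : Monomial) : List Monomial :=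
  m.foldr (fun f r => (expandFactor T f).flatMap fun e => r.map fun m => e ++ m) [[]]

/-- Replacing all generating functions of patterns in a sum of monomials by their expansions. -/
def expandSum (T : List (List PSpine)) (S : List Monomial) : List Monomial :=
  S.flatMap (expandMonomial T)

/-- The result of `t` rounds of expansion, starting with `R n`. -/
def expansion (n t : ℕ) : List Monomial := (expandSum (table n))^[t] [[.inr (redCode n)]]

/-- The patterns that occur in a sum of monomials. -/
def unexpanded (S : List Monomial) : List ℕ :=
  S.flatten.flatMap fun f => f.casesOn (fun _ => []) fun a => [a]

theorem unexpanded_eq_nil {S : List Monomial} :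
    unexpanded S = [] ↔ ∀ m ∈ S, ∀ f ∈ m, ∃ t, f = .inl t := by
  simp only [unexpanded, List.flatMap_eq_nil_iff, List.mem_flatten]
  constructor
  · intro h m hm f hf
    cases f with
    | inl t => exact ⟨t, rfl⟩
    | inr a => exact absurd (h _ ⟨m, hm, hf⟩) (by simp)
  · rintro h f ⟨m, hm, hf⟩
    obtain ⟨t, rfl⟩ := h m hm f hf
    rfl

/-! ### Soundness of the expansion -/

theorem prod_le_one' {l : List ℕ} (h : ∀ a ∈ l, a ≤ 1) : l.prod ≤ 1 := by
  induction l with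
  | nil => simp
  | cons a l ih =>
    rw [List.prod_cons]
    exact Nat.mul_le_mul (h a List.mem_cons_self) (ih fun b hb => h b (List.mem_cons_of_mem _ hb))

theorem redVal_le_one (k : ℕ) (x : Term) : redVal k x ≤ 1 := by
  rw [redVal]
  split_ifs <;> simp

theorem codeVal_le_one_of {x : Term} (h : ∀ s, spineVal x s ≤ 1) (a : ℕ) : codeVal x a ≤ 1 := by
  refine (Nat.mul_le_mul (prod_le_one' fun v hv => ?_) (prod_le_one' fun v hv => ?_)).trans_eq
    (one_mul 1)
  · obtain ⟨k, -, rfl⟩ := List.mem_map.1 hv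
    exact redVal_le_one k x
  · obtain ⟨s, -, rfl⟩ := List.mem_map.1 hv
    exact h s

theorem spineVal_le_one (x : Term) (s : PSpine) : spineVal x s ≤ 1 := by
  induction x generalizing s with
  | S => rw [spineVal]; split_ifs <;> simp
  | K => rw [spineVal]; split_ifs <;> simp
  | app f x ihf ihx =>
    obtain ⟨X, _ | ⟨a, as⟩⟩ := s
    · simp
    · exact Nat.mul_le_mul (ihf _) (codeVal_le_one_of ihx a)

theorem codeVal_le_one (x : Term) (a : ℕ) : codeVal x a ≤ 1 :=
  codeVal_le_one_of (spineVal_le_one x) a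

theorem norm_natCast_le_one {n : ℕ} (h : n ≤ 1) : ‖(n : ℂ)‖ ≤ 1 := by
  rw [Complex.norm_natCast]
  exact_mod_cast h

/-- The generating function of a pattern. -/
noncomputable def genCode (z : ℂ) (a : ℕ) : ℂ := gen z fun x => codeVal x a

/-- The generating function of a spine. -/
noncomputable def genSpine (z : ℂ) (s : PSpine) : ℂ := gen z fun x => spineVal x s

/-- The value of a factor of a monomial. -/
noncomputable def factorVal (z : ℂ) (f : ℕ ⊕ ℕ) : ℂ :=
  f.elim (fun t => (baseForm t).eval z) (genCode z)

/-- The value of a monomial. -/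
noncomputable def monomialVal (z : ℂ) (m : Monomial) : ℂ := (m.map (factorVal z)).prod

/-- The value of a sum of monomials. -/
noncomputable def sumVal (z : ℂ) (S : List Monomial) : ℂ := (S.map (monomialVal z)).sum

section

variable {z : ℂ}

theorem genSpine_nil (hz : ‖z‖ < 1 / 8) (X : Bool) : genSpine z (X, []) = 1 := by
  have := gen_eq hz fun x => norm_natCast_le_one (spineVal_le_one x (X, []))
  rw [genSpine, this]
  cases X <;> simp

theorem genSpine_cons (hz : ‖z‖ < 1 / 8) (X : Bool) (a : ℕ) (l : List ℕ) :
    genSpine z (X, a :: l) = z * genSpine z (X, l) * genCode z a :=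
  gen_app hz (fun x => norm_natCast_le_one (spineVal_le_one x _))
    (fun x => norm_natCast_le_one (codeVal_le_one x _)) (by simp) (by simp) (by simp)

theorem monomialVal_spineMonomial (hz : ‖z‖ < 1 / 8) (s : PSpine) :
    monomialVal z (spineMonomial s) = genSpine z s := by
  obtain ⟨X, l⟩ := s
  induction l with
  | nil => simp [spineMonomial, monomialVal, genSpine_nil hz]
  | cons a l ih =>
    rw [genSpine_cons hz, ← ih]
    simp [spineMonomial, monomialVal, factorVal, baseForm, ClosedForm.eval]
    ring

/-- Additivity is applied spine by spine, since for an arbitrary list the count may exceed 1 and the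
norm bound for a single weight is not available. -/
theorem gen_spinesVal (hz : ‖z‖ < 1 / 8) (L : List PSpine) :
    gen z (fun x => spinesVal x L) = (L.map (genSpine z)).sum := by
  refine HasSum.tsum_eq ?_
  induction L with
  | nil => simp
  | cons s L ih =>
    simp only [spinesVal_cons, Nat.cast_add, add_mul, List.map_cons, List.sum_cons]
    exact HasSum.add (summable_gen hz fun x => norm_natCast_le_one (spineVal_le_one x s)).hasSum ih

theorem gen_redVal (k : ℕ) : gen z (fun x => redVal k x) = genR k z := by
  rw [genR, genSet]
  congr 1
  funext x
  simp [redVal]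

theorem genCode_redCode (k : ℕ) : genCode z (redCode k) = genR k z := by
  simp [genCode, gen_redVal]

theorem genCode_topCode (h0 : 0 < ‖z‖) (hz : ‖z‖ < 1 / 8) : genCode z topCode = genC z := by
  rw [← genSet_univ h0 hz]
  simp [genCode, genSet]

theorem eval_baseForm_one : (baseForm 1).eval z = genC z := by
  simp [baseForm, ClosedForm.eval, genC]

theorem eval_baseForm_two : (baseForm 2).eval z = genR0 z := by
  simp [baseForm, ClosedForm.eval, genR0, sq]

theorem eval_baseForm_three :
    (baseForm 3).eval z = 1 / Complex.sqrt (1 - 4 * z - 4 * z ^ 2) := by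
  simp [baseForm, ClosedForm.eval, sq]

/-- The formula for Rₙ once more, now for the computed table: the four spines of `selfSpines` are
solved for and the remaining ones form the sum. -/
theorem genR_eq_sum_table (hz : ‖z‖ < 1 / 8) {n k : ℕ} (hk : k ≤ n) (hk0 : k ≠ 0) :
    genR k z = 1 / Complex.sqrt (1 - 4 * z - 4 * z ^ 2) *
      (((table n).getD k []).map (genSpine z)).sum := by
  apply eq_div_sqrt hz
  have h : genR k z = ((lookup (table n) k).map (genSpine z)).sum := by
    rw [← gen_spinesVal hz, ← gen_redVal]
    congr 1
    funext x
    rw [(table_spec n).1 k (by omega)]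
  rw [lookup, List.map_append, List.sum_append, selfSpines, if_neg hk0] at h
  simp only [List.map_cons, List.map_nil, List.sum_cons, List.sum_nil, genSpine_cons hz,
    genSpine_nil hz, genCode_redCode] at h
  linear_combination h

theorem headI_mem {l : List ℕ} (h : l ≠ []) : l.headI ∈ l := by
  cases l with
  | nil => exact absurd rfl h
  | cons k l => exact List.mem_cons_self

theorem codeVal_eq_redVal {a : ℕ} (h1 : (dec a).2 = []) (h2 : (dec a).1 ≠ [])
    (h3 : ∀ k ∈ (dec a).1, k = (dec a).1.headI) (x : Term) :
    codeVal x a = redVal (dec a).1.headI x := by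
  rw [codeVal, h1, List.map_congr_left (g := fun _ => redVal (dec a).1.headI x)
    fun k hk => by rw [h3 k hk], List.map_const',
    List.prod_replicate, List.map_nil, List.prod_nil, mul_one, redVal]
  have := List.length_pos_iff.2 h2
  split_ifs
  · simp
  · simp [this.ne']

theorem sumVal_expandCode (h0 : 0 < ‖z‖) (hz : ‖z‖ < 1 / 8) {n a : ℕ} (ha : IndexLt (n + 1) a) :
    sumVal z (expandCode (table n) a) = genCode z a := by
  have hsum : ∀ L : List PSpine, sumVal z (L.map spineMonomial) = (L.map (genSpine z)).sum := by
    intro L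
    simp [sumVal, Function.comp_def, monomialVal_spineMonomial hz]
  rw [expandCode]
  split_ifs with h1 h2 h3 h4
  · have h : ∀ x, codeVal x a = codeVal x topCode := by
      intro x
      rw [codeVal, h1, h2, codeVal_topCode]
      simp
    rw [genCode]
    simp only [h]
    rw [← genCode, genCode_topCode h0 hz, ← eval_baseForm_one]
    simp [sumVal, monomialVal, factorVal]
  · have h := codeVal_eq_redVal h1 h2 h3
    rw [genCode]
    simp only [h]
    rw [gen_redVal, h4, genR_zero h0 hz, ← eval_baseForm_two]
    simp [sumVal, monomialVal, factorVal]
  · have h := codeVal_eq_redVal h1 h2 h3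
    have hk : (dec a).1.headI ≤ n := by
      exact Nat.lt_succ_iff.1 ((indexLt_iff.1 ha).1 _ (headI_mem h2))
    rw [genCode]
    simp only [h]
    rw [gen_redVal, genR_eq_sum_table hz hk h4, ← hsum, ← eval_baseForm_three]
    simp [sumVal, monomialVal, factorVal, Function.comp_def, List.sum_map_mul_left]
  · push Not at h3
    obtain ⟨k, hk, hne⟩ := h3
    have h : ∀ x, codeVal x a = 0 := by
      intro x
      rw [codeVal, List.prod_eq_zero, zero_mul]
      -- A term cannot normalize in two different numbers of steps, so one of the two conflicting
      -- factors vanishes.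
      by_cases hx : Reduces k x
      · refine List.mem_map.2 ⟨_, headI_mem h2, redVal_eq_zero fun h => hne (reduces_unique hx h)⟩
      · exact List.mem_map.2 ⟨_, hk, redVal_eq_zero hx⟩
    rw [genCode]
    simp [h, sumVal, gen]
  · rw [hsum, ← gen_spinesVal hz, genCode]
    congr 1
    funext x
    rw [spinesVal_unfoldCode (table_spec n).1 ha]
    simp [options, h1]

theorem sumVal_append (S S' : List Monomial) : sumVal z (S ++ S') = sumVal z S + sumVal z S' := by
  simp [sumVal]

theorem monomialVal_append (m m' : Monomial) :
    monomialVal z (m ++ m') = monomialVal z m * monomialVal z m' := by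
  simp [monomialVal]

theorem sumVal_flatMap_append (S S' : List Monomial) :
    sumVal z (S.flatMap fun e => S'.map fun m => e ++ m) = sumVal z S * sumVal z S' := by
  induction S with
  | nil => simp [sumVal]
  | cons e S ih =>
    rw [List.flatMap_cons, sumVal_append, ih]
    simp only [sumVal, List.map_cons, List.sum_cons, List.map_map, Function.comp_def,
      monomialVal_append, List.sum_map_mul_left]
    ring

/-- All patterns that occur in a monomial have numbers of reduction steps less than `N`. -/
def MonomialIndexLt (N : ℕ) (m : Monomial) : Prop := ∀ a, .inr a ∈ m → IndexLt N a

theorem sumVal_expandMonomial (h0 : 0 < ‖z‖) (hz : ‖z‖ < 1 / 8) {n : ℕ} {m : Monomial}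
    (hm : MonomialIndexLt (n + 1) m) :
    sumVal z (expandMonomial (table n) m) = monomialVal z m := by
  induction m with
  | nil => simp [expandMonomial, sumVal, monomialVal]
  | cons f m ih =>
    rw [expandMonomial, List.foldr_cons, sumVal_flatMap_append, ← expandMonomial,
      ih fun a ha => hm a (List.mem_cons_of_mem _ ha),
      show monomialVal z (f :: m) = factorVal z f * monomialVal z m by simp [monomialVal]]
    congr 1
    cases f with
    | inl t => simp [expandFactor, sumVal, monomialVal]
    | inr a => exact sumVal_expandCode h0 hz (hm a List.mem_cons_self)

theorem sumVal_expandSum (h0 : 0 < ‖z‖) (hz : ‖z‖ < 1 / 8) {n : ℕ} {S : List Monomial}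
    (hS : ∀ m ∈ S, MonomialIndexLt (n + 1) m) :
    sumVal z (expandSum (table n) S) = sumVal z S := by
  induction S with
  | nil => simp [expandSum]
  | cons m S ih =>
    rw [expandSum, List.flatMap_cons, sumVal_append, ← expandSum,
      ih fun m hm => hS m (List.mem_cons_of_mem _ hm),
      sumVal_expandMonomial h0 hz (hS m List.mem_cons_self)]
    simp [sumVal]

end

-- Patterns occurring in an expansion

theorem mem_expandMonomial {T : List (List PSpine)} {m m' : Monomial}
    (h : m' ∈ expandMonomial T m) {f' : ℕ ⊕ ℕ} (hf' : f' ∈ m') :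
    ∃ f ∈ m, ∃ e ∈ expandFactor T f, f' ∈ e := by
  induction m generalizing m' with
  | nil =>
    rw [expandMonomial, List.foldr_nil, List.mem_singleton] at h
    simp [h] at hf'
  | cons f m ih =>
    rw [expandMonomial, List.foldr_cons, ← expandMonomial] at h
    simp only [List.mem_flatMap, List.mem_map] at h
    obtain ⟨e, he, m'', hm'', rfl⟩ := h
    rcases List.mem_append.1 hf' with hf' | hf'
    · exact ⟨f, List.mem_cons_self, e, he, hf'⟩
    · obtain ⟨g, hg, h⟩ := ih hm'' hf'
      exact ⟨g, List.mem_cons_of_mem _ hg, h⟩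

theorem mem_expandSum {T : List (List PSpine)} {S : List Monomial} {m' : Monomial}
    (h : m' ∈ expandSum T S) {f' : ℕ ⊕ ℕ} (hf' : f' ∈ m') :
    ∃ m ∈ S, ∃ f ∈ m, ∃ e ∈ expandFactor T f, f' ∈ e := by
  obtain ⟨m, hm, h⟩ := List.mem_flatMap.1 h
  exact ⟨m, hm, mem_expandMonomial h hf'⟩

theorem inr_mem_spineMonomial {s : PSpine} {a : ℕ} : .inr a ∈ spineMonomial s ↔ a ∈ s.2 := by
  simp [spineMonomial]

theorem indexLt_of_mem_expandCode {n a N : ℕ} (hN : N ≤ n + 1) (ha : IndexLt N a) {e : Monomial}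
    (he : e ∈ expandCode (table n) a) : MonomialIndexLt N e := by
  rw [expandCode] at he
  split_ifs at he with h1 h2 h3 h4
  · simp [List.mem_singleton.1 he, MonomialIndexLt]
  · simp [List.mem_singleton.1 he, MonomialIndexLt]
  · obtain ⟨s, hs, rfl⟩ := List.mem_map.1 he
    have hk : (dec a).1.headI < N := by
      exact (indexLt_iff.1 ha).1 _ (headI_mem h2)
    intro b hb
    have hb : b ∈ s.2 := by simpa [inr_mem_spineMonomial] using hb
    exact (((table_spec n).2 _ (by omega) s hs).mono hk.le) b hb
  · simp at he
  · obtain ⟨s, hs, rfl⟩ := List.mem_map.1 he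
    exact fun b hb => spineIndexLt_unfoldCode (fun k hk => spineIndexLt_lookup_table hk hN) ha s hs b
      (inr_mem_spineMonomial.1 hb)

theorem indexLt_of_mem_expandSum {n : ℕ} {S : List Monomial}
    (hS : ∀ m ∈ S, MonomialIndexLt (n + 1) m) :
    ∀ m ∈ expandSum (table n) S, MonomialIndexLt (n + 1) m := by
  intro m' hm' a ha
  obtain ⟨m, hm, f, hf, e, he, hae⟩ := mem_expandSum hm' ha
  cases f with
  | inl t =>
    rw [List.mem_singleton.1 he, List.mem_singleton] at hae
    cases hae
  | inr b => exact indexLt_of_mem_expandCode le_rfl (hS m hm b hf) he a hae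

theorem expansion_succ (n t : ℕ) :
    expansion n (t + 1) = expandSum (table n) (expansion n t) := Function.iterate_succ_apply' _ _ _

theorem indexLt_expansion (n t : ℕ) : ∀ m ∈ expansion n t, MonomialIndexLt (n + 1) m := by
  induction t with
  | zero =>
    intro m hm a ha
    rw [List.mem_singleton.1 hm, List.mem_singleton] at ha
    rw [Sum.inr_injective ha]
    exact indexLt_redCode n.lt_succ_self
  | succ t ih =>
    rw [expansion_succ]
    exact indexLt_of_mem_expandSum ih

theorem sumVal_expansion {z : ℂ} (h0 : 0 < ‖z‖) (hz : ‖z‖ < 1 / 8) (n t : ℕ) :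
    sumVal z (expansion n t) = genR n z := by
  induction t with
  | zero => simp [expansion, sumVal, monomialVal, factorVal, genCode_redCode]
  | succ t ih => rw [expansion_succ, sumVal_expandSum h0 hz (indexLt_expansion n t), ih]

/-! ### Termination of the expansion -/

theorem encode_lt_of_mem {α : Type*} [Encodable α] {a : α} {l : List α} (h : a ∈ l) :
    Encodable.encode a < Encodable.encode l := by
  induction l with
  | nil => simp at h
  | cons b l ih =>
    rw [Encodable.encode_list_cons, Nat.lt_succ_iff]
    rcases List.mem_cons.1 h with rfl | h
    · exact Nat.left_le_pair _ _
    · exact (ih h).le.trans (Nat.right_le_pair _ _)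

/-- `decode₂` accepts only genuine codes, and the code of a list or pair dominates those of its
parts. Numbers that are not codes decode to the pattern without spines. Recursion on codes is
therefore well founded. -/
theorem lt_of_mem_dec {a b : ℕ} {s : PSpine} (hs : s ∈ (dec a).2) (hb : b ∈ s.2) : b < a := by
  rw [dec] at hs
  cases h : Encodable.decode₂ Pattern a with
  | none => simp [h] at hs
  | some p =>
    rw [h, Option.getD_some] at hs
    rw [Encodable.decode₂_eq_some] at h
    obtain ⟨l, L⟩ := p
    obtain ⟨X, bs⟩ := s
    calc b = Encodable.encode b := rfl
      _ < Encodable.encode bs := encode_lt_of_mem hb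
      _ ≤ Encodable.encode (X, bs) := Nat.right_le_pair _ _
      _ < Encodable.encode L := encode_lt_of_mem hs
      _ ≤ Encodable.encode (l, L) := Nat.right_le_pair _ _
      _ = a := h

/-- The weight of a pattern, where `R k` weighs `h k`. -/
def codeWeight (h : ℕ → ℕ) (a : ℕ) : ℕ :=
  ((dec a).1.map h).sum + ((dec a).2.attach.map fun s =>
    1 + (s.1.2.attach.map fun b => codeWeight h b.1).sum).sum
termination_by a
decreasing_by exact lt_of_mem_dec s.2 b.2

/-- The total weight of the arguments of a spine. -/
def argsWeight (h : ℕ → ℕ) (s : PSpine) : ℕ := (s.2.map (codeWeight h)).sum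

theorem codeWeight_eq (h : ℕ → ℕ) (a : ℕ) : codeWeight h a =
    ((dec a).1.map h).sum + ((dec a).2.map fun s => 1 + argsWeight h s).sum := by
  rw [codeWeight]
  have h1 : ∀ s : PSpine, (s.2.attach.map fun b => codeWeight h b.1) = s.2.map (codeWeight h) :=
    fun s => List.attach_map_val (f := codeWeight h)
  simp only [h1]
  rw [List.attach_map_val (f := fun s : PSpine => 1 + (s.2.map (codeWeight h)).sum)]
  rfl

@[simp] theorem codeWeight_redCode (h : ℕ → ℕ) (k : ℕ) : codeWeight h (redCode k) = h k := by
  simp [codeWeight_eq, redCode]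

@[simp] theorem codeWeight_interCode (h : ℕ → ℕ) (a b : ℕ) :
    codeWeight h (interCode a b) = codeWeight h a + codeWeight h b := by
  simp only [codeWeight_eq, interCode, dec_enc, List.map_append, List.sum_append]
  omega

theorem codeWeight_congr {h h' : ℕ → ℕ} {N : ℕ} (hh : ∀ k < N, h k = h' k) {a : ℕ}
    (ha : IndexLt N a) : codeWeight h a = codeWeight h' a := by
  induction ha with
  | mk h1 _ ih =>
    rw [codeWeight_eq, codeWeight_eq, List.map_congr_left fun k hk => hh k (h1 k hk)]
    congr 2
    refine List.map_congr_left fun s hs => ?_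
    rw [argsWeight, argsWeight, List.map_congr_left fun b hb => ih s hs b hb]

/-- All arguments of the spines in a list have weight at most `m`. -/
def ArgsLe (h : ℕ → ℕ) (L : List PSpine) (m : ℕ) : Prop := ∀ s ∈ L, ∀ a ∈ s.2, codeWeight h a ≤ m

theorem argsLe_append {h : ℕ → ℕ} {L M : List PSpine} {m : ℕ} :
    ArgsLe h (L ++ M) m ↔ ArgsLe h L m ∧ ArgsLe h M m := by
  simp only [ArgsLe, List.forall_mem_append]

theorem argsLe_selfSpines {h : ℕ → ℕ} {k : ℕ} (h0 : h 0 ≤ h k) : ArgsLe h (selfSpines k) (h k) := by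
  intro s hs a ha
  rw [selfSpines] at hs
  split_ifs at hs with hk <;> simp only [List.mem_cons, List.not_mem_nil, or_false] at hs
  · subst hk
    rcases hs with rfl | rfl | rfl <;> simp at ha <;> simp [ha]
  · rcases hs with rfl | rfl | rfl | rfl <;> simp at ha
    · simp [ha]
    · simp [ha]
    · rcases ha with rfl | rfl <;> simp [h0]
    · rcases ha with rfl | rfl <;> simp [h0]

theorem exists_argsLe_table (n : ℕ) :
    ∃ h : ℕ → ℕ, h 0 = 0 ∧ ∀ k ≤ n, ArgsLe h ((table n).getD k []) (h k) := by
  induction n with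
  | zero =>
    refine ⟨fun _ => 0, rfl, fun k hk s hs a ha => ?_⟩
    obtain rfl : k = 0 := by omega
    simp [table] at hs
    rcases hs with rfl | rfl <;> simp at ha
  | succ n ih =>
    obtain ⟨h, h0, hle⟩ := ih
    obtain ⟨M, hM⟩ : ∃ M, ArgsLe h (nextSpines (table n) n) M := by
      -- The sum of all argument weights bounds each of them.
      refine ⟨((nextSpines (table n) n).map (argsWeight h)).sum, fun s hs a ha => ?_⟩
      exact (List.single_le_sum (fun _ _ => Nat.zero_le _) _ (List.mem_map_of_mem ha)).trans
        (List.single_le_sum (fun _ _ => Nat.zero_le _) _ (List.mem_map_of_mem hs))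
    have hagree : ∀ k < n + 1, h k = Function.update h (n + 1) M k :=
      fun k hk => by rw [Function.update_of_ne hk.ne]
    refine ⟨Function.update h (n + 1) M, by rw [← hagree 0 n.succ_pos, h0], fun k hk s hs a ha => ?_⟩
    have hI := (table_spec (n + 1)).2 k hk s hs a ha
    rw [← codeWeight_congr hagree (hI.mono hk)]
    rcases Nat.le_succ_iff.1 hk with hk | rfl
    · rw [getD_table_succ_of_le hk] at hs
      rw [← hagree k (by omega)]
      exact hle k hk s hs a ha
    · rw [getD_table_succ_self] at hs
      rw [Function.update_self]
      exact hM s hs a ha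

theorem argsLe_meetSpine {h : ℕ → ℕ} {s t : PSpine} {m m' : ℕ}
    (hs : ∀ a ∈ s.2, codeWeight h a ≤ m) (ht : ∀ a ∈ t.2, codeWeight h a ≤ m') :
    ArgsLe h (meetSpine s t) (m + m') := by
  intro u hu c hc
  rw [meetSpine] at hu
  split_ifs at hu
  · obtain rfl := List.mem_singleton.1 hu
    simp only [← List.map_uncurry_zip_eq_zipWith, List.mem_map] at hc
    obtain ⟨⟨a, b⟩, hab, rfl⟩ := hc
    rw [Function.uncurry, codeWeight_interCode]
    exact Nat.add_le_add (hs a (List.of_mem_zip hab).1) (ht b (List.of_mem_zip hab).2)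
  · simp at hu

theorem argsLe_foldl_meetSpines {h : ℕ → ℕ} {L : List (List PSpine)} {ms : List ℕ}
    (hL : List.Forall₂ (ArgsLe h) L ms) {M : List PSpine} {m : ℕ} (hM : ArgsLe h M m) :
    ArgsLe h (L.foldl meetSpines M) (m + ms.sum) := by
  induction hL generalizing M m with
  | nil => simpa using hM
  | cons h1 _ ih =>
    rw [List.foldl_cons, List.sum_cons, ← add_assoc]
    refine ih fun u hu => ?_
    simp only [meetSpines, List.mem_flatMap] at hu
    obtain ⟨s, hs, t, ht, hu⟩ := hu
    exact argsLe_meetSpine (hM s hs) (h1 t ht) u hu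

theorem sum_map_one_add (f : PSpine → ℕ) (L : List PSpine) :
    (L.map fun s => 1 + f s).sum = L.length + (L.map f).sum := by
  induction L with
  | nil => rfl
  | cons s L ih =>
    simp only [List.map_cons, List.sum_cons, ih, List.length_cons]
    omega

/-- An argument of the unfolding is an intersection with one argument from each member, so its
weight is at most the sum of the `h k` and of the argument weights of the spines. The 1 charged for
each spine makes the inequality strict as soon as a spine is present. -/
theorem codeWeight_lt_of_mem_unfoldCode {h : ℕ → ℕ} {T : List (List PSpine)} {a : ℕ}
    (hT : ∀ k ∈ (dec a).1, ArgsLe h (lookup T k) (h k)) (ha : (dec a).2 ≠ []) {s : PSpine}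
    (hs : s ∈ unfoldCode T a) {b : ℕ} (hb : b ∈ s.2) : codeWeight h b < codeWeight h a := by
  have ho : List.Forall₂ (ArgsLe h) (options T a)
      ((dec a).1.map h ++ (dec a).2.map (argsWeight h)) := by
    refine List.rel_append ?_ ?_
    · rw [List.forall₂_map_left_iff, List.forall₂_map_right_iff, List.forall₂_same]
      exact hT
    · rw [List.forall₂_map_left_iff, List.forall₂_map_right_iff, List.forall₂_same]
      intro s _ t ht c hc
      rw [List.mem_singleton.1 ht] at hc
      exact List.single_le_sum (fun _ _ => Nat.zero_le _) _ (List.mem_map_of_mem hc)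
  have hlen := List.length_pos_iff.2 ha
  rw [codeWeight_eq h a, sum_map_one_add]
  have hsum : ((dec a).1.map h ++ (dec a).2.map (argsWeight h)).sum =
      ((dec a).1.map h).sum + ((dec a).2.map (argsWeight h)).sum := List.sum_append
  rw [unfoldCode] at hs
  generalize (dec a).1.map h ++ (dec a).2.map (argsWeight h) = ms at ho hsum
  cases hopt : options T a with
  | nil => simp [options, ha] at hopt
  | cons L M =>
    rw [hopt] at ho hs
    cases ho with
    | cons h1 h2 =>
      have := argsLe_foldl_meetSpines h2 h1 s hs b hb
      rw [List.sum_cons] at hsum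
      omega

/-- Every pattern in a factor is removed by `d` rounds of expansion. -/
inductive Expands (T : List (List PSpine)) : ℕ → ℕ ⊕ ℕ → Prop
  | tag (d t : ℕ) : Expands T d (.inl t)
  | code {d a : ℕ} : (∀ m ∈ expandCode T a, ∀ f ∈ m, Expands T d f) → Expands T (d + 1) (.inr a)

theorem Expands.mono {T : List (List PSpine)} {d d' : ℕ} {f : ℕ ⊕ ℕ} (h : Expands T d f)
    (hd : d ≤ d') : Expands T d' f := by
  induction h generalizing d' with
  | tag d t => exact .tag d' t
  | code _ ih =>
    obtain ⟨e, rfl⟩ := Nat.exists_eq_add_of_le' (Nat.one_le_of_lt hd)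
    exact .code fun m hm f hf => ih m hm f hf (by omega)

/-- An expansion contains only finitely many factors, so a common number of rounds exists. -/
theorem exists_expands_of_forall {T : List (List PSpine)} {a : ℕ}
    (h : ∀ m ∈ expandCode T a, ∀ b, .inr b ∈ m → ∃ d, Expands T d (.inr b)) :
    ∃ d, Expands T d (.inr a) := by
  have key : ∀ l : List (ℕ ⊕ ℕ), (∀ b, .inr b ∈ l → ∃ d, Expands T d (.inr b)) →
      ∃ d, ∀ f ∈ l, Expands T d f := by
    intro l
    induction l with
    | nil => exact fun _ => ⟨0, by simp⟩
    | cons f l ih =>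
      intro hl
      obtain ⟨d, hd⟩ := ih fun b hb => hl b (List.mem_cons_of_mem _ hb)
      obtain ⟨e, he⟩ : ∃ e, Expands T e f := by
        cases f with
        | inl t => exact ⟨0, .tag 0 t⟩
        | inr b => exact hl b List.mem_cons_self
      refine ⟨d + e, fun g hg => ?_⟩
      rcases List.mem_cons.1 hg with rfl | hg
      · exact he.mono (by omega)
      · exact (hd g hg).mono (by omega)
  obtain ⟨d, hd⟩ := key (expandCode T a).flatten fun b hb => by
    obtain ⟨m, hm, hb⟩ := List.mem_flatten.1 hb
    exact h m hm b hb
  exact ⟨d + 1, .code fun m hm f hf => hd f (List.mem_flatten.2 ⟨m, hm, hf⟩)⟩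

/-- Lexicographic induction. A pattern that is just `R k` passes to table entries, whose step
numbers are less than `k`. A pattern containing a spine keeps its bound on step numbers, even
through self-referencing spines, but its weight drops. -/
theorem exists_expands {n N : ℕ} (hN : N ≤ n + 1) {a : ℕ} (ha : IndexLt N a) :
    ∃ d, Expands (table n) d (.inr a) := by
  obtain ⟨h, h0, hle⟩ := exists_argsLe_table n
  induction N using Nat.strong_induction_on generalizing a with
  | _ N ihN =>
  induction hw : codeWeight h a using Nat.strong_induction_on generalizing a with
  | _ w ihw =>
  subst hw
  refine exists_expands_of_forall fun m hm b hb => ?_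
  have hbN := indexLt_of_mem_expandCode hN ha hm b hb
  rw [expandCode] at hm
  split_ifs at hm with h1 h2 h3 h4
  · rw [List.mem_singleton.1 hm] at hb
    simp at hb
  · rw [List.mem_singleton.1 hm] at hb
    simp at hb
  · obtain ⟨s, hs, rfl⟩ := List.mem_map.1 hm
    have hk := (indexLt_iff.1 ha).1 _ (headI_mem h2)
    have hb : b ∈ s.2 := by simpa [inr_mem_spineMonomial] using hb
    exact ihN _ hk (by omega) ((table_spec n).2 _ (by omega) s hs b hb)
  · simp at hm
  · obtain ⟨s, hs, rfl⟩ := List.mem_map.1 hm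
    refine ihw _ (codeWeight_lt_of_mem_unfoldCode (fun k hk => ?_) h1 hs
      (inr_mem_spineMonomial.1 hb)) hbN rfl
    have hk := (indexLt_iff.1 ha).1 k hk
    exact argsLe_append.2 ⟨argsLe_selfSpines (by omega), hle k (by omega)⟩

theorem expands_expandSum {T : List (List PSpine)} {d : ℕ} {S : List Monomial}
    (hS : ∀ m ∈ S, ∀ f ∈ m, Expands T (d + 1) f) :
    ∀ m ∈ expandSum T S, ∀ f ∈ m, Expands T d f := by
  intro m' hm' f' hf'
  obtain ⟨m, hm, f, hf, e, he, hfe⟩ := mem_expandSum hm' hf'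
  cases hS m hm f hf with
  | tag _ t =>
    rw [List.mem_singleton.1 he, List.mem_singleton] at hfe
    rw [hfe]
    exact .tag d t
  | code h => exact h e he f' hfe

theorem exists_unexpanded_eq_nil (n : ℕ) : ∃ t, unexpanded (expansion n t) = [] := by
  obtain ⟨d, hd⟩ := exists_expands le_rfl (indexLt_redCode n.lt_succ_self)
  refine ⟨d, unexpanded_eq_nil.2 ?_⟩
  have key : ∀ t e, t + e = d → ∀ m ∈ expansion n t, ∀ f ∈ m, Expands (table n) e f := by
    intro t
    induction t with
    | zero =>
      rintro e rfl m hm f hf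
      rw [List.mem_singleton.1 hm, List.mem_singleton] at hf
      rw [hf]
      exact hd.mono (by omega)
    | succ t ih =>
      intro e he
      rw [expansion_succ]
      exact expands_expandSum (ih (e + 1) (by omega))
  intro m hm f hf
  cases key d 0 rfl m hm f hf with
  | tag _ t => exact ⟨t, rfl⟩

/-! ### The closed forms -/

/-- The product of the factors of a monomial without patterns. -/
def monomialForm (m : Monomial) : ClosedForm :=
  m.foldr (fun f e => .mul (baseForm (f.casesOn id fun _ => 0)) e) (.const 1)

/-- The sum of monomials without patterns. -/
def sumForm (S : List Monomial) : ClosedForm :=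
  S.foldr (fun m e => .add (monomialForm m) e) (.const 0)

/-- The closed form of `Rₙ(z)`. -/
def closedForm (n : ℕ) : ClosedForm :=
  sumForm (expansion n (Nat.find (exists_unexpanded_eq_nil n)))

section

variable {z : ℂ}

/-- The hypothesis excludes the dummy value that `monomialForm` assigns to a leftover pattern. -/
theorem eval_monomialForm {m : Monomial} (hm : ∀ f ∈ m, ∃ t, f = .inl t) :
    (monomialForm m).eval z = monomialVal z m := by
  induction m with
  | nil => simp [monomialForm, monomialVal, ClosedForm.eval]
  | cons f m ih =>
    obtain ⟨t, rfl⟩ := hm f List.mem_cons_self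
    rw [show monomialForm (.inl t :: m) = .mul (baseForm t) (monomialForm m) from rfl,
      ClosedForm.eval, ih fun g hg => hm g (List.mem_cons_of_mem _ hg)]
    simp [monomialVal, factorVal]

theorem eval_sumForm {S : List Monomial} (hS : unexpanded S = []) :
    (sumForm S).eval z = sumVal z S := by
  rw [unexpanded_eq_nil] at hS
  induction S with
  | nil => simp [sumForm, sumVal, ClosedForm.eval]
  | cons m S ih =>
    have := ih fun g hg => hS g (List.mem_cons_of_mem _ hg)
    simp only [sumForm, sumVal] at this ⊢
    simp [ClosedForm.eval, this, eval_monomialForm (hS m List.mem_cons_self)]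

theorem eval_closedForm (h0 : 0 < ‖z‖) (hz : ‖z‖ < 1 / 8) (n : ℕ) :
    (closedForm n).eval z = genR n z := by
  rw [closedForm, eval_sumForm (Nat.find_spec (exists_unexpanded_eq_nil n)),
    sumVal_expansion h0 hz]

theorem regular_baseForm (h0 : 0 < ‖z‖) (hz : ‖z‖ < 1 / 8) (t : ℕ) : (baseForm t).Regular z := by
  have hz0 : z ≠ 0 := norm_pos_iff.1 h0
  have h1 : 1 - 8 * z ∈ Complex.slitPlane := by
    refine slitPlane_of_norm_lt ?_
    rw [norm_mul, Complex.norm_ofNat]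
    linarith
  have h2 : 1 - 4 * z - 4 * (z * z) ∈ Complex.slitPlane := by
    rw [sub_sub, ← sq]
    exact slitPlane_of_norm_lt (norm_four_mul_add_lt hz)
  have h3 := sqrt_ne_zero hz
  rw [sq] at h3
  match t with
  | 0 => trivial
  | 1 => simp [baseForm, ClosedForm.Regular, ClosedForm.eval, h1, hz0]
  | 2 => simp [baseForm, ClosedForm.Regular, ClosedForm.eval, h2, hz0]
  | t + 3 => simp [baseForm, ClosedForm.Regular, ClosedForm.eval, h2, h3]

/-- Only sums and products are formed on top of the basic closed forms, so no new denominator or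
radicand appears. -/
theorem regular_closedForm (h0 : 0 < ‖z‖) (hz : ‖z‖ < 1 / 8) (n : ℕ) :
    (closedForm n).Regular z := by
  have hm : ∀ m, (monomialForm m).Regular z := by
    intro m
    induction m with
    | nil => trivial
    | cons f m ih => exact ⟨regular_baseForm h0 hz _, ih⟩
  rw [closedForm]
  induction expansion n _ with
  | nil => trivial
  | cons m S ih => exact ⟨hm m, ih⟩

end

/-! ### Computability -/

open Primrec

theorem primrec_dec : Primrec dec :=
  option_getD.comp Primrec.decode₂ (const _)

theorem primrec_enc : Primrec enc := Primrec.encode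

theorem primrec_redCode : Primrec redCode :=
  primrec_enc.comp ((list_cons.comp .id (const [])).pair (const []))

theorem primrec_spineCode : Primrec spineCode :=
  primrec_enc.comp ((const []).pair (list_cons.comp .id (const [])))

theorem primrec_interCode : Primrec₂ interCode :=
  primrec_enc.comp (Primrec.pair
    (list_append.comp (fst.comp (primrec_dec.comp fst)) (fst.comp (primrec_dec.comp snd)))
    (list_append.comp (snd.comp (primrec_dec.comp fst)) (snd.comp (primrec_dec.comp snd))))

theorem primrec_singleton {α β : Type*} [Primcodable α] [Primcodable β] {f : α → β}
    (hf : Primrec f) : Primrec fun a => [f a] := list_cons.comp hf (const [])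

theorem primrec_pairList {α β : Type*} [Primcodable α] [Primcodable β] {f g : α → β}
    (hf : Primrec f) (hg : Primrec g) : Primrec fun a => [f a, g a] :=
  list_cons.comp hf (primrec_singleton hg)

theorem primrec_selfSpines : Primrec selfSpines := by
  have h0 : ∀ a : ℕ, Primrec fun _ : ℕ => redCode a := fun a => const _
  refine Primrec.ite (Primrec.eq.comp .id (const 0)) (const _) ?_
  exact list_cons.comp (pair (const true) (primrec_singleton primrec_redCode))
    (list_cons.comp (pair (const false) (primrec_singleton primrec_redCode))
      (primrec_pairList (pair (const true) (primrec_pairList primrec_redCode (h0 0)))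
        (pair (const true) (primrec_pairList (h0 0) primrec_redCode))))

theorem primrec_lookup : Primrec₂ lookup :=
  list_append.comp (primrec_selfSpines.comp snd) ((list_getD []).comp fst snd)

theorem primrec_options : Primrec₂ options :=
  list_append.comp
    (list_map (fst.comp (primrec_dec.comp snd)) (primrec_lookup.comp (fst.comp fst) snd))
    (list_map (snd.comp (primrec_dec.comp snd)) (primrec_singleton snd).to₂)

/-- Indexing by position expresses the intersection through a map over a range, for which primitive
recursiveness is immediate; equal lengths make the default 0 irrelevant. -/
theorem zipWith_interCode (as bs : List ℕ) (h : as.length = bs.length) :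
    List.zipWith interCode as bs =
      (List.range as.length).map fun i => interCode (as.getD i 0) (bs.getD i 0) := by
  apply List.ext_getElem
  · simp [h]
  · intro i h1 h2
    simp at h1 h2
    simp [h1]

theorem primrec_meetSpine : Primrec₂ meetSpine := by
  have h : Primrec₂ fun s t : PSpine =>
      if s.1 = t.1 ∧ s.2.length = t.2.length then
        [(s.1, (List.range s.2.length).map fun i => interCode (s.2.getD i 0) (t.2.getD i 0))]
      else [] := by
    refine Primrec.ite (PrimrecPred.and
      (Primrec.eq.comp (fst.comp fst) (fst.comp snd))
      (Primrec.eq.comp (list_length.comp (snd.comp fst)) (list_length.comp (snd.comp snd))))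
      (primrec_singleton (pair (fst.comp fst) ?_)) (const [])
    exact list_map (list_range.comp (list_length.comp (snd.comp fst)))
      (primrec_interCode.comp ((list_getD 0).comp (snd.comp (fst.comp fst)) snd)
        ((list_getD 0).comp (snd.comp (snd.comp fst)) snd))
  refine h.of_eq fun s t => ?_
  rw [meetSpine]
  split_ifs with h
  · rw [zipWith_interCode _ _ h.2]
  · rfl

theorem primrec_meetSpines : Primrec₂ meetSpines :=
  list_flatMap fst (list_flatMap (snd.comp fst) (primrec_meetSpine.comp (snd.comp fst) snd).to₂)

theorem primrec_unfoldCode : Primrec₂ unfoldCode :=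
  list_foldl (list_tail.comp primrec_options) (list_headI.comp primrec_options)
    (primrec_meetSpines.comp (fst.comp snd) (snd.comp snd)).to₂

theorem primrec_rewriteCodes :
    Primrec fun q : List (List PSpine) × ℕ × ℕ => rewriteCodes q.1 q.2.1 q.2.2 := by
  refine Primrec.ite (Primrec.eq.comp (primrec_options.comp fst (snd.comp snd)) (const []))
    (primrec_singleton (pair (const _) (fst.comp snd))) ?_
  refine list_flatMap (primrec_unfoldCode.comp fst (snd.comp snd)) ?_
  refine (list_casesOn (α := (List (List PSpine) × ℕ × ℕ) × PSpine) (β := ℕ) (σ := List (ℕ × ℕ))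
    (f := fun q => q.2.2) (g := fun _ => [])
    (h := fun q c => [(spineCode (q.2.1, c.2), interCode q.1.2.1 c.1)])
    (snd.comp snd) (const []) ?_).to₂
  exact primrec_singleton (pair
    (primrec_spineCode.comp (pair (fst.comp (snd.comp fst)) (snd.comp snd)))
    (primrec_interCode.comp (fst.comp (snd.comp (fst.comp fst))) (fst.comp snd)))

theorem primrec_consArg : Primrec₂ consArg :=
  pair (fst.comp snd) (list_cons.comp fst (snd.comp snd))

theorem primrec_expandK : Primrec₂ expandK := by
  -- The same structural recursion, written with the list recursor.
  have h : Primrec₂ fun (X : Bool) (l : List ℕ) => (l.rec [] fun a as r =>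
      (false, [a, topCode, spineCode (X, as)]) :: r.map (consArg a) : List PSpine) := by
    refine list_rec (α := Bool × List ℕ) (β := ℕ) (σ := List PSpine) (f := fun q => q.2)
      (g := fun _ => []) (h := fun q c => (false, [c.1, topCode, spineCode (q.1, c.2.1)]) ::
        c.2.2.map (consArg c.1)) snd (const []) ?_
    refine list_cons.comp (pair (const false) (list_cons.comp (fst.comp snd)
      (primrec_pairList (const topCode)
        (primrec_spineCode.comp (pair (fst.comp fst) (fst.comp (snd.comp snd))))))) ?_
    exact list_map (snd.comp (snd.comp snd)) (primrec_consArg.comp (fst.comp (snd.comp fst)) snd)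
  refine h.of_eq fun X l => ?_
  induction l with
  | nil => rfl
  | cons a l ih => rw [expandK, ← ih]

theorem primrec_expandSLast : Primrec fun q : (List (List PSpine) × Bool) × ℕ × List ℕ =>
    expandSLast q.1.1 q.1.2 q.2.1 q.2.2 := by
  refine list_casesOn (α := (List (List PSpine) × Bool) × ℕ × List ℕ) (β := ℕ)
    (σ := List PSpine) (f := fun q => q.2.2) (g := fun _ => [])
    (h := fun q c => (rewriteCodes q.1.1 c.1 q.2.1).map fun r =>
      (true, [r.2, r.1, spineCode (q.1.2, c.2)])) (snd.comp snd) (const []) ?_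
  refine list_map (primrec_rewriteCodes.comp (pair (fst.comp (fst.comp fst))
    (pair (fst.comp snd) (fst.comp (snd.comp fst))))) ?_
  exact pair (const true) (list_cons.comp (snd.comp snd) (primrec_pairList (fst.comp snd)
    (primrec_spineCode.comp (pair (snd.comp (fst.comp (fst.comp fst))) (snd.comp (snd.comp fst))))))

theorem primrec_expandS : Primrec fun q : (List (List PSpine) × Bool) × List ℕ =>
    expandS q.1.1 q.1.2 q.2 := by
  have h : Primrec fun q : (List (List PSpine) × Bool) × List ℕ => (q.2.rec [] fun b l r =>
      expandSLast q.1.1 q.1.2 b l ++ r.map (consArg b) : List PSpine) := by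
    refine list_rec (α := (List (List PSpine) × Bool) × List ℕ) (β := ℕ) (σ := List PSpine)
      (f := fun q => q.2) (g := fun _ => [])
      (h := fun q c => expandSLast q.1.1 q.1.2 c.1 c.2.1 ++ c.2.2.map (consArg c.1))
      snd (const []) ?_
    have h1 : Primrec₂ fun (q : (List (List PSpine) × Bool) × List ℕ)
        (c : ℕ × List ℕ × List PSpine) => expandSLast q.1.1 q.1.2 c.1 c.2.1 :=
      Primrec.comp (g := fun p : ((List (List PSpine) × Bool) × List ℕ) × ℕ × List ℕ × List PSpine =>
        (p.1.1, p.2.1, p.2.2.1)) primrec_expandSLast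
        (pair (fst.comp fst) (pair (fst.comp snd) (fst.comp (snd.comp snd))))
    have h2 : Primrec₂ fun (_ : (List (List PSpine) × Bool) × List ℕ)
        (c : ℕ × List ℕ × List PSpine) => c.2.2.map (consArg c.1) :=
      list_map (snd.comp (snd.comp snd)) (primrec_consArg.comp (fst.comp (snd.comp fst)) snd)
    exact list_append.comp h1 h2
  refine h.of_eq fun q => ?_
  obtain ⟨q, l⟩ := q
  induction l with
  | nil => rfl
  | cons a l ih =>
    simp only at ih ⊢
    rw [expandS, ← ih]

theorem primrec_nextSpines : Primrec₂ nextSpines := by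
  refine list_append.comp (list_append.comp (list_append.comp ?_ ?_) ?_) ?_
  · exact list_map (list_range.comp snd) (pair (const true) (primrec_pairList
      (primrec_redCode.comp (nat_sub.comp (snd.comp fst) snd))
      (primrec_redCode.comp (succ.comp snd))))
  · exact primrec_singleton (pair (const false) (primrec_pairList (const topCode)
      (primrec_redCode.comp snd)))
  · exact list_flatMap primrec_lookup (primrec_expandK.comp (fst.comp snd) (snd.comp snd)).to₂
  · exact list_flatMap primrec_lookup (primrec_expandS.comp
      (pair (pair (fst.comp fst) (fst.comp snd)) (snd.comp snd))).to₂

theorem primrec_table : Primrec table := by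
  have h := nat_rec₁ (f := fun n T => T ++ [nextSpines T n]) [[(true, []), (false, [])]]
    (list_append.comp snd (primrec_singleton (primrec_nextSpines.comp snd fst)))
  refine h.of_eq fun n => ?_
  induction n with
  | zero => rfl
  | succ n ih => rw [table, ← ih]

theorem primrec_spineMonomial : Primrec spineMonomial :=
  list_flatMap snd (primrec_pairList (const _) (sumInr.comp snd)).to₂

theorem primrec_expandCode : Primrec₂ expandCode := by
  have h1 : Primrec₂ fun (_ : List (List PSpine)) (a : ℕ) => (dec a).1 :=
    fst.comp (primrec_dec.comp snd)
  have h2 : Primrec₂ fun (_ : List (List PSpine)) (a : ℕ) => (dec a).1.headI :=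
    list_headI.comp h1
  refine Primrec.ite (Primrec.eq.comp (snd.comp (primrec_dec.comp snd)) (const [])) ?_
    (list_map primrec_unfoldCode (primrec_spineMonomial.comp snd).to₂)
  refine Primrec.ite (Primrec.eq.comp h1 (const [])) (const _) ?_
  refine Primrec.ite (PrimrecRel.comp (PrimrecRel.forall_mem_list Primrec.eq) h1 h2) ?_ (const [])
  refine Primrec.ite (Primrec.eq.comp h2 (const 0)) (const _) ?_
  exact list_map ((list_getD []).comp fst h2)
    (list_cons.comp (const _) (primrec_spineMonomial.comp snd)).to₂

theorem primrec_expandFactor : Primrec₂ expandFactor :=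
  sumCasesOn snd (primrec_singleton (primrec_singleton (sumInl.comp snd))).to₂
    (primrec_expandCode.comp (fst.comp fst) snd).to₂

theorem primrec_expandMonomial : Primrec₂ expandMonomial := by
  refine list_foldr (α := List (List PSpine) × Monomial) (β := ℕ ⊕ ℕ) (σ := List Monomial)
    (f := fun q => q.2) (g := fun _ => [[]])
    (h := fun q c => (expandFactor q.1 c.1).flatMap fun e => c.2.map fun m => e ++ m)
    snd (const [[]]) ?_
  refine list_flatMap (primrec_expandFactor.comp (fst.comp fst) (fst.comp snd)) ?_
  exact list_map (snd.comp (snd.comp fst)) (list_append.comp (snd.comp fst) snd)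

theorem primrec_expandSum : Primrec₂ expandSum :=
  list_flatMap snd (primrec_expandMonomial.comp (fst.comp fst) snd).to₂

theorem primrec_expansion : Primrec₂ expansion :=
  nat_iterate snd (primrec_singleton (primrec_singleton
    (sumInr.comp (primrec_redCode.comp fst))))
    (primrec_expandSum.comp (primrec_table.comp (fst.comp fst)) snd).to₂

theorem primrec_unexpanded : Primrec unexpanded :=
  list_flatMap list_flatten (sumCasesOn snd (const []).to₂ (primrec_singleton snd).to₂).to₂

/-- The code of a product depends only on the codes of its factors, so the fold can be carried out
on numbers. -/
theorem primrec_code_monomialForm : Primrec fun m : Monomial => (monomialForm m).code := by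
  have hb : Primrec fun t : ℕ => (baseForm t).code := by
    have h : Primrec fun t : ℕ => [(baseForm 0).code, (baseForm 1).code, (baseForm 2).code].getD t
        (baseForm 3).code := (list_getD _).comp (const _) .id
    refine h.of_eq fun t => ?_
    match t with
    | 0 | 1 | 2 => rfl
    | t + 3 => rfl
  have h : Primrec fun m : Monomial => m.foldr (fun f e =>
      Nat.pair 4 (Nat.pair (baseForm (f.casesOn id fun _ => 0)).code e))
      (ClosedForm.const 1).code := by
    refine list_foldr (α := Monomial) (β := ℕ ⊕ ℕ) (σ := ℕ) (f := fun m => m)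
      (g := fun _ => (ClosedForm.const 1).code)
      (h := fun _ c => Nat.pair 4 (Nat.pair (baseForm (c.1.casesOn id fun _ => 0)).code c.2))
      .id (const _) ?_
    exact Primrec₂.natPair.comp (const 4) (Primrec₂.natPair.comp
      (hb.comp (sumCasesOn (fst.comp snd) snd.to₂ (const 0).to₂)) (snd.comp snd))
  refine h.of_eq fun m => ?_
  induction m with
  | nil => rfl
  | cons f m ih =>
    rw [List.foldr_cons, ih]
    rfl

theorem primrec_code_sumForm : Primrec fun S : List Monomial => (sumForm S).code := by
  have h : Primrec fun S : List Monomial => S.foldr (fun m e =>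
      Nat.pair 2 (Nat.pair (monomialForm m).code e)) (ClosedForm.const 0).code := by
    refine list_foldr (α := List Monomial) (β := Monomial) (σ := ℕ) (f := fun S => S)
      (g := fun _ => (ClosedForm.const 0).code)
      (h := fun _ c => Nat.pair 2 (Nat.pair (monomialForm c.1).code c.2)) .id (const _) ?_
    exact Primrec₂.natPair.comp (const 2) (Primrec₂.natPair.comp
      (primrec_code_monomialForm.comp (fst.comp snd)) (snd.comp snd))
  refine h.of_eq fun S => ?_
  induction S with
  | nil => rfl
  | cons m S ih =>
    rw [List.foldr_cons, ih]
    rfl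

/-- No bound on the number of rounds is computed: testing for leftover patterns is primitive
recursive, and the search for the first success is total by `exists_unexpanded_eq_nil`. -/
theorem computable_code_closedForm : Computable fun n => (closedForm n).code := by
  have h1 : Primrec₂ fun n t => decide (unexpanded (expansion n t) = []) :=
    (PrimrecPred.decide (Primrec.eq.comp (primrec_unexpanded.comp primrec_expansion) (const [])))
  have h2 : Partrec fun n => Nat.rfind fun t =>
      Part.some (decide (unexpanded (expansion n t) = [])) :=
    Partrec.rfind h1.to_comp.partrec₂
  have h3 : Computable fun n => Nat.find (exists_unexpanded_eq_nil n) := by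
    refine h2.of_eq fun n => Part.eq_some_iff.2 (Nat.mem_rfind.2 ⟨?_, fun {m} hm => ?_⟩)
    · simpa using Nat.find_spec (exists_unexpanded_eq_nil n)
    · simpa using Nat.find_min (exists_unexpanded_eq_nil n) hm
  exact primrec_code_sumForm.to_comp.comp (primrec_expansion.to_comp.comp Computable.id h3)

end SK

theorem mainTheorem4 :
    (∀ n : ℕ, (SK.productions n).Finite) ∧
    (∀ z : ℂ, 0 < ‖z‖ → ‖z‖ < 1 / 8 →
      HasSum (fun k : ℕ => (SK.numTerms k : ℂ) * z ^ k) (SK.genC z)) ∧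
    ∃ F : ℕ → SK.ClosedForm,
      Computable (fun n : ℕ => (F n).code) ∧
      ∀ z : ℂ, 0 < ‖z‖ → ‖z‖ < 1 / 8 →
        (∀ n : ℕ, (F n).Regular z ∧
          HasSum (fun k : ℕ => (SK.numReducing n k : ℂ) * z ^ k) ((F n).eval z)) ∧
        (F 0).eval z = SK.genR0 z ∧
        ∀ n : ℕ, 1 ≤ n →
          (F n).eval z =
            1 / Complex.sqrt (1 - 4 * z - 4 * z ^ 2) *
              ∑ᶠ α ∈ SK.nonSelfReferencing n,
                z ^ α.numApp * SK.genC z ^ α.numC *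
                  ∏ i ∈ Finset.range n, (F i).eval z ^ α.numR i := by
  refine ⟨SK.finite_productions, fun z h0 hz => ?_, SK.closedForm, SK.computable_code_closedForm,
    fun z h0 hz => ?_⟩
  · have := SK.hasSum_genSet hz Set.univ
    rw [SK.genSet_univ h0 hz] at this
    simpa [SK.numTerms] using this
  -- Every value of a closed form becomes `genR`, also inside the product, so the recursion for
  -- `genR` applies literally.
  · simp only [SK.eval_closedForm h0 hz]
    exact ⟨fun n => ⟨SK.regular_closedForm h0 hz n, SK.hasSum_genSet hz {x | SK.Reduces n x}⟩,
      SK.genR_zero h0 hz, fun n hn => SK.genR_eq_finsum h0 hz hn⟩
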